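/- **Setting.** Let $d\in\mathbb N$ and $0<\varepsilon_0\le 1$; write $\langle z\rangle=\sqrt{1+|z|^2}$. A family of functions $u=u^\varepsilon$, $0<\varepsilon\le\varepsilon_0$, on $\mathbb R^{D_1}\times\dots\times\mathbb R^{D_J}$ is a symbol of class $S[(m_1,\dots,m_J);(D_1,\dots,D_J)]$ if every $u^\varepsilon$ is $C^\infty$ and every partial derivative of $u^\varepsilon$ is bounded by a constant times $\prod_j\langle z_j\rangle^{m_j}$, uniformly in $z$ and in $\varepsilon\le\varepsilon_0$; vector- and matrix-valued symbols are understood entrywise. An entry $m_j=+\infty$ means the union over all $m_j\in\mathbb R$. Let $\kappa=(X^\kappa,\Xi^\kappa)$ be a canonical transformation of $\mathbb R^d\times\mathbb R^d$ of class $\mathcal B$: a diffeomorphism whose Jacobian matrix $F^\kappa(q,p)$ is symplectic at every point and has entries in $S[0;2d]$. Let $S^\kappa$ be a real-valued action associated to $\kappa$, i.e. a differentiable function with $S^\kappa_q=-p+X^\kappa_q\Xi^\kappa$ and $S^\kappa_p=X^\kappa_p\Xi^\kappa$, where $(X_q)_{jk}=\partial_{q_j}X_k$. Let $\Theta^x,\Theta^y$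 be complex symmetric $d\times d$ matrices with positive definite real part, and $$\Phi^\kappa=S^\kappa(q,p)-p\cdot(y-q)+\Xi^\kappa(q,p)\cdot(x-X^\kappa(q,p))+\tfrac i2(y-q)\cdot\Theta^y(y-q)+\tfrac i2(x-X^\kappa(q,p))\cdot\Theta^x(x-X^\kappa(q,p)).$$ For $u\in S[(+\infty,m);(3d,d)]$ in the variables $((x,y,q),p)$, a Schwartz function $\varphi$ and an integer $n\ge 0$ with $n>m+d$, put $$[\mathcal I^\varepsilon(\kappa;u;\Theta^x,\Theta^y)\varphi](x)=\frac1{(2\pi\varepsilon)^{3d/2}}\int_{\mathbb R^{3d}}e^{\frac i\varepsilon\Phi^\kappa}(L_y^\dagger)^n[u\,\varphi(y)]\,dq\,dp\,dy,$$ $$L_y=\frac{1}{1+|\nabla_y\Phi^\kappa|^2}\left[1-i\varepsilon\nabla_y\overline{\Phi^\kappa}\cdot\nabla_y\right],$$ with $L_y^\dagger$ the transpose of $L_y$ for the bilinear pairing $\int vu\,dy$. Two symbols $u,v\in S[+\infty;4d]$ are equivalent with respect to $\kappa$, $u\sim v$, if $\mathcal I^\varepsilon(\kappa;u;\Theta^x,\Theta^y)\varphi=\mathcal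 I^\varepsilon(\kappa;v;\Theta^x,\Theta^y)\varphi$ for all $0<\varepsilon\le\varepsilon_0$ and all Schwartz functions $\varphi$, where the integrals converge absolutely and the admissible numbers $n$ may be chosen independently on the two sides. Put $\partial_z=(\Theta^y)^{-1}\partial_q-i\partial_p$, $\mathrm{div}\,V=\sum_j\partial_{z_j}V_j$ (for row or column vectors $V$), $(X^\kappa_z)_{jk}=\partial_{z_j}X^\kappa_k$, let $\dagger$ denote the transpose of a matrix, and let $$\mathcal Z(q,p)=\begin{pmatrix}i(\Theta^y)^{-1}&\mathrm{id}\end{pmatrix}F^\kappa(q,p)^\dagger\begin{pmatrix}-i\Theta^x&\mathrm{id}\end{pmatrix}^\dagger .$$ **Proposition 3.5.** Let $P(q,p,x)=\alpha(q,p)+a(q,p)\cdot x+x\cdot A(q,p)x$ be a quadratic polynomial in $x\in\mathbb R^d$ whose (possibly $\varepsilon$-dependent) coefficients $\alpha$, $a$, $A$, with values in $\mathbb C$, $\mathbb C^d$, $\mathbb C^{d\times d}$, are in $S[m_P;2d]$, and let $u\in S[m_u;2d]$ be complex-valued, where $m_P,m_u\in\mathbb R$. Then $$P\bigl(q,p,x-X^\kappa(q,p)\bigr)\,u(q,p)\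 \sim\ v_0(q,p)+\varepsilon v_1(q,p)+\varepsilon^2v_2(q,p),$$ where $v_0,v_1,v_2\in S[m_P+m_u;2d]$ are given by $$v_0=\alpha\,u,$$ $$v_1=-\mathrm{div}\left(a^\dagger\mathcal Z^{-1}u\right)+\mathrm{tr}\left(\mathcal Z^{-1}X^\kappa_zA\right)u,$$ $$v_2=\sum_{k=1}^d\mathrm{div}\left(\left(\partial_{z_k}\left[A\,\mathcal Z^{-1}e_k\,u\right]\right)^\dagger\mathcal Z^{-1}\right).$$ -/

import Mathlib

open MeasureTheory Set
open scoped ContDiff SchwartzMap Matrix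

noncomputable section

namespace SemiclassicalFIO

/-- Euclidean space `ℝ^d`. -/
abbrev E (d : ℕ) : Type := EuclideanSpace ℝ (Fin d)

/-- Phase space `T^*ℝ^d`, with points `(q, p)`. -/
abbrev Phase (d : ℕ) : Type := E d × E d

/-- The space `ℝ^{4d}`, with points `(x, y, q, p)`. -/
abbrev Full (d : ℕ) : Type := E d × E d × E d × E d

/-! ### Symbol classes -/

/-- The weight `⟨(q,p)⟩^m`. -/
def weight2 {d : ℕ} (m : ℝ) (z : Phase d) : ℝ :=
  Real.sqrt (1 + ‖z.1‖ ^ 2 + ‖z.2‖ ^ 2) ^ m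

/-- The weight `⟨(x,y,q,p)⟩^m`. -/
def weight4 {d : ℕ} (m : ℝ) (z : Full d) : ℝ :=
  Real.sqrt (1 + ‖z.1‖ ^ 2 + ‖z.2.1‖ ^ 2 + ‖z.2.2.1‖ ^ 2 + ‖z.2.2.2‖ ^ 2) ^ m

/-- The weight `⟨(x,y,q)⟩^m ⟨p⟩^{m'}`. -/
def weight31 {d : ℕ} (m m' : ℝ) (z : Full d) : ℝ :=
  Real.sqrt (1 + ‖z.1‖ ^ 2 + ‖z.2.1‖ ^ 2 + ‖z.2.2.1‖ ^ 2) ^ m *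
    Real.sqrt (1 + ‖z.2.2.2‖ ^ 2) ^ m'

/-- `u` is a family of smooth functions, indexed by `0 < ε ≤ ε₀`, all of whose derivatives are
bounded by a multiple of the weight `w`, uniformly in `ε`. Values of `u ε` for other `ε` are
irrelevant. -/
def IsSymbol {V : Type*} [NormedAddCommGroup V] [NormedSpace ℝ V]
    (ε₀ : ℝ) (w : V → ℝ) (u : ℝ → V → ℂ) : Prop :=
  (∀ ε ∈ Ioc 0 ε₀, ContDiff ℝ ∞ (u ε)) ∧
    ∀ k : ℕ, ∃ C : ℝ, ∀ ε ∈ Ioc 0 ε₀, ∀ z : V, ‖iteratedFDeriv ℝ k (u ε) z‖ ≤ C * w z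

/-- The class `S[m; 2d]` of symbols in `(q, p)`. -/
def IsSymbol2 {d : ℕ} (ε₀ m : ℝ) (u : ℝ → Phase d → ℂ) : Prop :=
  IsSymbol ε₀ (weight2 m) u

/-- The class `S[+∞; 4d]` of symbols in `(x, y, q, p)`. -/
def IsSymbol4 {d : ℕ} (ε₀ : ℝ) (u : ℝ → Full d → ℂ) : Prop :=
  ∃ m : ℝ, IsSymbol ε₀ (weight4 m) u

/-- The class `S[(+∞, m'); (3d, d)]` of symbols in `((x, y, q), p)`. -/
def IsSymbol31 {d : ℕ} (ε₀ m' : ℝ) (u : ℝ → Full d → ℂ) : Prop :=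
  ∃ m : ℝ, IsSymbol ε₀ (weight31 m m') u

/-! ### Derivatives on phase space -/

/-- `∂_{q_j} f`. -/
def dq {d : ℕ} {G : Type*} [NormedAddCommGroup G] [NormedSpace ℝ G]
    (j : Fin d) (f : Phase d → G) (z : Phase d) : G :=
  fderiv ℝ f z (EuclideanSpace.single j 1, 0)

/-- `∂_{p_j} f`. -/
def dp {d : ℕ} {G : Type*} [NormedAddCommGroup G] [NormedSpace ℝ G]
    (j : Fin d) (f : Phase d → G) (z : Phase d) : G :=
  fderiv ℝ f z (0, EuclideanSpace.single j 1)

/-- `∂_{z_j} f`, the `j`-th component of `∂_z = (Θ^y)⁻¹ ∂_q - i ∂_p`. -/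
def dz {d : ℕ} (Θy : Matrix (Fin d) (Fin d) ℂ) (j : Fin d) (f : Phase d → ℂ) (z : Phase d) : ℂ :=
  (∑ k, Θy⁻¹ j k * dq k f z) - Complex.I * dp j f z

/-- `div V = ∑_j ∂_{z_j} V_j`. -/
def divz {d : ℕ} (Θy : Matrix (Fin d) (Fin d) ℂ) (V : Phase d → Fin d → ℂ) (z : Phase d) : ℂ :=
  ∑ j, dz Θy j (fun z' => V z' j) z

/-! ### Canonical transformations and actions -/

/-- The Jacobian matrix `F^κ` of `κ = (X^κ, Ξ^κ)`, with blocks `∂X_j/∂q_k`, `∂X_j/∂p_k`,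
`∂Ξ_j/∂q_k`, `∂Ξ_j/∂p_k`. -/
def jac {d : ℕ} (κ : Phase d → Phase d) (z : Phase d) :
    Matrix (Fin d ⊕ Fin d) (Fin d ⊕ Fin d) ℝ :=
  Matrix.fromBlocks
    (Matrix.of fun j k => dq k (fun z' => (κ z').1 j) z)
    (Matrix.of fun j k => dp k (fun z' => (κ z').1 j) z)
    (Matrix.of fun j k => dq k (fun z' => (κ z').2 j) z)
    (Matrix.of fun j k => dp k (fun z' => (κ z').2 j) z)

/-- `κ` is a canonical transformation of class `𝓑`: a diffeomorphism of phase space whose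
Jacobian matrix is symplectic everywhere and has entries in `S[0; 2d]`. -/
structure IsCanonicalB {d : ℕ} (κ : Phase d ≃ Phase d) : Prop where
  contDiff : ContDiff ℝ ∞ κ
  contDiff_symm : ContDiff ℝ ∞ κ.symm
  symplectic : ∀ z, jac κ z ∈ Matrix.symplecticGroup (Fin d) ℝ
  classB : ∀ i j, IsSymbol2 1 0 (fun _ z => ((jac κ z i j : ℝ) : ℂ))

/-- `S` is an action associated to `κ`:
`S_q = -p + X_q Ξ` and `S_p = X_p Ξ`, where `(X_q)_{jk} = ∂X_k/∂q_j`. -/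
structure IsAction {d : ℕ} (κ : Phase d → Phase d) (S : Phase d → ℝ) : Prop where
  differentiable : Differentiable ℝ S
  dq_eq : ∀ z j, dq j S z = -z.2 j + ∑ k, dq j (fun z' => (κ z').1 k) z * (κ z).2 k
  dp_eq : ∀ z j, dp j S z = ∑ k, dp j (fun z' => (κ z').1 k) z * (κ z).2 k

/-- Complex symmetric matrices with positive definite real part. -/
structure IsAdmissibleMatrix {d : ℕ} (Θ : Matrix (Fin d) (Fin d) ℂ) : Prop where
  symm : Θᵀ = Θ
  re_posDef : (Θ.map Complex.re).PosDef

/-! ### Fourier integral operators -/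

/-- A real vector regarded as a complex one. -/
def cvec {d : ℕ} (v : E d) : Fin d → ℂ := fun j => ((v j : ℝ) : ℂ)

/-- The complex-valued phase function `Φ^κ(x, y, q, p; Θ^x, Θ^y)`. -/
def phase {d : ℕ} (κ : Phase d → Phase d) (S : Phase d → ℝ) (Θx Θy : Matrix (Fin d) (Fin d) ℂ)
    (x y q p : E d) : ℂ :=
  (S (q, p) : ℂ) - cvec p ⬝ᵥ cvec (y - q) + cvec (κ (q, p)).2 ⬝ᵥ cvec (x - (κ (q, p)).1)
    + Complex.I / 2 * (cvec (y - q) ⬝ᵥ Θy *ᵥ cvec (y - q))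
    + Complex.I / 2 * (cvec (x - (κ (q, p)).1) ⬝ᵥ Θx *ᵥ cvec (x - (κ (q, p)).1))

/-- The partial derivative `∂f/∂y_j` of a function on `ℝ^d`. -/
def dy {d : ℕ} (j : Fin d) (f : E d → ℂ) (y : E d) : ℂ :=
  fderiv ℝ f y (EuclideanSpace.single j 1)

/-- The transpose `L^†`, with respect to the bilinear pairing `∫ v u dy`, of the operator
`L v = (1 + |∇ψ|²)⁻¹ (v - i ε (∇ (conj ψ)) · ∇ v)`, that is
`L^† f = f / (1 + |∇ψ|²) + i ε div (f ∇ (conj ψ) / (1 + |∇ψ|²))`. -/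
def Ladj {d : ℕ} (ε : ℝ) (ψ : E d → ℂ) (f : E d → ℂ) (y : E d) : ℂ :=
  f y / ((1 + ∑ j, ‖dy j ψ y‖ ^ 2 : ℝ) : ℂ)
    + Complex.I * ε * ∑ j, dy j (fun y' =>
        dy j (fun y'' => (starRingEnd ℂ) (ψ y'')) y' * f y' /
          ((1 + ∑ l, ‖dy l ψ y'‖ ^ 2 : ℝ) : ℂ)) y

/-- The integrand `e^{iΦ/ε} (L_y^†)^n [u(x,y,q,p) φ(y)]` as a function of `(q, p, y)`;
here `u` is the symbol at the fixed value of `ε`. -/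
def fioIntegrand {d : ℕ} (κ : Phase d → Phase d) (S : Phase d → ℝ)
    (Θx Θy : Matrix (Fin d) (Fin d) ℂ) (n : ℕ) (ε : ℝ) (u : Full d → ℂ) (φ : 𝓢(E d, ℂ))
    (x : E d) (w : E d × E d × E d) : ℂ :=
  Complex.exp (Complex.I / ε * phase κ S Θx Θy x w.2.2 w.1 w.2.1) *
    (Ladj ε (fun y => phase κ S Θx Θy x y w.1 w.2.1))^[n]
      (fun y => u (x, y, w.1, w.2.1) * φ y) w.2.2

/-- The Fourier integral operator `𝓘^ε(κ; u; Θ^x, Θ^y)`, applied to `φ` and evaluated at `x`,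
written with `n` regularising powers of `L_y^†`. -/
def fio {d : ℕ} (κ : Phase d → Phase d) (S : Phase d → ℝ)
    (Θx Θy : Matrix (Fin d) (Fin d) ℂ) (n : ℕ) (ε : ℝ) (u : Full d → ℂ) (φ : 𝓢(E d, ℂ))
    (x : E d) : ℂ :=
  (((2 * Real.pi * ε) ^ (3 * (d : ℝ) / 2) : ℝ) : ℂ)⁻¹ *
    ∫ w : E d × E d × E d, fioIntegrand κ S Θx Θy n ε u φ x w

/-- Equivalence `u ∼ v` with respect to `κ` of two symbols in `S[+∞; 4d]`: for all `0 < ε ≤ ε₀`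
the Fourier integral operators agree on Schwartz functions. Each operator may be written with
any number `n > m + d` of powers of `L_y^†`, where the symbol is in `S[(+∞, m); (3d, d)]`; the
integrals converge absolutely and the values agree for all these choices. -/
structure SymbolEquiv {d : ℕ} (κ : Phase d → Phase d) (S : Phase d → ℝ)
    (Θx Θy : Matrix (Fin d) (Fin d) ℂ) (ε₀ : ℝ) (u v : ℝ → Full d → ℂ) : Prop where
  left_mem : IsSymbol4 ε₀ u
  right_mem : IsSymbol4 ε₀ v
  eq : ∀ (m m' : ℝ) (n n' : ℕ), IsSymbol31 ε₀ m u → m + d < n → IsSymbol31 ε₀ m' v → m' + d < n' →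
    ∀ ε ∈ Ioc 0 ε₀, ∀ (φ : 𝓢(E d, ℂ)) (x : E d),
      Integrable (fioIntegrand κ S Θx Θy n ε (u ε) φ x) ∧
      Integrable (fioIntegrand κ S Θx Θy n' ε (v ε) φ x) ∧
      fio κ S Θx Θy n ε (u ε) φ x = fio κ S Θx Θy n' ε (v ε) φ x

/-! ### The matrix `𝒵` and the coefficients of the expansion -/

/-- `X^κ_z`, with entries `(X^κ_z)_{jk} = ∂_{z_j} X^κ_k`. -/
def Xz {d : ℕ} (κ : Phase d → Phase d) (Θy : Matrix (Fin d) (Fin d) ℂ) (z : Phase d) :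
    Matrix (Fin d) (Fin d) ℂ :=
  Matrix.of fun j k => dz Θy j (fun z' => (((κ z').1 k : ℝ) : ℂ)) z

/-- `𝒵 = (i (Θ^y)⁻¹  id) (F^κ)^† (-i Θ^x  id)^†`, which is `X^κ_z Θ^x + i Ξ^κ_z`. -/
def calZ {d : ℕ} (κ : Phase d → Phase d) (Θx Θy : Matrix (Fin d) (Fin d) ℂ) (z : Phase d) :
    Matrix (Fin d) (Fin d) ℂ :=
  let Ft : Matrix (Fin d ⊕ Fin d) (Fin d ⊕ Fin d) ℂ := (jac κ z)ᵀ.map (fun r => (r : ℂ))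
  let B : Matrix (Fin d) (Fin d ⊕ Fin d) ℂ := Matrix.fromCols (Complex.I • Θy⁻¹) 1
  let C : Matrix (Fin d) (Fin d ⊕ Fin d) ℂ := Matrix.fromCols (-(Complex.I • Θx)) 1
  B * Ft * Cᵀ

/-- `P(q, p, ξ) = α(q, p) + a(q, p) · ξ + ξ · A(q, p) ξ` for real `ξ`. -/
def quadPoly {d : ℕ} (α : Phase d → ℂ) (a : Phase d → Fin d → ℂ)
    (A : Phase d → Matrix (Fin d) (Fin d) ℂ) (z : Phase d) (ξ : E d) : ℂ :=
  α z + a z ⬝ᵥ cvec ξ + cvec ξ ⬝ᵥ A z *ᵥ cvec ξ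

/-- `v₀ = α u`. -/
def v0 {d : ℕ} (α u : Phase d → ℂ) (z : Phase d) : ℂ :=
  α z * u z

/-- `v₁ = -div (a^† 𝒵⁻¹ u) + tr (𝒵⁻¹ X^κ_z A) u`. -/
def v1 {d : ℕ} (κ : Phase d → Phase d) (Θx Θy : Matrix (Fin d) (Fin d) ℂ)
    (a : Phase d → Fin d → ℂ) (A : Phase d → Matrix (Fin d) (Fin d) ℂ)
    (u : Phase d → ℂ) (z : Phase d) : ℂ :=
  -divz Θy (fun z' => u z' • (a z' ᵥ* (calZ κ Θx Θy z')⁻¹)) z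
    + ((calZ κ Θx Θy z)⁻¹ * Xz κ Θy z * A z).trace * u z

/-- `v₂ = ∑_k div ((∂_{z_k} [A 𝒵⁻¹ e_k u])^† 𝒵⁻¹)`. -/
def v2 {d : ℕ} (κ : Phase d → Phase d) (Θx Θy : Matrix (Fin d) (Fin d) ℂ)
    (A : Phase d → Matrix (Fin d) (Fin d) ℂ) (u : Phase d → ℂ) (z : Phase d) : ℂ :=
  ∑ k, divz Θy (fun z' =>
    (fun i => dz Θy k (fun z'' =>
      (u z'' • ((A z'' * (calZ κ Θx Θy z'')⁻¹) *ᵥ Pi.single k 1)) i) z')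
      ᵥ* (calZ κ Θx Θy z')⁻¹) z

end SemiclassicalFIO

end

/-! The idea is to turn each factor `x - X` into `ε` times a derivative and to integrate by parts.

For fixed `(q, p)` the operator `L_y^†` is the transpose of an operator fixing the oscillating
exponential, so its powers disappear once the integral over `y` is done. What remains (`fio_eq`)
pairs the symbol, as far as it does not depend on `y`, with one function `g` on phase space,
`amplitude`: the exponential of the `y`-independent part of the phase times a Gaussian wave packet
transform of `φ`. The powers of `L_y^†` serve to give absolute convergence; they help because `1 +
|∇_y Φ|²` is comparable to `1 + |p|² + |y - q|²` (`exists_le_phaseDenom`).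

The operator `∂_z` is chosen so that the contributions of `y - q` to `∂_z Φ` cancel. With the
defining equations of the action this leaves `∂_z Φ = -i 𝒵 (x - X)`, hence `ε ∂_z g = 𝒵 (x - X) g`
(`dz_amplitude`). The matrix `𝒵` is invertible with a bounded inverse (`exists_norm_sq_le_calZ`): a
symplectic matrix preserves the imaginary part of a pairing which the positivity of `Re Θ^x` bounds
from below and that of `Re Θ^y` bounds from above in terms of `𝒵 v`. Cramer's rule then makes `𝒵⁻¹`
a symbol of order zero (`IsCanonicalB.symbol_calZ_inv`).

Since `g` and its first derivatives decrease rapidly (`isTestAmplitude_amplitude`), `b · (x - X)`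
may be replaced under the integral by `-ε div (b^† 𝒵⁻¹)` (`integral_dotProduct_mul_amplitude`). One
use settles the linear term of `P`. In the quadratic term the divergence either differentiates the
second factor `x - X`, which yields the trace in `v₁`, or leaves it in place; a second integration
by parts then gives `ε² v₂` (`integral_quadPoly_mul_amplitude`). -/

namespace SemiclassicalFIO

/-! ### Calculus of symbols with a general weight -/

section SymbolCalculus

variable {V W : Type*} [NormedAddCommGroup V] [NormedSpace ℝ V]
  [NormedAddCommGroup W] [NormedSpace ℝ W] {ε₀ : ℝ} {w w' : V → ℝ} {u v : ℝ → V → ℂ}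

theorem IsSymbol.contDiff (hu : IsSymbol ε₀ w u) {ε : ℝ} (hε : ε ∈ Ioc 0 ε₀) :
    ContDiff ℝ ∞ (u ε) := hu.1 ε hε

theorem IsSymbol.differentiable (hu : IsSymbol ε₀ w u) {ε : ℝ} (hε : ε ∈ Ioc 0 ε₀) :
    Differentiable ℝ (u ε) := (hu.1 ε hε).differentiable (by simp)

theorem natCast_le_infty (k : ℕ) : ((k : ℕ∞) : WithTop ℕ∞) ≤ ∞ := by
  exact_mod_cast le_top

theorem IsSymbol.congr (hu : IsSymbol ε₀ w u) (h : ∀ ε ∈ Ioc 0 ε₀, ∀ z, u ε z = v ε z) :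
    IsSymbol ε₀ w v := by
  have h' : ∀ ε ∈ Ioc 0 ε₀, u ε = v ε := fun ε hε => funext (h ε hε)
  refine ⟨fun ε hε => h' ε hε ▸ hu.1 ε hε, fun k => ?_⟩
  obtain ⟨C, hC⟩ := hu.2 k
  exact ⟨C, fun ε hε z => h' ε hε ▸ hC ε hε z⟩

theorem IsSymbol.mono (hu : IsSymbol ε₀ w u) (K : ℝ) (hw : ∀ z, 0 ≤ w z)
    (h : ∀ z, w z ≤ K * w' z) : IsSymbol ε₀ w' u := by
  refine ⟨hu.1, fun k => ?_⟩
  obtain ⟨C, hC⟩ := hu.2 k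
  refine ⟨|C| * K, fun ε hε z => (hC ε hε z).trans ?_⟩
  calc C * w z ≤ |C| * w z := mul_le_mul_of_nonneg_right (le_abs_self C) (hw z)
    _ ≤ |C| * (K * w' z) := mul_le_mul_of_nonneg_left (h z) (abs_nonneg C)
    _ = _ := by ring

theorem IsSymbol.restrict (hu : IsSymbol ε₀ w u) {ε₁ : ℝ} (h : ε₁ ≤ ε₀) : IsSymbol ε₁ w u :=
  ⟨fun ε hε => hu.1 ε ⟨hε.1, hε.2.trans h⟩, fun k => (hu.2 k).imp fun _ hC ε hε =>
    hC ε ⟨hε.1, hε.2.trans h⟩⟩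

/-- Once `ε` is fixed, the constant family lets the uniform calculus be reused for a single
function. -/
theorem IsSymbol.freeze (hu : IsSymbol ε₀ w u) {ε : ℝ} (hε : ε ∈ Ioc 0 ε₀) (ε₁ : ℝ) :
    IsSymbol ε₁ w (fun _ => u ε) :=
  ⟨fun _ _ => hu.1 ε hε, fun k => (hu.2 k).imp fun _ hC _ _ => hC ε hε⟩

theorem IsSymbol.norm_le (hu : IsSymbol ε₀ w u) :
    ∃ C : ℝ, ∀ ε ∈ Ioc 0 ε₀, ∀ z : V, ‖u ε z‖ ≤ C * w z := by
  obtain ⟨C, hC⟩ := hu.2 0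
  exact ⟨C, fun ε hε z => by simpa using hC ε hε z⟩

theorem isSymbol_const (c : ℝ → ℂ) (K : ℝ) (hc : ∀ ε ∈ Ioc 0 ε₀, ‖c ε‖ ≤ K) :
    IsSymbol ε₀ (fun _ : V => 1) (fun ε _ => c ε) := by
  refine ⟨fun _ _ => contDiff_const, fun k => ⟨max K 0, fun ε hε z => ?_⟩⟩
  rcases Nat.eq_zero_or_pos k with rfl | hk
  · simpa using Or.inl (hc ε hε)
  · simp [iteratedFDeriv_const_of_ne hk.ne']

theorem IsSymbol.add (hu : IsSymbol ε₀ w u) (hv : IsSymbol ε₀ w v) :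
    IsSymbol ε₀ w (fun ε z => u ε z + v ε z) := by
  refine ⟨fun ε hε => (hu.1 ε hε).add (hv.1 ε hε), fun k => ?_⟩
  obtain ⟨C, hC⟩ := hu.2 k
  obtain ⟨D, hD⟩ := hv.2 k
  refine ⟨C + D, fun ε hε z => ?_⟩
  change ‖iteratedFDeriv ℝ k (u ε + v ε) z‖ ≤ _
  rw [iteratedFDeriv_add_apply ((hu.1 ε hε).of_le (natCast_le_infty k)).contDiffAt
    ((hv.1 ε hε).of_le (natCast_le_infty k)).contDiffAt, add_mul]
  exact (norm_add_le _ _).trans (add_le_add (hC ε hε z) (hD ε hε z))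

theorem IsSymbol.zero : IsSymbol ε₀ w (fun _ _ => 0) :=
  ⟨fun _ _ => contDiff_const, fun k => ⟨0, fun ε _ z => by
    have : (fun _ : V => (0 : ℂ)) = 0 := rfl
    rw [this, iteratedFDeriv_zero]; simp⟩⟩

theorem IsSymbol.sum {ι : Type*} {f : ι → ℝ → V → ℂ} {s : Finset ι}
    (h : ∀ i ∈ s, IsSymbol ε₀ w (f i)) : IsSymbol ε₀ w (fun ε z => ∑ i ∈ s, f i ε z) := by
  classical
  induction s using Finset.induction_on with
  | empty => simpa using IsSymbol.zero
  | insert i s hi ih =>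
    simp only [Finset.sum_insert hi]
    exact (h i (by simp)).add (ih fun j hj => h j (by simp [hj]))

theorem IsSymbol.mul (hu : IsSymbol ε₀ w u) (hv : IsSymbol ε₀ w' v) :
    IsSymbol ε₀ (fun z => w z * w' z) (fun ε z => u ε z * v ε z) := by
  refine ⟨fun ε hε => (hu.1 ε hε).mul (hv.1 ε hε), fun k => ?_⟩
  choose C hC using hu.2
  choose D hD using hv.2
  refine ⟨∑ i ∈ Finset.range (k + 1), k.choose i * C i * D (k - i), fun ε hε z => ?_⟩
  refine (norm_iteratedFDeriv_mul_le (hu.1 ε hε) (hv.1 ε hε) z (natCast_le_infty k)).trans ?_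
  rw [Finset.sum_mul]
  refine Finset.sum_le_sum fun i _ => ?_
  calc _ ≤ (k.choose i : ℝ) * (C i * w z) * (D (k - i) * w' z) := by
        have h1 := hC i ε hε z
        have h2 := hD (k - i) ε hε z
        have h3 := (norm_nonneg _).trans h1
        gcongr
    _ = _ := by ring

theorem IsSymbol.const_mul (hu : IsSymbol ε₀ w u) (c : ℂ) :
    IsSymbol ε₀ w (fun ε z => c * u ε z) := by
  simpa using (isSymbol_const (V := V) (ε₀ := ε₀) (fun _ => c) ‖c‖ (fun _ _ => le_rfl)).mul hu

theorem IsSymbol.neg (hu : IsSymbol ε₀ w u) : IsSymbol ε₀ w (fun ε z => -u ε z) := by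
  simpa using hu.const_mul (-1)

theorem IsSymbol.sub (hu : IsSymbol ε₀ w u) (hv : IsSymbol ε₀ w v) :
    IsSymbol ε₀ w (fun ε z => u ε z - v ε z) := by
  simpa [sub_eq_add_neg] using hu.add hv.neg

theorem IsSymbol.prod {ι : Type*} {f : ι → ℝ → V → ℂ} {s : Finset ι}
    (h : ∀ i ∈ s, IsSymbol ε₀ (fun _ => 1) (f i)) :
    IsSymbol ε₀ (fun _ => 1) (fun ε z => ∏ i ∈ s, f i ε z) := by
  classical
  induction s using Finset.induction_on with
  | empty => simpa using isSymbol_const (V := V) (fun _ => 1) 1 (by simp)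
  | insert i s hi ih =>
    simp only [Finset.prod_insert hi]
    simpa using (h i (by simp)).mul (ih fun j hj => h j (by simp [hj]))

theorem IsSymbol.fderiv_apply (hu : IsSymbol ε₀ w u) (e : V) :
    IsSymbol ε₀ w (fun ε z => fderiv ℝ (u ε) z e) := by
  have hd : ∀ ε ∈ Ioc 0 ε₀, ContDiff ℝ ∞ (fderiv ℝ (u ε)) := fun ε hε =>
    (hu.1 ε hε).fderiv_right (m := ∞) (by simp)
  refine ⟨fun ε hε => (hd ε hε).clm_apply contDiff_const, fun k => ?_⟩
  obtain ⟨C, hC⟩ := hu.2 (k + 1)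
  refine ⟨‖e‖ * C, fun ε hε z => ?_⟩
  refine (norm_iteratedFDeriv_clm_apply_const (hd ε hε).contDiffAt (natCast_le_infty k)).trans ?_
  rw [norm_iteratedFDeriv_fderiv, mul_assoc]
  exact mul_le_mul_of_nonneg_left (hC ε hε z) (norm_nonneg _)

theorem IsSymbol.comp_affine (hu : IsSymbol ε₀ w u) (L : W →L[ℝ] V) (c : V) :
    IsSymbol ε₀ (fun z => w (L z + c)) (fun ε z => u ε (L z + c)) := by
  have hs : ∀ ε ∈ Ioc 0 ε₀, ContDiff ℝ ∞ (fun z => u ε (z + c)) := fun ε hε =>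
    (hu.1 ε hε).comp (contDiff_id.add contDiff_const)
  refine ⟨fun ε hε => (hs ε hε).comp L.contDiff, fun k => ?_⟩
  obtain ⟨C, hC⟩ := hu.2 k
  refine ⟨C * ‖L‖ ^ k, fun ε hε z => ?_⟩
  have h1 := L.iteratedFDeriv_comp_right (hs ε hε) z (natCast_le_infty k)
  have h2 : (fun z => u ε (z + c)) ∘ L = fun z => u ε (L z + c) := rfl
  rw [h2, iteratedFDeriv_comp_add_right] at h1
  rw [h1]
  refine (ContinuousMultilinearMap.norm_compContinuousLinearMap_le _ _).trans ?_
  rw [Finset.prod_const, Finset.card_univ, Fintype.card_fin]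
  calc _ ≤ (C * w (L z + c)) * ‖L‖ ^ k := by
        gcongr; exact hC ε hε _
    _ = _ := by ring

/-- The lower bound gives the estimate of order zero. Higher orders follow by strong induction from
`d(1/u) = -u⁻² du`, where Leibniz' rule involves only derivatives of `1/u` of lower order. -/
theorem IsSymbol.inv (hu : IsSymbol ε₀ w u) (hw : ∀ z, 0 < w z) {c : ℝ} (hc : 0 < c)
    (h : ∀ ε ∈ Ioc 0 ε₀, ∀ z, c * w z ≤ ‖u ε z‖) :
    IsSymbol ε₀ (fun z => (w z)⁻¹) (fun ε z => (u ε z)⁻¹) := by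
  have hne : ∀ ε ∈ Ioc 0 ε₀, ∀ z, u ε z ≠ 0 := fun ε hε z =>
    norm_pos_iff.1 ((mul_pos hc (hw z)).trans_le (h ε hε z))
  have hi : ∀ ε ∈ Ioc 0 ε₀, ContDiff ℝ ∞ (fun z => (u ε z)⁻¹) := fun ε hε =>
    (hu.1 ε hε).inv (hne ε hε)
  have hfd : ∀ ε ∈ Ioc 0 ε₀, fderiv ℝ (fun z => (u ε z)⁻¹) =
      fun z => (-(u ε z)⁻¹ * (u ε z)⁻¹) • fderiv ℝ (u ε) z := by
    intro ε hε
    ext z e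
    have h1 : HasFDerivAt (u ε) (fderiv ℝ (u ε) z) z := (hu.differentiable hε z).hasFDerivAt
    have h2 := (hasDerivAt_inv (hne ε hε z)).comp_hasFDerivAt z h1
    have h3 : (Inv.inv ∘ u ε) = fun z => (u ε z)⁻¹ := rfl
    rw [h3] at h2
    rw [h2.fderiv]
    simp [pow_two]
  refine ⟨hi, fun k => ?_⟩
  choose D hD using hu.2
  induction k using Nat.strong_induction_on with
  | _ k ih =>
    rcases Nat.eq_zero_or_pos k with rfl | hk
    · refine ⟨c⁻¹, fun ε hε z => ?_⟩
      rw [norm_iteratedFDeriv_zero, norm_inv, ← mul_inv]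
      exact inv_anti₀ (mul_pos hc (hw z)) (h ε hε z)
    · obtain ⟨k, rfl⟩ : ∃ l, k = l + 1 := ⟨k - 1, by omega⟩
      -- The condition `i ≤ k` sits under the existential so that `choose` gives constants for all
      -- `i`.
      have ih' : ∀ i, ∃ C, i ≤ k → ∀ ε ∈ Ioc 0 ε₀, ∀ z,
          ‖iteratedFDeriv ℝ i (fun z => (u ε z)⁻¹) z‖ ≤ C * (w z)⁻¹ := by
        intro i
        by_cases hik : i ≤ k
        · obtain ⟨C, hC⟩ := ih i (by omega)
          exact ⟨C, fun _ => hC⟩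
        · exact ⟨0, fun h => absurd h hik⟩
      choose C hC using ih'
      have hsq : ∀ i ≤ k, ∀ ε ∈ Ioc 0 ε₀, ∀ z,
          ‖iteratedFDeriv ℝ i (fun z => -(u ε z)⁻¹ * (u ε z)⁻¹) z‖ ≤
            (∑ j ∈ Finset.range (i + 1), i.choose j * C j * C (i - j)) * ((w z)⁻¹ * (w z)⁻¹) := by
        intro i hik ε hε z
        refine (norm_iteratedFDeriv_mul_le (hi ε hε).neg (hi ε hε) z (natCast_le_infty i)).trans ?_
        rw [Finset.sum_mul]
        refine Finset.sum_le_sum fun j hj => ?_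
        have hj' : j ≤ i := Nat.lt_succ_iff.1 (Finset.mem_range.1 hj)
        have e1 : (fun z => -(u ε z)⁻¹) = -fun z => (u ε z)⁻¹ := rfl
        rw [e1, iteratedFDeriv_neg, Pi.neg_apply, norm_neg]
        have h1 := hC j (hj'.trans hik) ε hε z
        have h2 := hC (i - j) ((Nat.sub_le _ _).trans hik) ε hε z
        have h3 := (norm_nonneg _).trans h1
        calc _ ≤ (i.choose j : ℝ) * (C j * (w z)⁻¹) * (C (i - j) * (w z)⁻¹) := by gcongr
          _ = _ := by ring
      refine ⟨∑ i ∈ Finset.range (k + 1), k.choose i *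
        (∑ j ∈ Finset.range (i + 1), i.choose j * C j * C (i - j)) * D (k - i + 1),
        fun ε hε z => ?_⟩
      have hd : ContDiff ℝ ∞ (fderiv ℝ (u ε)) := (hu.1 ε hε).fderiv_right (m := ∞) (by simp)
      rw [← norm_iteratedFDeriv_fderiv, hfd ε hε]
      refine (norm_iteratedFDeriv_smul_le ((hi ε hε).neg.mul (hi ε hε)) hd z
        (natCast_le_infty k)).trans ?_
      rw [Finset.sum_mul]
      refine Finset.sum_le_sum fun i hik => ?_
      have hik' : i ≤ k := Nat.lt_succ_iff.1 (Finset.mem_range.1 hik)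
      rw [norm_iteratedFDeriv_fderiv]
      have h1 := hsq i hik' ε hε z
      have h2 := hD (k - i + 1) ε hε z
      have h3 := (norm_nonneg _).trans h1
      calc _ ≤ (k.choose i : ℝ) * ((∑ j ∈ Finset.range (i + 1), i.choose j * C j * C (i - j)) *
              ((w z)⁻¹ * (w z)⁻¹)) * (D (k - i + 1) * w z) := by gcongr
        _ = _ := by
          have := (hw z).ne'
          field_simp

/-- A smooth family is a symbol if it is bounded by the weight and if its derivatives along the
vectors `e i` of a finite system with dual functionals `ℓ i` are symbols. -/
theorem isSymbol_of_fderiv {ι : Type*} [Fintype ι] (e : ι → V) (ℓ : ι → V →L[ℝ] ℝ)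
    (hb : ∀ z, ∑ i, ℓ i z • e i = z) (hs : ∀ ε ∈ Ioc 0 ε₀, ContDiff ℝ ∞ (u ε))
    (h0 : ∃ C : ℝ, ∀ ε ∈ Ioc 0 ε₀, ∀ z : V, ‖u ε z‖ ≤ C * w z)
    (h1 : ∀ i, IsSymbol ε₀ w (fun ε z => fderiv ℝ (u ε) z (e i))) : IsSymbol ε₀ w u := by
  refine ⟨hs, fun k => ?_⟩
  rcases k with _ | k
  · obtain ⟨C, hC⟩ := h0
    exact ⟨C, fun ε hε z => by simpa using hC ε hε z⟩
  choose C hC using fun i => (h1 i).2 k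
  refine ⟨∑ i, ‖(ContinuousLinearMap.smulRightL ℝ V ℂ (ℓ i))‖ * C i, fun ε hε z => ?_⟩
  -- The differential is rebuilt from the partial derivatives by the dual system, which reduces
  -- order `k + 1` of `u ε` to order `k` of its partials.
  have hfd : fderiv ℝ (u ε) = fun z => ∑ i,
      ContinuousLinearMap.smulRightL ℝ V ℂ (ℓ i) (fderiv ℝ (u ε) z (e i)) := by
    ext z y
    conv_lhs => rw [← hb y]
    simp
  have hsum := iteratedFDeriv_sum (𝕜 := ℝ) (i := k) (u := Finset.univ) (f := fun i z =>
    ContinuousLinearMap.smulRightL ℝ V ℂ (ℓ i) (fderiv ℝ (u ε) z (e i))) (fun i _ =>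
    ((ContinuousLinearMap.contDiff _).comp ((h1 i).1 ε hε)).of_le (natCast_le_infty k))
  rw [← norm_iteratedFDeriv_fderiv, hfd, hsum, Finset.sum_apply, Finset.sum_mul]
  refine (norm_sum_le _ _).trans (Finset.sum_le_sum fun i _ => ?_)
  refine ((ContinuousLinearMap.smulRightL ℝ V ℂ (ℓ i)).norm_iteratedFDeriv_comp_left
    ((h1 i).1 ε hε).contDiffAt (natCast_le_infty k)).trans ?_
  rw [mul_assoc]
  exact mul_le_mul_of_nonneg_left (hC i ε hε z) (norm_nonneg _)

end SymbolCalculus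

/-! ### Uniform invertibility of `𝒵` -/

section LinearAlgebra

variable {d : ℕ}

/-- The constant is the minimum of the quadratic form on the compact unit sphere; homogeneity
extends the bound to all vectors. -/
theorem exists_pos_le_of_posDef {R : Matrix (Fin d) (Fin d) ℝ} (hR : R.PosDef) :
    ∃ c : ℝ, 0 < c ∧ ∀ x : Fin d → ℝ, c * ∑ i, x i ^ 2 ≤ x ⬝ᵥ R *ᵥ x := by
  by_cases hne : (Metric.sphere (0 : E d) 1).Nonempty
  · have hcont : Continuous fun x : E d => (fun i => x i) ⬝ᵥ R *ᵥ (fun i => x i) := by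
      simp only [dotProduct, Matrix.mulVec]
      fun_prop
    obtain ⟨x₀, hx₀, hmin⟩ := (isCompact_sphere (0 : E d) 1).exists_isMinOn hne hcont.continuousOn
    have hx₀' : x₀ ≠ 0 := by
      rintro rfl
      simp at hx₀
    have hpos := hR.dotProduct_mulVec_pos (x := fun i => x₀ i) (by
      intro h
      exact hx₀' (by ext i; exact congrFun h i))
    refine ⟨_, hpos, fun x => ?_⟩
    by_cases hx : x = 0
    · simp [hx]
    set y : E d := WithLp.toLp 2 x
    have hy : y ≠ 0 := by
      intro h
      apply hx
      ext i
      exact congrArg (fun v : E d => v i) h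
    have hy' : 0 < ‖y‖ := norm_pos_iff.2 hy
    have hmem : ‖y‖⁻¹ • y ∈ Metric.sphere (0 : E d) 1 := by
      simp [norm_smul, hy'.ne']
    have := hmin hmem
    have e1 : (fun i => (‖y‖⁻¹ • y) i) = ‖y‖⁻¹ • x := by
      ext i; simp [y]
    have e2 : ∑ i, x i ^ 2 = ‖y‖ ^ 2 := by
      rw [EuclideanSpace.norm_sq_eq]
      simp [y]
    simp only [mem_ofPred_eq, e1, Matrix.mulVec_smul, smul_dotProduct, dotProduct_smul,
      smul_eq_mul] at this
    rw [e2]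
    have h3 : star (fun i => x₀ i) = fun i => x₀ i := by ext i; simp
    rw [h3]
    calc _ ≤ (‖y‖⁻¹ * (‖y‖⁻¹ * x ⬝ᵥ R *ᵥ x)) * ‖y‖ ^ 2 := by gcongr
      _ = _ := by field_simp
  -- The sphere is empty only when every vector vanishes, that is for `d = 0`.
  · refine ⟨1, one_pos, fun x => ?_⟩
    have hx : x = 0 := by
      by_contra hx
      apply hne
      set y : E d := WithLp.toLp 2 x
      have hy : y ≠ 0 := by
        intro h
        apply hx
        ext i
        exact congrArg (fun v : E d => v i) h
      exact ⟨‖y‖⁻¹ • y, by simp [norm_smul, norm_pos_iff.2 hy |>.ne']⟩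
    simp [hx]

/-- The imaginary part of `Θ` enters only against an expression antisymmetric in the two indices, so
the symmetry of `Θ` removes it. -/
theorem IsAdmissibleMatrix.re_form {Θ : Matrix (Fin d) (Fin d) ℂ} (h : IsAdmissibleMatrix Θ)
    (v : Fin d → ℂ) : (star v ⬝ᵥ Θ *ᵥ v).re =
      (fun i => (v i).re) ⬝ᵥ Θ.map Complex.re *ᵥ (fun i => (v i).re) +
      (fun i => (v i).im) ⬝ᵥ Θ.map Complex.re *ᵥ (fun i => (v i).im) := by
  have hsymm : ∀ i j, Θ i j = Θ j i := fun i j => congrFun (congrFun h.symm.symm i) j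
  have h0 : ∑ i, ∑ j, (Θ i j).im * ((v i).re * (v j).im - (v i).im * (v j).re) = 0 := by
    have : ∑ i, ∑ j, (Θ i j).im * ((v i).re * (v j).im - (v i).im * (v j).re) =
        -∑ i, ∑ j, (Θ i j).im * ((v i).re * (v j).im - (v i).im * (v j).re) := by
      conv_lhs => rw [Finset.sum_comm]
      simp_rw [← Finset.sum_neg_distrib]
      refine Finset.sum_congr rfl fun i _ => Finset.sum_congr rfl fun j _ => ?_
      rw [hsymm j i]; ring
    linarith
  rw [← sub_eq_zero, ← neg_eq_zero, ← h0]
  simp only [dotProduct, Matrix.mulVec, Matrix.map_apply, Finset.mul_sum, Complex.re_sum,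
    ← Finset.sum_add_distrib, ← Finset.sum_sub_distrib, ← Finset.sum_neg_distrib]
  refine Finset.sum_congr rfl fun i _ => Finset.sum_congr rfl fun j _ => ?_
  simp
  ring

theorem IsAdmissibleMatrix.exists_pos_le {Θ : Matrix (Fin d) (Fin d) ℂ}
    (h : IsAdmissibleMatrix Θ) :
    ∃ c : ℝ, 0 < c ∧ ∀ v : Fin d → ℂ, c * ∑ i, ‖v i‖ ^ 2 ≤ (star v ⬝ᵥ Θ *ᵥ v).re := by
  obtain ⟨c, hc, H⟩ := exists_pos_le_of_posDef h.re_posDef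
  refine ⟨c, hc, fun v => ?_⟩
  rw [h.re_form]
  refine le_trans (le_of_eq ?_) (add_le_add (H _) (H _))
  rw [← mul_add, ← Finset.sum_add_distrib]
  congr 1
  refine Finset.sum_congr rfl fun i _ => ?_
  rw [← Complex.normSq_eq_norm_sq, Complex.normSq_apply]; ring

theorem IsAdmissibleMatrix.isUnit_det {Θ : Matrix (Fin d) (Fin d) ℂ}
    (h : IsAdmissibleMatrix Θ) : IsUnit Θ.det := by
  obtain ⟨c, hc, H⟩ := h.exists_pos_le
  rw [← Matrix.isUnit_iff_isUnit_det, ← Matrix.mulVec_injective_iff_isUnit]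
  refine (injective_iff_map_eq_zero (Matrix.mulVecLin Θ)).2 fun v hv => ?_
  have hv' : Θ *ᵥ v = 0 := hv
  have := H v
  rw [hv'] at this
  simp only [dotProduct_zero, Complex.zero_re] at this
  have h0 : ∑ i, ‖v i‖ ^ 2 = 0 :=
    le_antisymm (nonpos_of_mul_nonpos_right this hc) (Finset.sum_nonneg fun i _ => by positivity)
  ext i
  have := (Finset.sum_eq_zero_iff_of_nonneg (f := fun i => ‖v i‖ ^ 2) (fun i _ => by positivity)).1 h0 i (Finset.mem_univ i)
  simpa using this

theorem sum_norm_sq_mulVec_le (M : Matrix (Fin d) (Fin d) ℂ) (v : Fin d → ℂ) :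
    ∑ i, ‖(M *ᵥ v) i‖ ^ 2 ≤ (∑ i, ∑ j, ‖M i j‖ ^ 2) * ∑ j, ‖v j‖ ^ 2 := by
  rw [Finset.sum_mul]
  refine Finset.sum_le_sum fun i _ => ?_
  refine le_trans ?_ (Finset.sum_mul_sq_le_sq_mul_sq _ _ _)
  have : ‖(M *ᵥ v) i‖ ≤ ∑ j, ‖M i j‖ * ‖v j‖ := by
    simp only [Matrix.mulVec, dotProduct, ← norm_mul]
    exact norm_sum_le _ _
  gcongr

/-- Young's inequality with a free parameter, from the square of `2c|v_i| - |t_i|`. The parameter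
will be the coercivity constant of `Θ^y`, so that the `v` term can be absorbed. -/
theorem re_star_dotProduct_le {c : ℝ} (hc : 0 < c) (v t : Fin d → ℂ) :
    (star v ⬝ᵥ t).re ≤ c * ∑ i, ‖v i‖ ^ 2 + (4 * c)⁻¹ * ∑ i, ‖t i‖ ^ 2 := by
  rw [Finset.mul_sum, Finset.mul_sum, ← Finset.sum_add_distrib, dotProduct, Complex.re_sum]
  refine Finset.sum_le_sum fun i _ => ?_
  have h1 : ((star v) i * t i).re ≤ ‖v i‖ * ‖t i‖ := by
    refine (Complex.re_le_norm _).trans (le_of_eq ?_)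
    simp
  refine h1.trans ?_
  have h2 : 0 ≤ (2 * c * ‖v i‖ - ‖t i‖) ^ 2 * (4 * c)⁻¹ := by positivity
  have h3 : (2 * c * ‖v i‖ - ‖t i‖) ^ 2 * (4 * c)⁻¹ =
      c * ‖v i‖ ^ 2 + (4 * c)⁻¹ * ‖t i‖ ^ 2 - ‖v i‖ * ‖t i‖ := by
    field_simp; ring
  linarith

theorem im_star_dotProduct_J (y : Fin d ⊕ Fin d → ℂ) :
    (star y ⬝ᵥ (Matrix.J (Fin d) ℂ) *ᵥ y).im =
      -2 * (star (y ∘ Sum.inl) ⬝ᵥ (y ∘ Sum.inr)).im := by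
  have e : y = Sum.elim (y ∘ Sum.inl) (y ∘ Sum.inr) := by simp
  conv_lhs => rw [e]
  rw [Matrix.J, Matrix.fromBlocks_mulVec]
  simp only [dotProduct, Complex.im_sum, Fintype.sum_sum_type, Finset.mul_sum]
  rw [← Finset.sum_add_distrib, Complex.im_sum]
  refine Finset.sum_congr rfl fun i _ => ?_
  simp [Matrix.neg_mulVec]
  ring

/-- By `im_star_dotProduct_J` the quantity is a multiple of the imaginary part of `y^* J y`. As `F`
is real, the conjugate transpose of `F^†` is `F`, and `F J F^† = J` gives the invariance. -/
theorem im_star_dotProduct_symplectic {F : Matrix (Fin d ⊕ Fin d) (Fin d ⊕ Fin d) ℝ}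
    (hF : F ∈ Matrix.symplecticGroup (Fin d) ℝ) (y : Fin d ⊕ Fin d → ℂ) :
    (star ((Fᵀ.map (fun r => (r : ℂ)) *ᵥ y) ∘ Sum.inl) ⬝ᵥ
      ((Fᵀ.map (fun r => (r : ℂ)) *ᵥ y) ∘ Sum.inr)).im =
    (star (y ∘ Sum.inl) ⬝ᵥ (y ∘ Sum.inr)).im := by
  set G : Matrix (Fin d ⊕ Fin d) (Fin d ⊕ Fin d) ℂ := Fᵀ.map (fun r => (r : ℂ)) with hG
  have hJ : (Matrix.J (Fin d) ℝ).map (fun r => (r : ℂ)) = Matrix.J (Fin d) ℂ := by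
    ext i j
    rcases i with i | i <;> rcases j with j | j <;> simp [Matrix.J, Matrix.one_apply]
    · split_ifs <;> simp
    · split_ifs <;> simp
  have hF' : Gᴴ * Matrix.J (Fin d) ℂ * G = Matrix.J (Fin d) ℂ := by
    have h1 := SymplecticGroup.mem_iff.1 hF
    have h2 := congrArg (fun M => M.map (Complex.ofRealHom : ℝ → ℂ)) h1
    simp only [Matrix.map_mul] at h2
    have h3 : Gᴴ = F.map (Complex.ofRealHom : ℝ → ℂ) := by
      ext i j; simp [hG]
    rw [h3, ← hJ]
    exact h2
  have h4 := im_star_dotProduct_J (G *ᵥ y)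
  rw [Matrix.star_mulVec, ← Matrix.dotProduct_mulVec, Matrix.mulVec_mulVec, Matrix.mulVec_mulVec,
    hF', im_star_dotProduct_J] at h4
  linarith

/-- Put `(w₁, w₂) = F^† (-iΘ^x v, v)` and `r = 𝒵 v`, so that `w₁ = iΘ^y (w₂ - r)`. Symplectic
invariance says that `Re v^* Θ^x v = -Re w₂^* Θ^y w₂ + Re w₂^* Θ^y r`. The left side dominates
`|v|²`; on the right, coercivity of `Θ^y` and Young's inequality eliminate `w₂` and leave a multiple
of `|r|²`. -/
theorem exists_norm_sq_le_calZ {κ : Phase d ≃ Phase d} (hκ : IsCanonicalB κ)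
    {Θx Θy : Matrix (Fin d) (Fin d) ℂ} (hΘx : IsAdmissibleMatrix Θx)
    (hΘy : IsAdmissibleMatrix Θy) :
    ∃ K : ℝ, ∀ z (v : Fin d → ℂ), ∑ i, ‖v i‖ ^ 2 ≤ K * ∑ i, ‖(calZ κ Θx Θy z *ᵥ v) i‖ ^ 2 := by
  obtain ⟨c, hc, H⟩ := hΘx.exists_pos_le
  obtain ⟨c', hc', H'⟩ := hΘy.exists_pos_le
  refine ⟨c⁻¹ * ((4 * c')⁻¹ * ∑ i, ∑ j, ‖Θy i j‖ ^ 2), fun z v => ?_⟩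
  set r := calZ κ Θx Θy z *ᵥ v with hr
  set y : Fin d ⊕ Fin d → ℂ := Sum.elim (-(Complex.I • (Θx *ᵥ v))) v with hy
  set w := (jac κ z)ᵀ.map (fun r => (r : ℂ)) *ᵥ y with hw
  set w1 := w ∘ Sum.inl
  set w2 := w ∘ Sum.inr
  have hrw : r = Complex.I • (Θy⁻¹ *ᵥ w1) + w2 := by
    have : (Matrix.fromCols (-(Complex.I • Θx)) 1)ᵀ *ᵥ v = y := by
      rw [Matrix.transpose_fromCols, Matrix.fromRows_mulVec, Matrix.transpose_neg,
        Matrix.transpose_smul, hΘx.symm, Matrix.transpose_one, Matrix.one_mulVec,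
        Matrix.neg_mulVec, Matrix.smul_mulVec]
    rw [hr, calZ, ← Matrix.mulVec_mulVec, ← Matrix.mulVec_mulVec, this, ← hw,
      Matrix.fromCols_mulVec, Matrix.smul_mulVec, Matrix.one_mulVec]
  have hw1 : w1 = Complex.I • (Θy *ᵥ (w2 - r)) := by
    have : w2 - r = -(Complex.I • (Θy⁻¹ *ᵥ w1)) := by rw [hrw]; simp
    rw [this, Matrix.mulVec_neg, Matrix.mulVec_smul, Matrix.mulVec_mulVec,
      Matrix.mul_nonsing_inv _ hΘy.isUnit_det, Matrix.one_mulVec, smul_neg, smul_smul,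
      Complex.I_mul_I]
    simp
  have hform := im_star_dotProduct_symplectic (hκ.symplectic z) y
  have e1 : (star (y ∘ Sum.inl) ⬝ᵥ (y ∘ Sum.inr)).im = (star v ⬝ᵥ Θx *ᵥ v).re := by
    have : star v ⬝ᵥ Θx *ᵥ v = star (star (Θx *ᵥ v) ⬝ᵥ v) := by
      rw [Matrix.star_dotProduct]
    rw [this]
    simp [hy]
  have e2 : (star w1 ⬝ᵥ w2).im = -(star w2 ⬝ᵥ Θy *ᵥ w2).re + (star w2 ⬝ᵥ Θy *ᵥ r).re := by
    have h1 : star w2 ⬝ᵥ Θy *ᵥ (w2 - r) = star (star (Θy *ᵥ (w2 - r)) ⬝ᵥ w2) := by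
      rw [Matrix.star_dotProduct]
    have h2 : (star w1 ⬝ᵥ w2).im = -(star w2 ⬝ᵥ Θy *ᵥ (w2 - r)).re := by
      rw [h1, hw1]
      simp
    rw [h2, Matrix.mulVec_sub, dotProduct_sub, Complex.sub_re]
    ring
  have e3 := re_star_dotProduct_le hc' w2 (Θy *ᵥ r)
  have e4 := H' w2
  have e5 := H v
  have e6 := sum_norm_sq_mulVec_le Θy r
  have e7 : c * ∑ i, ‖v i‖ ^ 2 ≤ (4 * c')⁻¹ * ∑ i, ‖(Θy *ᵥ r) i‖ ^ 2 := by
    have : (star w1 ⬝ᵥ w2).im = (star (y ∘ Sum.inl) ⬝ᵥ (y ∘ Sum.inr)).im := hform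
    linarith
  have e8 : c * ∑ i, ‖v i‖ ^ 2 ≤
      (4 * c')⁻¹ * ((∑ i, ∑ j, ‖Θy i j‖ ^ 2) * ∑ i, ‖r i‖ ^ 2) :=
    e7.trans (by gcongr)
  calc ∑ i, ‖v i‖ ^ 2 = c⁻¹ * (c * ∑ i, ‖v i‖ ^ 2) := by field_simp
    _ ≤ c⁻¹ * ((4 * c')⁻¹ * ((∑ i, ∑ j, ‖Θy i j‖ ^ 2) * ∑ i, ‖r i‖ ^ 2)) := by gcongr
    _ = _ := by ring

theorem isUnit_det_calZ {κ : Phase d ≃ Phase d} (hκ : IsCanonicalB κ)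
    {Θx Θy : Matrix (Fin d) (Fin d) ℂ} (hΘx : IsAdmissibleMatrix Θx)
    (hΘy : IsAdmissibleMatrix Θy) (z : Phase d) : IsUnit (calZ κ Θx Θy z).det := by
  obtain ⟨K, hK⟩ := exists_norm_sq_le_calZ hκ hΘx hΘy
  rw [← Matrix.isUnit_iff_isUnit_det, ← Matrix.mulVec_injective_iff_isUnit]
  refine (injective_iff_map_eq_zero (Matrix.mulVecLin (calZ κ Θx Θy z))).2 fun v hv => ?_
  have hv' : calZ κ Θx Θy z *ᵥ v = 0 := hv
  have := hK z v
  rw [hv'] at this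
  simp only [Pi.zero_apply, norm_zero, ne_eq, OfNat.ofNat_ne_zero, not_false_eq_true, zero_pow,
    Finset.sum_const_zero, mul_zero] at this
  have h0 : ∑ i, ‖v i‖ ^ 2 = 0 := le_antisymm this (Finset.sum_nonneg fun i _ => by positivity)
  ext i
  have := (Finset.sum_eq_zero_iff_of_nonneg (f := fun i => ‖v i‖ ^ 2) (fun i _ => by positivity)).1 h0 i (Finset.mem_univ i)
  simpa using this

theorem exists_norm_calZ_inv_le {κ : Phase d ≃ Phase d} (hκ : IsCanonicalB κ)
    {Θx Θy : Matrix (Fin d) (Fin d) ℂ} (hΘx : IsAdmissibleMatrix Θx)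
    (hΘy : IsAdmissibleMatrix Θy) :
    ∃ K : ℝ, ∀ z i j, ‖(calZ κ Θx Θy z)⁻¹ i j‖ ≤ K := by
  obtain ⟨K, hK⟩ := exists_norm_sq_le_calZ hκ hΘx hΘy
  refine ⟨Real.sqrt K, fun z i j => Real.le_sqrt_of_sq_le ?_⟩
  -- The lower bound is applied to the `j`-th column of `𝒵⁻¹`, which `𝒵` maps to a unit vector.
  have h1 := hK z ((calZ κ Θx Θy z)⁻¹ *ᵥ Pi.single j 1)
  rw [Matrix.mulVec_mulVec, Matrix.mul_nonsing_inv _ (isUnit_det_calZ hκ hΘx hΘy z),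
    Matrix.one_mulVec, Matrix.mulVec_single_one] at h1
  have h2 : ∑ i, ‖(Pi.single j (1 : ℂ) : Fin d → ℂ) i‖ ^ 2 = 1 := by
    rw [Finset.sum_eq_single j] <;> simp +contextual
  rw [h2, mul_one] at h1
  refine le_trans ?_ h1
  exact Finset.single_le_sum (f := fun i => ‖(calZ κ Θx Θy z)⁻¹ i j‖ ^ 2)
    (fun _ _ => by positivity) (Finset.mem_univ i)

end LinearAlgebra

/-! ### Symbols on phase space: `κ`, `𝒵⁻¹` and the coefficients -/

section PhaseSpaceSymbols

variable {d : ℕ} {ε₀ m m' : ℝ} {u v : ℝ → Phase d → ℂ}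

theorem one_le_bracket2 (z : Phase d) : 1 ≤ Real.sqrt (1 + ‖z.1‖ ^ 2 + ‖z.2‖ ^ 2) := by
  rw [Real.one_le_sqrt]
  nlinarith [sq_nonneg ‖z.1‖, sq_nonneg ‖z.2‖]

theorem weight2_pos (m : ℝ) (z : Phase d) : 0 < weight2 m z :=
  Real.rpow_pos_of_pos (one_pos.trans_le (one_le_bracket2 z)) m

theorem weight2_add (m m' : ℝ) (z : Phase d) :
    weight2 (m + m') z = weight2 m z * weight2 m' z :=
  Real.rpow_add (one_pos.trans_le (one_le_bracket2 z)) m m'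

theorem weight2_zero : weight2 (d := d) 0 = fun _ => 1 := by
  ext z; simp [weight2]

theorem weight2_mono (h : m ≤ m') (z : Phase d) : weight2 m z ≤ weight2 m' z :=
  Real.rpow_le_rpow_of_exponent_le (one_le_bracket2 z) h

theorem one_add_norm_le_weight2 (z : Phase d) : 1 + ‖z‖ ≤ 2 * weight2 1 z := by
  have h1 : ‖z.1‖ ≤ weight2 1 z := by
    rw [weight2, Real.rpow_one]
    exact Real.le_sqrt_of_sq_le (by nlinarith [sq_nonneg ‖z.2‖])
  have h2 : ‖z.2‖ ≤ weight2 1 z := by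
    rw [weight2, Real.rpow_one]
    exact Real.le_sqrt_of_sq_le (by nlinarith [sq_nonneg ‖z.1‖])
  have h3 : 1 ≤ weight2 1 z := by rw [weight2, Real.rpow_one]; exact one_le_bracket2 z
  have h4 : ‖z‖ ≤ weight2 1 z := by rw [Prod.norm_def]; exact max_le h1 h2
  linarith

theorem weight2_one_le (z : Phase d) : weight2 1 z ≤ 2 * (1 + ‖z‖) := by
  rw [weight2, Real.rpow_one, Real.sqrt_le_left (by positivity)]
  have h1 := norm_fst_le z
  have h2 := norm_snd_le z
  nlinarith [norm_nonneg z.1, norm_nonneg z.2, norm_nonneg z]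

/-- A symbol on phase space grows at most polynomially. -/
theorem weight2_le_pow (m : ℝ) : ∃ (N : ℕ) (C : ℝ), 0 ≤ C ∧
    ∀ z : Phase d, weight2 m z ≤ C * (1 + ‖z‖) ^ N := by
  obtain ⟨N, hN⟩ := exists_nat_ge m
  refine ⟨N, 2 ^ N, by positivity, fun z => (weight2_mono hN z).trans ?_⟩
  rw [← mul_pow]
  have : weight2 (N : ℝ) z = weight2 1 z ^ N := by
    rw [weight2, weight2, Real.rpow_one, Real.rpow_natCast]
  rw [this]
  exact pow_le_pow_left₀ (weight2_pos 1 z).le (weight2_one_le z) N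

namespace IsSymbol2

theorem mul (hu : IsSymbol2 ε₀ m u) (hv : IsSymbol2 ε₀ m' v) :
    IsSymbol2 ε₀ (m + m') (fun ε z => u ε z * v ε z) := by
  have := IsSymbol.mul hu hv
  simp only [← weight2_add] at this
  exact this

theorem mono (hu : IsSymbol2 ε₀ m u) (h : m ≤ m') : IsSymbol2 ε₀ m' u :=
  IsSymbol.mono hu 1 (fun z => (weight2_pos m z).le) (fun z => by
    rw [one_mul]; exact weight2_mono h z)

theorem add (hu : IsSymbol2 ε₀ m u) (hv : IsSymbol2 ε₀ m v) :
    IsSymbol2 ε₀ m (fun ε z => u ε z + v ε z) := IsSymbol.add hu hv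

theorem sub (hu : IsSymbol2 ε₀ m u) (hv : IsSymbol2 ε₀ m v) :
    IsSymbol2 ε₀ m (fun ε z => u ε z - v ε z) := IsSymbol.sub hu hv

theorem neg (hu : IsSymbol2 ε₀ m u) : IsSymbol2 ε₀ m (fun ε z => -u ε z) := IsSymbol.neg hu

theorem const_mul (hu : IsSymbol2 ε₀ m u) (c : ℂ) : IsSymbol2 ε₀ m (fun ε z => c * u ε z) :=
  IsSymbol.const_mul hu c

theorem sum {ι : Type*} {f : ι → ℝ → Phase d → ℂ} {s : Finset ι}
    (h : ∀ i ∈ s, IsSymbol2 ε₀ m (f i)) : IsSymbol2 ε₀ m (fun ε z => ∑ i ∈ s, f i ε z) :=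
  IsSymbol.sum h

theorem const (c : ℂ) : IsSymbol2 ε₀ 0 (fun _ (_ : Phase d) => c) := by
  rw [IsSymbol2, weight2_zero]
  exact isSymbol_const (fun _ => c) ‖c‖ (fun _ _ => le_rfl)

theorem prod {ι : Type*} {f : ι → ℝ → Phase d → ℂ} {s : Finset ι}
    (h : ∀ i ∈ s, IsSymbol2 ε₀ 0 (f i)) :
    IsSymbol2 ε₀ 0 (fun ε z => ∏ i ∈ s, f i ε z) := by
  simp only [IsSymbol2, weight2_zero] at *
  exact IsSymbol.prod h

theorem dq (hu : IsSymbol2 ε₀ m u) (k : Fin d) :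
    IsSymbol2 ε₀ m (fun ε z => SemiclassicalFIO.dq k (u ε) z) := IsSymbol.fderiv_apply hu _

theorem dp (hu : IsSymbol2 ε₀ m u) (k : Fin d) :
    IsSymbol2 ε₀ m (fun ε z => SemiclassicalFIO.dp k (u ε) z) := IsSymbol.fderiv_apply hu _

theorem dz (hu : IsSymbol2 ε₀ m u) (Θy : Matrix (Fin d) (Fin d) ℂ) (k : Fin d) :
    IsSymbol2 ε₀ m (fun ε z => SemiclassicalFIO.dz Θy k (u ε) z) :=
  (sum fun l _ => (hu.dq l).const_mul _).sub ((hu.dp k).const_mul _)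

theorem divz {V : ℝ → Phase d → Fin d → ℂ} (hV : ∀ j, IsSymbol2 ε₀ m (fun ε z => V ε z j))
    (Θy : Matrix (Fin d) (Fin d) ℂ) :
    IsSymbol2 ε₀ m (fun ε z => SemiclassicalFIO.divz Θy (V ε) z) :=
  sum fun j _ => (hV j).dz Θy j

theorem det {n : Type*} [Fintype n] [DecidableEq n] {M : ℝ → Phase d → Matrix n n ℂ}
    (hM : ∀ i j, IsSymbol2 ε₀ 0 (fun ε z => M ε z i j)) :
    IsSymbol2 ε₀ 0 (fun ε z => (M ε z).det) := by
  simp only [Matrix.det_apply']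
  exact sum fun σ _ => (prod fun i _ => hM _ _).const_mul _

theorem differentiable (hu : IsSymbol2 ε₀ m u) {ε : ℝ} (hε : ε ∈ Ioc 0 ε₀) :
    Differentiable ℝ (u ε) := IsSymbol.differentiable hu hε

end IsSymbol2

theorem phase_basis (z : Phase d) :
    ∑ i : Fin d ⊕ Fin d, (Sum.elim
      (fun j => (EuclideanSpace.proj j : E d →L[ℝ] ℝ).comp (ContinuousLinearMap.fst ℝ (E d) (E d)))
      (fun j => (EuclideanSpace.proj j : E d →L[ℝ] ℝ).comp
        (ContinuousLinearMap.snd ℝ (E d) (E d))) i) z •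
      (Sum.elim (fun j => ((EuclideanSpace.single j (1 : ℝ), 0) : Phase d))
        (fun j => (0, EuclideanSpace.single j (1 : ℝ))) i) = z := by
  rw [Fintype.sum_sum_type]
  ext i
  · simp [Prod.fst_sum, Pi.single_apply]
  · simp [Prod.snd_sum, Pi.single_apply]

theorem isSymbol2_of_partial (hs : ∀ ε ∈ Ioc 0 ε₀, ContDiff ℝ ∞ (u ε))
    (h0 : ∃ C : ℝ, ∀ ε ∈ Ioc 0 ε₀, ∀ z, ‖u ε z‖ ≤ C * weight2 m z)
    (hq : ∀ j, IsSymbol2 ε₀ m (fun ε z => dq j (u ε) z))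
    (hp : ∀ j, IsSymbol2 ε₀ m (fun ε z => dp j (u ε) z)) : IsSymbol2 ε₀ m u := by
  refine isSymbol_of_fderiv _ _ phase_basis hs h0 ?_
  rintro (j | j)
  · exact hq j
  · exact hp j

theorem fderiv_ofReal_comp {f : Phase d → ℝ} (hf : Differentiable ℝ f) (z e : Phase d) :
    fderiv ℝ (fun z => (f z : ℂ)) z e = ((fderiv ℝ f z e : ℝ) : ℂ) := by
  have := (Complex.ofRealCLM.hasFDerivAt (x := f z)).comp z (hf z).hasFDerivAt
  have h2 : (fun z => (f z : ℂ)) = Complex.ofRealCLM ∘ f := rfl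
  rw [h2, this.fderiv]
  rfl

theorem dq_ofReal {f : Phase d → ℝ} (hf : Differentiable ℝ f) (j : Fin d) (z : Phase d) :
    dq j (fun z => (f z : ℂ)) z = ((dq j f z : ℝ) : ℂ) := fderiv_ofReal_comp hf z _

theorem dp_ofReal {f : Phase d → ℝ} (hf : Differentiable ℝ f) (j : Fin d) (z : Phase d) :
    dp j (fun z => (f z : ℂ)) z = ((dp j f z : ℝ) : ℂ) := fderiv_ofReal_comp hf z _

section Canonical

variable {κ : Phase d ≃ Phase d}

theorem IsCanonicalB.contDiff_fst (hκ : IsCanonicalB κ) (j : Fin d) :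
    ContDiff ℝ ∞ (fun z => (κ z).1 j) :=
  (EuclideanSpace.proj j : E d →L[ℝ] ℝ).contDiff.comp (_root_.contDiff_fst.comp hκ.contDiff)

theorem IsCanonicalB.contDiff_snd (hκ : IsCanonicalB κ) (j : Fin d) :
    ContDiff ℝ ∞ (fun z => (κ z).2 j) :=
  (EuclideanSpace.proj j : E d →L[ℝ] ℝ).contDiff.comp (_root_.contDiff_snd.comp hκ.contDiff)

/-- Bounded first derivatives force at most linear growth, by the mean value inequality on the
segment from the origin. This puts the components of `κ`, about which only the Jacobian is assumed
bounded, in the class of order one. -/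
theorem isSymbol2_one_of_partial {f : Phase d → ℝ} (hf : ContDiff ℝ ∞ f)
    (hq : ∀ j, IsSymbol2 ε₀ 0 (fun _ z => ((dq j f z : ℝ) : ℂ)))
    (hp : ∀ j, IsSymbol2 ε₀ 0 (fun _ z => ((dp j f z : ℝ) : ℂ))) (hε₀ : 0 < ε₀) :
    IsSymbol2 ε₀ 1 (fun _ z => (f z : ℂ)) := by
  have hd : Differentiable ℝ f := hf.differentiable (by simp)
  have hmem : ε₀ ∈ Ioc 0 ε₀ := ⟨hε₀, le_rfl⟩
  choose Cq hCq using fun j => IsSymbol.norm_le (hq j)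
  choose Cp hCp using fun j => IsSymbol.norm_le (hp j)
  refine isSymbol2_of_partial (fun _ _ => Complex.ofRealCLM.contDiff.comp hf) ?_ ?_ ?_
  · have hbound : ∀ z, ‖fderiv ℝ f z‖ ≤ ∑ j, (|Cq j| + |Cp j|) := by
      intro z
      refine ContinuousLinearMap.opNorm_le_bound _
        (Finset.sum_nonneg fun j _ => by positivity) fun y => ?_
      conv_lhs => rw [← phase_basis y]
      rw [Fintype.sum_sum_type, map_add, map_sum, map_sum, ← Finset.sum_add_distrib,
        Finset.sum_mul]
      refine (norm_sum_le _ _).trans (Finset.sum_le_sum fun j _ => ?_)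
      rw [add_mul]
      have e1 : ‖fderiv ℝ f z (EuclideanSpace.single j 1, 0)‖ ≤ |Cq j| := by
        have := hCq j ε₀ hmem z
        rw [weight2_zero, mul_one, Complex.norm_real] at this
        exact this.trans (le_abs_self _)
      have e2 : ‖fderiv ℝ f z (0, EuclideanSpace.single j 1)‖ ≤ |Cp j| := by
        have := hCp j ε₀ hmem z
        rw [weight2_zero, mul_one, Complex.norm_real] at this
        exact this.trans (le_abs_self _)
      have e3 : ‖y.1 j‖ ≤ ‖y‖ := (PiLp.norm_apply_le y.1 j).trans (norm_fst_le y)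
      have e4 : ‖y.2 j‖ ≤ ‖y‖ := (PiLp.norm_apply_le y.2 j).trans (norm_snd_le y)
      refine (norm_add_le _ _).trans (add_le_add ?_ ?_)
      · rw [map_smul, norm_smul, mul_comm]
        exact mul_le_mul e1 e3 (norm_nonneg _) (abs_nonneg _)
      · rw [map_smul, norm_smul, mul_comm]
        exact mul_le_mul e2 e4 (norm_nonneg _) (abs_nonneg _)
    set K := ∑ j, (|Cq j| + |Cp j|)
    have hK : 0 ≤ K := (norm_nonneg _).trans (hbound 0)
    refine ⟨(‖f 0‖ + K) * 2, fun ε _ z => ?_⟩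
    have h1 := convex_univ.norm_image_sub_le_of_norm_fderiv_le (𝕜 := ℝ) (f := f) (C := K)
      (fun x _ => hd x) (fun x _ => hbound x) (mem_univ 0) (mem_univ z)
    rw [sub_zero] at h1
    have h2 : ‖f z‖ ≤ ‖f 0‖ + ‖f z - f 0‖ := by
      simpa using norm_add_le (f 0) (f z - f 0)
    have h3 := one_add_norm_le_weight2 z
    rw [Complex.norm_real]
    have h4 : (‖f 0‖ + K) * (1 + ‖z‖) ≤ (‖f 0‖ + K) * (2 * weight2 1 z) := by gcongr
    nlinarith [norm_nonneg z, norm_nonneg (f 0)]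
  · intro j
    simp only [dq_ofReal hd]
    exact (hq j).mono zero_le_one
  · intro j
    simp only [dp_ofReal hd]
    exact (hp j).mono zero_le_one

theorem IsCanonicalB.jac_symbol (hκ : IsCanonicalB κ) (hε₀ : ε₀ ≤ 1) (i j : Fin d ⊕ Fin d) :
    IsSymbol2 ε₀ 0 (fun _ z => ((jac κ z i j : ℝ) : ℂ)) :=
  IsSymbol.restrict (hκ.classB i j) hε₀

theorem IsCanonicalB.symbol_fst (hκ : IsCanonicalB κ) (h0 : 0 < ε₀) (h1 : ε₀ ≤ 1) (j : Fin d) :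
    IsSymbol2 ε₀ 1 (fun _ z => (((κ z).1 j : ℝ) : ℂ)) :=
  isSymbol2_one_of_partial (hκ.contDiff_fst j) (fun k => hκ.jac_symbol h1 (Sum.inl j) (Sum.inl k))
    (fun k => hκ.jac_symbol h1 (Sum.inl j) (Sum.inr k)) h0

theorem IsCanonicalB.symbol_snd (hκ : IsCanonicalB κ) (h0 : 0 < ε₀) (h1 : ε₀ ≤ 1) (j : Fin d) :
    IsSymbol2 ε₀ 1 (fun _ z => (((κ z).2 j : ℝ) : ℂ)) :=
  isSymbol2_one_of_partial (hκ.contDiff_snd j) (fun k => hκ.jac_symbol h1 (Sum.inr j) (Sum.inl k))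
    (fun k => hκ.jac_symbol h1 (Sum.inr j) (Sum.inr k)) h0

theorem IsCanonicalB.dz_fst_eq (hκ : IsCanonicalB κ) (Θy : Matrix (Fin d) (Fin d) ℂ)
    (j k : Fin d) (z : Phase d) : dz Θy j (fun z => (((κ z).1 k : ℝ) : ℂ)) z =
      (∑ l, Θy⁻¹ j l * ((jac κ z (Sum.inl k) (Sum.inl l) : ℝ) : ℂ)) -
        Complex.I * ((jac κ z (Sum.inl k) (Sum.inr j) : ℝ) : ℂ) := by
  have hd := (hκ.contDiff_fst k).differentiable (by simp)
  simp only [dz, dq_ofReal hd, dp_ofReal hd]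
  rfl

theorem IsCanonicalB.dz_snd_eq (hκ : IsCanonicalB κ) (Θy : Matrix (Fin d) (Fin d) ℂ)
    (j k : Fin d) (z : Phase d) : dz Θy j (fun z => (((κ z).2 k : ℝ) : ℂ)) z =
      (∑ l, Θy⁻¹ j l * ((jac κ z (Sum.inr k) (Sum.inl l) : ℝ) : ℂ)) -
        Complex.I * ((jac κ z (Sum.inr k) (Sum.inr j) : ℝ) : ℂ) := by
  have hd := (hκ.contDiff_snd k).differentiable (by simp)
  simp only [dz, dq_ofReal hd, dp_ofReal hd]
  rfl

theorem IsCanonicalB.symbol_dz_fst (hκ : IsCanonicalB κ) (h1 : ε₀ ≤ 1)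
    (Θy : Matrix (Fin d) (Fin d) ℂ) (j k : Fin d) :
    IsSymbol2 ε₀ 0 (fun _ z => dz Θy j (fun z => (((κ z).1 k : ℝ) : ℂ)) z) := by
  simp only [hκ.dz_fst_eq]
  exact (IsSymbol2.sum fun l _ => (hκ.jac_symbol h1 _ _).const_mul _).sub
    ((hκ.jac_symbol h1 _ _).const_mul _)

theorem IsCanonicalB.symbol_dz_snd (hκ : IsCanonicalB κ) (h1 : ε₀ ≤ 1)
    (Θy : Matrix (Fin d) (Fin d) ℂ) (j k : Fin d) :
    IsSymbol2 ε₀ 0 (fun _ z => dz Θy j (fun z => (((κ z).2 k : ℝ) : ℂ)) z) := by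
  simp only [hκ.dz_snd_eq]
  exact (IsSymbol2.sum fun l _ => (hκ.jac_symbol h1 _ _).const_mul _).sub
    ((hκ.jac_symbol h1 _ _).const_mul _)

/-- `𝒵 = X_z Θ^x + i Ξ_z`. -/
theorem IsCanonicalB.calZ_apply (hκ : IsCanonicalB κ) {Θx : Matrix (Fin d) (Fin d) ℂ}
    (hΘx : IsAdmissibleMatrix Θx) (Θy : Matrix (Fin d) (Fin d) ℂ) (z : Phase d) (j k : Fin d) :
    calZ κ Θx Θy z j k =
      (∑ l, dz Θy j (fun z => (((κ z).1 l : ℝ) : ℂ)) z * Θx l k) +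
        Complex.I * dz Θy j (fun z => (((κ z).2 k : ℝ) : ℂ)) z := by
  have hsymm : ∀ l, Θx k l = Θx l k := fun l => congrFun (congrFun hΘx.symm l) k
  simp only [hκ.dz_fst_eq, hκ.dz_snd_eq]
  simp only [calZ, Matrix.mul_apply, Fintype.sum_sum_type, Matrix.fromCols_apply_inl,
    Matrix.fromCols_apply_inr, Matrix.transpose_apply, Matrix.map_apply, Matrix.smul_apply,
    Matrix.neg_apply, smul_eq_mul, Matrix.one_apply, hsymm, ite_mul, one_mul, zero_mul,
    Finset.sum_ite_eq, Finset.mem_univ, if_true, mul_ite, mul_one, mul_zero]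
  congr 1
  · refine Finset.sum_congr rfl fun l _ => ?_
    simp only [mul_assoc, ← Finset.mul_sum]
    linear_combination (-(∑ i, Θy⁻¹ j i * ((jac κ z (Sum.inl l) (Sum.inl i) : ℝ) : ℂ)) *
      Θx l k) * Complex.I_mul_I
  · simp only [mul_assoc, ← Finset.mul_sum]
    linear_combination (((jac κ z (Sum.inr k) (Sum.inr j) : ℝ) : ℂ)) * Complex.I_mul_I

theorem IsCanonicalB.symbol_calZ (hκ : IsCanonicalB κ) {Θx : Matrix (Fin d) (Fin d) ℂ}
    (hΘx : IsAdmissibleMatrix Θx) (Θy : Matrix (Fin d) (Fin d) ℂ) (h1 : ε₀ ≤ 1) (j k : Fin d) :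
    IsSymbol2 ε₀ 0 (fun _ z => calZ κ Θx Θy z j k) := by
  simp only [hκ.calZ_apply hΘx]
  refine (IsSymbol2.sum fun l _ => ?_).add ((hκ.symbol_dz_snd h1 _ _ _).const_mul _)
  simp only [mul_comm _ (Θx l k)]
  exact (hκ.symbol_dz_fst h1 _ _ _).const_mul _

/-- Cramer's rule. The adjugate is polynomial in the entries of `𝒵`; the determinant stays away from
zero because its reciprocal is the determinant of `𝒵⁻¹`, whose entries are bounded. -/
theorem IsCanonicalB.symbol_calZ_inv (hκ : IsCanonicalB κ) {Θx Θy : Matrix (Fin d) (Fin d) ℂ}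
    (hΘx : IsAdmissibleMatrix Θx) (hΘy : IsAdmissibleMatrix Θy) (h1 : ε₀ ≤ 1) (j k : Fin d) :
    IsSymbol2 ε₀ 0 (fun _ z => (calZ κ Θx Θy z)⁻¹ j k) := by
  have hdet : IsSymbol2 ε₀ 0 (fun _ z => (calZ κ Θx Θy z).det) :=
    IsSymbol2.det fun i j => hκ.symbol_calZ hΘx Θy h1 i j
  obtain ⟨K, hK⟩ := exists_norm_calZ_inv_le hκ hΘx hΘy
  have hadj : IsSymbol2 ε₀ 0 (fun _ z => (calZ κ Θx Θy z).adjugate j k) := by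
    simp only [Matrix.adjugate_apply]
    refine IsSymbol2.det fun i l => ?_
    simp only [Matrix.updateRow_apply]
    split_ifs
    · exact IsSymbol2.const _
    · exact hκ.symbol_calZ hΘx Θy h1 i l
  -- A bound for the Leibniz expansion of a determinant with entries of norm at most `K`; the
  -- maximum with `1` makes it positive.
  set B : ℝ := ∑ _σ : Equiv.Perm (Fin d), (max K 1) ^ d with hB
  have hBpos : 0 < B := by
    rw [hB, Finset.sum_const, nsmul_eq_mul]
    have : 0 < (Finset.univ : Finset (Equiv.Perm (Fin d))).card := Finset.card_pos.2 ⟨1, by simp⟩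
    positivity
  have hinvdet : ∀ z, ‖((calZ κ Θx Θy z).det)⁻¹‖ ≤ B := by
    intro z
    have : ((calZ κ Θx Θy z).det)⁻¹ = ((calZ κ Θx Θy z)⁻¹).det := by
      rw [Matrix.det_nonsing_inv, Ring.inverse_eq_inv']
    rw [this, Matrix.det_apply]
    refine (norm_sum_le _ _).trans (Finset.sum_le_sum fun σ _ => ?_)
    have hσ : ‖Equiv.Perm.sign σ • ∏ i, (calZ κ Θx Θy z)⁻¹ (σ i) i‖ =
        ∏ i, ‖(calZ κ Θx Θy z)⁻¹ (σ i) i‖ := by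
      rcases Int.units_eq_one_or (Equiv.Perm.sign σ) with h | h <;> simp [h]
    rw [hσ]
    calc _ ≤ ∏ _i : Fin d, max K 1 :=
          Finset.prod_le_prod (fun _ _ => norm_nonneg _) fun i _ =>
            (hK z _ _).trans (le_max_left _ _)
      _ = _ := by simp
  have hdetinv : IsSymbol2 ε₀ 0 (fun _ z => ((calZ κ Θx Θy z).det)⁻¹) := by
    have := IsSymbol.inv hdet (weight2_pos 0) (inv_pos.2 hBpos) (fun _ _ z => by
      rw [weight2_zero, mul_one]
      have h1 := hinvdet z
      have h2 := (isUnit_det_calZ hκ hΘx hΘy z).ne_zero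
      rw [norm_inv] at h1
      exact inv_le_of_inv_le₀ (norm_pos_iff.2 h2) h1)
    simpa [IsSymbol2, weight2_zero] using this
  have := hdetinv.mul hadj
  rw [add_zero] at this
  simpa [Matrix.inv_def, Ring.inverse_eq_inv'] using this

end Canonical

section Coefficients

variable {κ : Phase d ≃ Phase d} {Θx Θy : Matrix (Fin d) (Fin d) ℂ} {mP mu : ℝ}
  {α : ℝ → Phase d → ℂ} {a : ℝ → Phase d → Fin d → ℂ}
  {A : ℝ → Phase d → Matrix (Fin d) (Fin d) ℂ}

theorem isSymbol2_smul_vecMul_calZ_inv (hκ : IsCanonicalB κ) (hΘx : IsAdmissibleMatrix Θx)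
    (hΘy : IsAdmissibleMatrix Θy) (h1 : ε₀ ≤ 1)
    (ha : ∀ j, IsSymbol2 ε₀ m (fun ε z => a ε z j)) (j : Fin d) :
    IsSymbol2 ε₀ m (fun ε z => (a ε z ᵥ* (calZ κ Θx Θy z)⁻¹) j) := by
  have := IsSymbol2.sum (s := Finset.univ) fun i _ =>
    (ha i).mul (hκ.symbol_calZ_inv hΘx hΘy h1 i j)
  rw [add_zero] at this
  exact this

theorem isSymbol2_v0 (hα : IsSymbol2 ε₀ mP α) (hu : IsSymbol2 ε₀ mu u) :
    IsSymbol2 ε₀ (mP + mu) (fun ε => v0 (α ε) (u ε)) := hα.mul hu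

theorem isSymbol2_v1 (hκ : IsCanonicalB κ) (hΘx : IsAdmissibleMatrix Θx)
    (hΘy : IsAdmissibleMatrix Θy) (h1 : ε₀ ≤ 1)
    (ha : ∀ j, IsSymbol2 ε₀ mP (fun ε z => a ε z j))
    (hA : ∀ j k, IsSymbol2 ε₀ mP (fun ε z => A ε z j k)) (hu : IsSymbol2 ε₀ mu u) :
    IsSymbol2 ε₀ (mP + mu) (fun ε => v1 κ Θx Θy (a ε) (A ε) (u ε)) := by
  refine IsSymbol2.add ?_ ?_
  · refine IsSymbol2.neg (IsSymbol2.divz (fun j => ?_) Θy)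
    rw [add_comm]
    exact hu.mul (isSymbol2_smul_vecMul_calZ_inv hκ hΘx hΘy h1 ha j)
  · refine IsSymbol2.mul ?_ hu
    refine IsSymbol2.sum fun i _ => ?_
    simp only [Matrix.diag_apply, Matrix.mul_apply]
    refine IsSymbol2.sum fun k _ => ?_
    have := (IsSymbol2.sum (s := Finset.univ) fun l _ =>
      (hκ.symbol_calZ_inv hΘx hΘy h1 i l).mul (hκ.symbol_dz_fst h1 Θy l k)).mul (hA k i)
    simpa [Xz] using this

/-- The vector `A 𝒵⁻¹ e_k u`. -/
theorem isSymbol2_smul_mul_calZ_inv_mulVec (hκ : IsCanonicalB κ) (hΘx : IsAdmissibleMatrix Θx)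
    (hΘy : IsAdmissibleMatrix Θy) (h1 : ε₀ ≤ 1)
    (hA : ∀ j k, IsSymbol2 ε₀ mP (fun ε z => A ε z j k)) (hu : IsSymbol2 ε₀ mu u) (k i : Fin d) :
    IsSymbol2 ε₀ (mP + mu)
      (fun ε z => (u ε z • ((A ε z * (calZ κ Θx Θy z)⁻¹) *ᵥ Pi.single k 1)) i) := by
  simp only [Matrix.mulVec_single_one, Pi.smul_apply, Matrix.col_apply, smul_eq_mul]
  rw [add_comm]
  refine hu.mul ?_
  have := IsSymbol2.sum (s := Finset.univ) fun l _ =>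
    (hA i l).mul (hκ.symbol_calZ_inv hΘx hΘy h1 l k)
  rw [add_zero] at this
  exact this

theorem isSymbol2_v2 (hκ : IsCanonicalB κ) (hΘx : IsAdmissibleMatrix Θx)
    (hΘy : IsAdmissibleMatrix Θy) (h1 : ε₀ ≤ 1)
    (hA : ∀ j k, IsSymbol2 ε₀ mP (fun ε z => A ε z j k)) (hu : IsSymbol2 ε₀ mu u) :
    IsSymbol2 ε₀ (mP + mu) (fun ε => v2 κ Θx Θy (A ε) (u ε)) := by
  refine IsSymbol2.sum fun k _ => IsSymbol2.divz (fun j => ?_) Θy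
  exact isSymbol2_smul_vecMul_calZ_inv hκ hΘx hΘy h1 (fun i =>
    (isSymbol2_smul_mul_calZ_inv_mulVec hκ hΘx hΘy h1 hA hu k i).dz Θy k) j

end Coefficients

end PhaseSpaceSymbols

/-! ### The phase: splitting, derivatives and Gaussian damping -/

section PhaseFunction

variable {d : ℕ} {Θx Θy : Matrix (Fin d) (Fin d) ℂ}

/-- The `j`-th coordinate as a complex-valued linear form. -/
noncomputable def coordC (j : Fin d) : E d →L[ℝ] ℂ :=
  Complex.ofRealCLM.comp (EuclideanSpace.proj j : E d →L[ℝ] ℝ)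

@[simp] theorem coordC_apply (j : Fin d) (y : E d) : coordC j y = ((y j : ℝ) : ℂ) := rfl

/-- The linear form `y_k - q_k` on the space of all `(q, p, y)`. -/
noncomputable def displacement (k : Fin d) : (E d × E d × E d) →L[ℝ] ℂ :=
  (coordC k).comp ((ContinuousLinearMap.snd ℝ (E d) (E d)).comp
      (ContinuousLinearMap.snd ℝ (E d) (E d × E d)) -
    ContinuousLinearMap.fst ℝ (E d) (E d × E d))

/-- The linear form `p_k` on the space of all `(q, p, y)`. -/
noncomputable def momentum (k : Fin d) : (E d × E d × E d) →L[ℝ] ℂ :=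
  (coordC k).comp ((ContinuousLinearMap.fst ℝ (E d) (E d)).comp
    (ContinuousLinearMap.snd ℝ (E d) (E d × E d)))

@[simp] theorem displacement_apply (k : Fin d) (w : E d × E d × E d) :
    displacement k w = cvec (w.2.2 - w.1) k := rfl

@[simp] theorem momentum_apply (k : Fin d) (w : E d × E d × E d) :
    momentum k w = cvec w.2.1 k := rfl

/-- The linear form `-p_j + i (Θ^y (y - q))_j` on the space of all `(q, p, y)`, which is the
derivative of the phase with respect to `y_j`. -/
noncomputable def gradPhase (Θy : Matrix (Fin d) (Fin d) ℂ) (j : Fin d) :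
    (E d × E d × E d) →L[ℝ] ℂ :=
  -momentum j +
    ∑ k, (Complex.I * Θy j k) • displacement k

theorem gradPhase_apply (j : Fin d) (w : E d × E d × E d) :
    gradPhase Θy j w = -((w.2.1 j : ℝ) : ℂ) + Complex.I * (Θy *ᵥ cvec (w.2.2 - w.1)) j := by
  simp [gradPhase, Matrix.mulVec, dotProduct, cvec, Finset.mul_sum, mul_assoc]

/-- The part of the phase that depends on `y`. -/
noncomputable def innerPhase (Θy : Matrix (Fin d) (Fin d) ℂ) (w : E d × E d × E d) : ℂ :=
  -(cvec w.2.1 ⬝ᵥ cvec (w.2.2 - w.1)) +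
    Complex.I / 2 * (cvec (w.2.2 - w.1) ⬝ᵥ Θy *ᵥ cvec (w.2.2 - w.1))

/-- The part of the phase that does not depend on `y`. -/
noncomputable def outerPhase (κ : Phase d → Phase d) (S : Phase d → ℝ)
    (Θx : Matrix (Fin d) (Fin d) ℂ) (x : E d) (z : Phase d) : ℂ :=
  (S z : ℂ) + cvec (κ z).2 ⬝ᵥ cvec (x - (κ z).1) +
    Complex.I / 2 * (cvec (x - (κ z).1) ⬝ᵥ Θx *ᵥ cvec (x - (κ z).1))

theorem phase_eq (κ : Phase d → Phase d) (S : Phase d → ℝ) (x y q p : E d) :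
    phase κ S Θx Θy x y q p = outerPhase κ S Θx x (q, p) + innerPhase Θy (q, p, y) := by
  simp only [phase, outerPhase, innerPhase]
  ring

/-- Symmetry of `Θ` makes the two terms of the product rule equal, which cancels the factor `1/2`.
-/
theorem hasFDerivAt_quadratic {V : Type*} [NormedAddCommGroup V] [NormedSpace ℝ V]
    {Θ : Matrix (Fin d) (Fin d) ℂ} (hΘ : Θᵀ = Θ) {s : V → Fin d → ℂ} {s' : Fin d → V →L[ℝ] ℂ}
    {w : V} (hs : ∀ k, HasFDerivAt (fun w => s w k) (s' k) w) :
    HasFDerivAt (fun w => Complex.I / 2 * (s w ⬝ᵥ Θ *ᵥ s w))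
      (∑ k, (Complex.I * (Θ *ᵥ s w) k) • s' k) w := by
  have hsymm : ∀ k l, Θ k l = Θ l k := fun k l => congrFun (congrFun hΘ.symm k) l
  have h1 : HasFDerivAt (fun w => ∑ k, s w k * ∑ l, Θ k l * s w l)
      (∑ k, (s w k • ∑ l, Θ k l • s' l + (∑ l, Θ k l * s w l) • s' k)) w :=
    HasFDerivAt.fun_sum fun k _ =>
      (hs k).mul (HasFDerivAt.fun_sum fun l _ => (hs l).const_mul (Θ k l))
  refine (h1.const_mul (Complex.I / 2)).congr_fderiv ?_
  ext e
  simp only [FunLike.coe_smul, Pi.smul_apply, FunLike.coe_add, Pi.add_apply,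
    FunLike.coe_sum, Finset.sum_apply, smul_eq_mul, Finset.sum_add_distrib,
    Matrix.mulVec, dotProduct]
  have h2 : ∑ k, s w k * ∑ l, Θ k l * s' l e = ∑ k, (∑ l, Θ k l * s w l) * s' k e := by
    simp only [Finset.mul_sum, Finset.sum_mul]
    rw [Finset.sum_comm]
    refine Finset.sum_congr rfl fun k _ => Finset.sum_congr rfl fun l _ => ?_
    rw [hsymm l k]; ring
  rw [h2, ← two_mul, Finset.mul_sum, Finset.mul_sum]
  refine Finset.sum_congr rfl fun k _ => ?_
  ring

theorem hasFDerivAt_innerPhase (hΘy : Θyᵀ = Θy) (w : E d × E d × E d) :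
    HasFDerivAt (innerPhase Θy)
      (∑ k, (gradPhase Θy k w • displacement k -
        cvec (w.2.2 - w.1) k • momentum k)) w := by
  have hs : ∀ k, HasFDerivAt (fun w : E d × E d × E d => cvec (w.2.2 - w.1) k)
      (displacement k) w := fun k => (displacement k).hasFDerivAt
  have hp : ∀ k, HasFDerivAt (fun w : E d × E d × E d => cvec w.2.1 k)
      (momentum k) w := fun k => (momentum k).hasFDerivAt
  have h1 := ((HasFDerivAt.fun_sum (u := Finset.univ) fun k _ => (hp k).mul (hs k)).neg).add
    (hasFDerivAt_quadratic hΘy hs)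
  refine HasFDerivAt.congr_fderiv h1 ?_
  refine ContinuousLinearMap.ext fun e => ?_
  simp only [FunLike.coe_smul, Pi.smul_apply, FunLike.coe_add, Pi.add_apply, FunLike.coe_sub,
    Pi.sub_apply, FunLike.coe_neg, Pi.neg_apply,
    FunLike.coe_sum, Finset.sum_apply, smul_eq_mul, gradPhase_apply,
    displacement_apply, momentum_apply, ← Finset.sum_add_distrib, ← Finset.sum_neg_distrib]
  refine Finset.sum_congr rfl fun k _ => ?_
  simp only [cvec]
  ring

theorem contDiff_innerPhase : ContDiff ℝ ∞ (innerPhase Θy) := by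
  have hs : ∀ k, ContDiff ℝ ∞ (fun w : E d × E d × E d => cvec (w.2.2 - w.1) k) := fun k =>
    (displacement k).contDiff
  have hp : ∀ k, ContDiff ℝ ∞ (fun w : E d × E d × E d => cvec w.2.1 k) := fun k =>
    (momentum k).contDiff
  unfold innerPhase
  simp only [Matrix.mulVec, dotProduct]
  refine ContDiff.add (ContDiff.neg (ContDiff.sum fun k _ => (hp k).mul (hs k))) ?_
  exact contDiff_const.mul (ContDiff.sum fun k _ => (hs k).mul
    (ContDiff.sum fun l _ => contDiff_const.mul (hs l)))

theorem hasFDerivAt_fiber (q p y : E d) :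
    HasFDerivAt (𝕜 := ℝ) (fun y : E d => (q, p, y))
      (ContinuousLinearMap.prod 0 (ContinuousLinearMap.prod 0 (ContinuousLinearMap.id ℝ (E d)))) y :=
  (hasFDerivAt_const q y).prodMk ((hasFDerivAt_const p y).prodMk (hasFDerivAt_id y))

theorem dy_phase (hΘy : Θyᵀ = Θy) (κ : Phase d → Phase d) (S : Phase d → ℝ) (x q p : E d)
    (j : Fin d) (y : E d) :
    dy j (fun y => phase κ S Θx Θy x y q p) y = gradPhase Θy j (q, p, y) := by
  have h1 := hasFDerivAt_fiber q p y
  have h2 := ((hasFDerivAt_innerPhase hΘy (q, p, y)).comp y h1).const_add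
    (outerPhase κ S Θx x (q, p))
  have h3 : (fun y => phase κ S Θx Θy x y q p) =
      fun y => outerPhase κ S Θx x (q, p) + (innerPhase Θy ∘ fun y => (q, p, y)) y := by
    ext y; exact phase_eq ..
  rw [dy, h3, h2.fderiv]
  simp [cvec, apply_ite]

theorem IsAdmissibleMatrix.re_cvec_form_le {Θ : Matrix (Fin d) (Fin d) ℂ}
    (h : IsAdmissibleMatrix Θ) :
    ∃ c : ℝ, 0 < c ∧ ∀ s : E d, c * ‖s‖ ^ 2 ≤ (cvec s ⬝ᵥ Θ *ᵥ cvec s).re := by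
  obtain ⟨c, hc, H⟩ := h.exists_pos_le
  refine ⟨c, hc, fun s => ?_⟩
  have h1 : star (cvec s) = cvec s := by ext i; simp [cvec]
  have h2 : ‖s‖ ^ 2 = ∑ i, ‖cvec s i‖ ^ 2 := by
    rw [EuclideanSpace.norm_sq_eq]
    simp [cvec]
  have := H (cvec s)
  rwa [h1, ← h2] at this

theorem norm_exp_I_div_mul (ε : ℝ) (ψ : ℂ) :
    ‖Complex.exp (Complex.I / ε * ψ)‖ = Real.exp (-(ψ.im / ε)) := by
  rw [Complex.norm_exp]
  congr 1
  have : Complex.I / (ε : ℂ) * ψ = ((1 / ε : ℝ) : ℂ) * (Complex.I * ψ) := by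
    push_cast; ring
  rw [this, Complex.re_ofReal_mul, Complex.I_mul_re]
  ring

theorem im_innerPhase (w : E d × E d × E d) :
    (innerPhase Θy w).im = (cvec (w.2.2 - w.1) ⬝ᵥ Θy *ᵥ cvec (w.2.2 - w.1)).re / 2 := by
  have h1 : (cvec w.2.1 ⬝ᵥ cvec (w.2.2 - w.1)).im = 0 := by
    simp [dotProduct, cvec]
  have h2 : Complex.I / 2 = ((1 / 2 : ℝ) : ℂ) * Complex.I := by push_cast; ring
  rw [innerPhase, Complex.add_im, Complex.neg_im, h1, h2, mul_assoc, Complex.im_ofReal_mul,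
    Complex.I_mul_im]
  ring

theorem im_outerPhase (κ : Phase d → Phase d) (S : Phase d → ℝ) (x : E d) (z : Phase d) :
    (outerPhase κ S Θx x z).im = (cvec (x - (κ z).1) ⬝ᵥ Θx *ᵥ cvec (x - (κ z).1)).re / 2 := by
  have h1 : (cvec (κ z).2 ⬝ᵥ cvec (x - (κ z).1)).im = 0 := by
    simp [dotProduct, cvec]
  have h2 : Complex.I / 2 = ((1 / 2 : ℝ) : ℂ) * Complex.I := by push_cast; ring
  rw [outerPhase, Complex.add_im, Complex.add_im, h1, h2, mul_assoc, Complex.im_ofReal_mul,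
    Complex.I_mul_im, Complex.ofReal_im]
  ring

theorem norm_exp_outerPhase_le (hΘx : IsAdmissibleMatrix Θx) (κ : Phase d → Phase d)
    (S : Phase d → ℝ) (x : E d) {ε : ℝ} (hε : 0 < ε) (z : Phase d) :
    ‖Complex.exp (Complex.I / ε * outerPhase κ S Θx x z)‖ ≤ 1 := by
  obtain ⟨c, hc, H⟩ := hΘx.re_cvec_form_le
  rw [norm_exp_I_div_mul, im_outerPhase, Real.exp_le_one_iff, neg_nonpos]
  have := H (x - (κ z).1)
  have h2 : 0 ≤ c * ‖x - (κ z).1‖ ^ 2 := by positivity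
  exact div_nonneg (by linarith) hε.le

theorem one_add_pow_mul_exp_neg_le {a : ℝ} (ha : 0 < a) (K : ℕ) :
    ∃ C : ℝ, 0 ≤ C ∧ ∀ t : ℝ, 0 ≤ t → Real.exp (-(a * t ^ 2)) ≤ C * ((1 + t) ^ K)⁻¹ := by
  -- Combines `1 + t ≤ 2(1 + t²)` with `s^K / K! ≤ e^s` at `s = a(1 + t²)`; the shift by `a` costs
  -- the factor `e^a`.
  refine ⟨2 ^ K * (a⁻¹ ^ K * (K.factorial * Real.exp a)), by positivity, fun t ht => ?_⟩
  rw [← div_eq_mul_inv, le_div_iff₀ (by positivity)]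
  have h1 : (1 + t) ^ K ≤ 2 ^ K * (1 + t ^ 2) ^ K := by
    rw [← mul_pow]
    refine pow_le_pow_left₀ (by positivity) ?_ K
    nlinarith [sq_nonneg (t - 1)]
  have h2 := Real.pow_div_factorial_le_exp (a + a * t ^ 2) (by positivity) K
  rw [div_le_iff₀ (by positivity)] at h2
  have h3 : (1 + t ^ 2) ^ K = a⁻¹ ^ K * (a + a * t ^ 2) ^ K := by
    rw [← mul_pow]; congr 1; field_simp
  have h4 : Real.exp (a + a * t ^ 2) * Real.exp (-(a * t ^ 2)) = Real.exp a := by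
    rw [← Real.exp_add]; ring_nf
  calc Real.exp (-(a * t ^ 2)) * (1 + t) ^ K
      ≤ Real.exp (-(a * t ^ 2)) * (2 ^ K * (a⁻¹ ^ K * (Real.exp (a + a * t ^ 2) *
          K.factorial))) := by
        refine mul_le_mul_of_nonneg_left (h1.trans ?_) (Real.exp_pos _).le
        rw [h3]
        gcongr
    _ = 2 ^ K * (a⁻¹ ^ K * (K.factorial *
          (Real.exp (a + a * t ^ 2) * Real.exp (-(a * t ^ 2))))) := by ring
    _ = _ := by rw [h4]

/-- The imaginary part of the phase dominates a multiple of `|y - q|²`, so the exponential is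
bounded by a Gaussian in `y - q`. The constant depends on `ε`, which is harmless because the
equivalence is an identity at each `ε`. -/
theorem norm_exp_innerPhase_le (hΘy : IsAdmissibleMatrix Θy) {ε : ℝ} (hε : 0 < ε) (K : ℕ) :
    ∃ C : ℝ, 0 ≤ C ∧ ∀ w : E d × E d × E d,
      ‖Complex.exp (Complex.I / ε * innerPhase Θy w)‖ ≤ C * ((1 + ‖w.2.2 - w.1‖) ^ K)⁻¹ := by
  obtain ⟨c, hc, H⟩ := hΘy.re_cvec_form_le
  obtain ⟨C, hC0, hC⟩ := one_add_pow_mul_exp_neg_le (a := c / (2 * ε)) (by positivity) K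
  refine ⟨C, hC0, fun w => le_trans ?_ (hC _ (norm_nonneg _))⟩
  rw [norm_exp_I_div_mul, im_innerPhase, Real.exp_le_exp, neg_le_neg_iff]
  have := H (w.2.2 - w.1)
  rw [div_div, le_div_iff₀ (by positivity)]
  calc _ = c * ‖w.2.2 - w.1‖ ^ 2 := by field_simp
    _ ≤ _ := this

theorem norm_exp_innerPhase_le_one (hΘy : IsAdmissibleMatrix Θy) {ε : ℝ} (hε : 0 < ε)
    (w : E d × E d × E d) : ‖Complex.exp (Complex.I / ε * innerPhase Θy w)‖ ≤ 1 := by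
  obtain ⟨c, hc, H⟩ := hΘy.re_cvec_form_le
  rw [norm_exp_I_div_mul, im_innerPhase, Real.exp_le_one_iff, neg_nonpos]
  have := H (w.2.2 - w.1)
  have h2 : 0 ≤ c * ‖w.2.2 - w.1‖ ^ 2 := by positivity
  exact div_nonneg (by linarith) hε.le

end PhaseFunction

/-! ### Linear forms and conjugates as symbols -/

section SymbolsOfFunctions

variable {V : Type*} [NormedAddCommGroup V] [NormedSpace ℝ V]

theorem isSymbol_clm (L : V →L[ℝ] ℂ) {w : V → ℝ} {C K : ℝ} (h : ∀ z, ‖L z‖ ≤ C * w z)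
    (h1 : ∀ z, 1 ≤ K * w z) : IsSymbol 1 w (fun _ => L) := by
  refine ⟨fun _ _ => L.contDiff, fun k => ?_⟩
  rcases k with _ | k
  · exact ⟨C, fun _ _ z => by simpa using h z⟩
  · refine ⟨‖L‖ * K, fun _ _ z => ?_⟩
    have hf : fderiv ℝ L = fun _ => L := by ext1 z; exact L.fderiv
    rw [← norm_iteratedFDeriv_fderiv, hf, mul_assoc]
    rcases Nat.eq_zero_or_pos k with rfl | hk
    · simpa using le_mul_of_one_le_right (norm_nonneg L) (h1 z)
    · rw [iteratedFDeriv_const_of_ne hk.ne']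
      simpa using mul_nonneg (norm_nonneg L) (zero_le_one.trans (h1 z))

theorem IsSymbol.conj {ε₀ : ℝ} {w : V → ℝ} {u : ℝ → V → ℂ} (hu : IsSymbol ε₀ w u) :
    IsSymbol ε₀ w (fun ε z => (starRingEnd ℂ) (u ε z)) := by
  refine ⟨fun ε hε => Complex.conjCLE.contDiff.comp (hu.1 ε hε), fun k => ?_⟩
  obtain ⟨C, hC⟩ := hu.2 k
  refine ⟨C, fun ε hε z => ?_⟩
  have := Complex.conjLIE.norm_iteratedFDeriv_comp_left (𝕜 := ℝ) (u ε) z k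
  exact this.le.trans (hC ε hε z)

end SymbolsOfFunctions

/-! ### Gain of decay from the regularising operator -/

section RegularisedIntegrand

variable {d : ℕ} {Θx Θy : Matrix (Fin d) (Fin d) ℂ}

/-- The weight `⟨(p, y - q)⟩`. -/
noncomputable def fiberWeight (w : E d × E d × E d) : ℝ :=
  Real.sqrt (1 + ‖w.2.1‖ ^ 2 + ‖w.2.2 - w.1‖ ^ 2)

theorem one_le_fiberWeight (w : E d × E d × E d) : 1 ≤ fiberWeight w := by
  rw [fiberWeight, Real.one_le_sqrt]
  nlinarith [sq_nonneg ‖w.2.1‖, sq_nonneg ‖w.2.2 - w.1‖]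

theorem fiberWeight_mul_self (w : E d × E d × E d) :
    fiberWeight w * fiberWeight w = 1 + ‖w.2.1‖ ^ 2 + ‖w.2.2 - w.1‖ ^ 2 :=
  Real.mul_self_sqrt (by positivity)

theorem norm_displacement_le (k : Fin d) (w : E d × E d × E d) :
    ‖displacement k w‖ ≤ fiberWeight w := by
  have h1 : ‖displacement k w‖ ≤ ‖w.2.2 - w.1‖ := by
    rw [displacement_apply, cvec, Complex.norm_real]
    exact PiLp.norm_apply_le _ k
  refine h1.trans (Real.le_sqrt_of_sq_le ?_)
  nlinarith [sq_nonneg ‖w.2.1‖]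

theorem norm_momentum_le (k : Fin d) (w : E d × E d × E d) :
    ‖momentum k w‖ ≤ fiberWeight w := by
  have h1 : ‖momentum k w‖ ≤ ‖w.2.1‖ := by
    rw [momentum_apply, cvec, Complex.norm_real]
    exact PiLp.norm_apply_le _ k
  refine h1.trans (Real.le_sqrt_of_sq_le ?_)
  nlinarith [sq_nonneg ‖w.2.2 - w.1‖]

theorem isSymbol_gradPhase (j : Fin d) :
    IsSymbol 1 fiberWeight (fun _ => (gradPhase Θy j : E d × E d × E d → ℂ)) := by
  have h1 : ∀ z : E d × E d × E d, 1 ≤ 1 * fiberWeight z := fun z => by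
    rw [one_mul]; exact one_le_fiberWeight z
  have hd : ∀ k : Fin d, IsSymbol 1 fiberWeight (fun _ => ⇑(displacement k)) := fun k =>
    isSymbol_clm _ (C := 1) (fun z => by rw [one_mul]; exact norm_displacement_le k z) h1
  have hp : ∀ k : Fin d, IsSymbol 1 fiberWeight (fun _ => ⇑(momentum k)) := fun k =>
    isSymbol_clm _ (C := 1) (fun z => by rw [one_mul]; exact norm_momentum_le k z) h1
  refine ((hp j).neg.add (IsSymbol.sum (s := Finset.univ) fun k _ =>
    (hd k).const_mul (Complex.I * Θy j k))).congr fun _ _ z => ?_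
  simp [gradPhase]

/-- The function `1 + |∇_y Φ|²`. -/
noncomputable def phaseDenom (Θy : Matrix (Fin d) (Fin d) ℂ) (w : E d × E d × E d) : ℝ :=
  1 + ∑ j, ‖gradPhase Θy j w‖ ^ 2

theorem phaseDenom_pos (w : E d × E d × E d) : 0 < phaseDenom Θy w := by
  have : 0 ≤ ∑ j, ‖gradPhase Θy j w‖ ^ 2 := Finset.sum_nonneg fun _ _ => by positivity
  rw [phaseDenom]; linarith

theorem ofReal_phaseDenom (w : E d × E d × E d) : (phaseDenom Θy w : ℂ) =
    1 + ∑ j, (starRingEnd ℂ) (gradPhase Θy j w) * gradPhase Θy j w := by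
  rw [phaseDenom]
  push_cast
  simp only [Complex.conj_mul']

theorem isSymbol_phaseDenom :
    IsSymbol 1 (fun w => fiberWeight w * fiberWeight w)
      (fun _ (w : E d × E d × E d) => (phaseDenom Θy w : ℂ)) := by
  simp only [ofReal_phaseDenom]
  refine IsSymbol.add ?_ (IsSymbol.sum fun j _ =>
    (isSymbol_gradPhase j).conj.mul (isSymbol_gradPhase j))
  refine (isSymbol_const (fun _ => 1) 1 (by simp)).mono 1 (fun _ => zero_le_one) fun z => ?_
  have := one_le_fiberWeight z
  nlinarith

/-- With `s = y - q`, the pairing of `s` with `-i ∇_y Φ` is `s · Θ^y s + i s · p`. The second term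
is purely imaginary, so coercivity bounds the real part below and the Cauchy–Schwarz inequality
bounds it above. -/
theorem sq_mul_norm_sub_sq_le {c : ℝ} (hc : 0 < c)
    (H : ∀ s : E d, c * ‖s‖ ^ 2 ≤ (cvec s ⬝ᵥ Θy *ᵥ cvec s).re) (w : E d × E d × E d) :
    c ^ 2 * ‖w.2.2 - w.1‖ ^ 2 ≤ ∑ j, ‖gradPhase Θy j w‖ ^ 2 := by
  set s := w.2.2 - w.1 with hs
  have hn : ‖s‖ ^ 2 = ∑ i, ‖cvec s i‖ ^ 2 := by
    rw [EuclideanSpace.norm_sq_eq]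
    simp [cvec]
  have h1 : c * ‖s‖ ^ 2 ≤ ∑ j, ‖cvec s j‖ * ‖gradPhase Θy j w‖ := by
    have e1 : (cvec s ⬝ᵥ Θy *ᵥ cvec s).re =
        (∑ j, cvec s j * (-Complex.I * gradPhase Θy j w)).re := by
      rw [dotProduct, Complex.re_sum, Complex.re_sum]
      refine Finset.sum_congr rfl fun j _ => ?_
      rw [gradPhase_apply, ← hs]
      have e2 : ((s j * w.2.1 j : ℝ) : ℂ) = cvec s j * ((w.2.1 j : ℝ) : ℂ) := by simp [cvec]
      have : cvec s j * (-Complex.I * (-((w.2.1 j : ℝ) : ℂ) + Complex.I *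
          (Θy *ᵥ cvec s) j)) = cvec s j * (Θy *ᵥ cvec s) j +
          Complex.I * ((s j * w.2.1 j : ℝ) : ℂ) := by
        rw [e2]
        linear_combination (-(cvec s j) * (Θy *ᵥ cvec s) j) * Complex.I_mul_I
      rw [this, Complex.add_re, Complex.I_mul_re, Complex.ofReal_im, neg_zero, add_zero]
    refine (H s).trans (e1.le.trans ((Complex.re_le_norm _).trans ((norm_sum_le _ _).trans
      (le_of_eq ?_))))
    simp
  have h2 : (c * ‖s‖ ^ 2) ^ 2 ≤ ‖s‖ ^ 2 * ∑ j, ‖gradPhase Θy j w‖ ^ 2 := by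
    refine (pow_le_pow_left₀ (by positivity) h1 2).trans ?_
    rw [hn]
    exact Finset.sum_mul_sq_le_sq_mul_sq _ _ _
  have hG0 : 0 ≤ ∑ j, ‖gradPhase Θy j w‖ ^ 2 := Finset.sum_nonneg fun _ _ => by positivity
  -- A factor `‖s‖²` is to be cancelled, so `s = 0` is separate.
  rcases (sq_nonneg ‖s‖).eq_or_lt with h0 | h0
  · rw [← h0, mul_zero]; exact hG0
  · refine le_of_mul_le_mul_left ?_ h0
    calc _ = (c * ‖s‖ ^ 2) ^ 2 := by ring
      _ ≤ _ := h2

/-- Solving for the momentum gives `p = -∇_y Φ + iΘ^y (y - q)`. -/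
theorem norm_momentum_sq_le (w : E d × E d × E d) :
    ‖w.2.1‖ ^ 2 ≤ 2 * ∑ j, ‖gradPhase Θy j w‖ ^ 2 +
      2 * ((∑ i, ∑ j, ‖Θy i j‖ ^ 2) * ‖w.2.2 - w.1‖ ^ 2) := by
  set s := w.2.2 - w.1 with hs
  have hn : ‖s‖ ^ 2 = ∑ i, ‖cvec s i‖ ^ 2 := by
    rw [EuclideanSpace.norm_sq_eq]
    simp [cvec]
  have e2 := sum_norm_sq_mulVec_le Θy (cvec s)
  have e3 : ‖w.2.1‖ ^ 2 ≤
      2 * ∑ j, ‖gradPhase Θy j w‖ ^ 2 + 2 * ∑ i, ‖(Θy *ᵥ cvec s) i‖ ^ 2 := by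
    rw [EuclideanSpace.norm_sq_eq, Finset.mul_sum, Finset.mul_sum, ← Finset.sum_add_distrib]
    refine Finset.sum_le_sum fun j _ => ?_
    have e4 : ‖w.2.1 j‖ ≤ ‖gradPhase Θy j w‖ + ‖(Θy *ᵥ cvec s) j‖ := by
      have : ((w.2.1 j : ℝ) : ℂ) = -gradPhase Θy j w + Complex.I * (Θy *ᵥ cvec s) j := by
        rw [gradPhase_apply, ← hs]; ring
      rw [← Complex.norm_real (w.2.1 j), this]
      refine (norm_add_le _ _).trans (le_of_eq ?_)
      simp
    calc ‖w.2.1 j‖ ^ 2 ≤ (‖gradPhase Θy j w‖ + ‖(Θy *ᵥ cvec s) j‖) ^ 2 :=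
          pow_le_pow_left₀ (norm_nonneg _) e4 2
      _ ≤ _ := by
        have := sq_nonneg (‖gradPhase Θy j w‖ - ‖(Θy *ᵥ cvec s) j‖)
        linarith
  rw [hn]
  linarith

/-- The phase is uniformly non-stationary in `y` for large `(p, y - q)`: the gradient controls `y -
q`, and through it `p`. -/
theorem exists_le_phaseDenom (hΘy : IsAdmissibleMatrix Θy) :
    ∃ c : ℝ, 0 < c ∧ ∀ w : E d × E d × E d,
      c * (fiberWeight w * fiberWeight w) ≤ phaseDenom Θy w := by
  obtain ⟨c, hc, H⟩ := hΘy.re_cvec_form_le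
  have hM : 0 ≤ ∑ i, ∑ j, ‖Θy i j‖ ^ 2 :=
    Finset.sum_nonneg fun _ _ => Finset.sum_nonneg fun _ _ => by positivity
  have key := fun w => norm_momentum_sq_le (Θy := Θy) w
  have key' := fun w => sq_mul_norm_sub_sq_le hc H w
  simp only [phaseDenom, fiberWeight_mul_self]
  generalize (∑ i, ∑ j, ‖Θy i j‖ ^ 2) = M at hM key
  have hB : 0 ≤ (2 * M + 1) / c ^ 2 := by positivity
  -- If `G` is the squared gradient, then `|y - q|² ≤ G/c²` and `|p|² ≤ 2G + 2M|y - q|²`; the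
  -- constant comes from their sum.
  refine ⟨(2 + (2 * M + 1) / c ^ 2)⁻¹, by positivity, fun w => ?_⟩
  rw [inv_mul_le_iff₀ (by positivity)]
  have h1 := key w
  have h2 := key' w
  generalize ∑ j, ‖gradPhase Θy j w‖ ^ 2 = G at h1 h2
  have h5 : ‖w.2.2 - w.1‖ ^ 2 ≤ G / c ^ 2 := by
    rw [le_div_iff₀ (by positivity)]; linarith
  have h6 : (2 * M + 1) * ‖w.2.2 - w.1‖ ^ 2 ≤ (2 * M + 1) * (G / c ^ 2) := by gcongr
  have h7 : (2 * M + 1) * (G / c ^ 2) = (2 * M + 1) / c ^ 2 * G := by ring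
  nlinarith

theorem isSymbol_inv_phaseDenom (hΘy : IsAdmissibleMatrix Θy) :
    IsSymbol 1 (fun w => (fiberWeight w * fiberWeight w)⁻¹)
      (fun _ (w : E d × E d × E d) => (phaseDenom Θy w : ℂ)⁻¹) := by
  obtain ⟨c, hc, H⟩ := exists_le_phaseDenom hΘy
  refine isSymbol_phaseDenom.inv (fun z => ?_) hc fun _ _ z => ?_
  · have := one_le_fiberWeight z
    positivity
  · rw [Complex.norm_real]
    exact (H z).trans (le_abs_self _)

/-- The operator `L_y^†`, acting on functions of `(q, p, y)`. -/
noncomputable def fiberLadj (Θy : Matrix (Fin d) (Fin d) ℂ) (ε : ℝ) (f : E d × E d × E d → ℂ)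
    (w : E d × E d × E d) : ℂ :=
  f w / (phaseDenom Θy w : ℂ) + Complex.I * ε * ∑ j, fderiv ℝ (fun w =>
    (starRingEnd ℂ) (gradPhase Θy j w) * f w / (phaseDenom Θy w : ℂ)) w
      (0, 0, EuclideanSpace.single j 1)

theorem isSymbol_conj_gradPhase_mul (hΘy : IsAdmissibleMatrix Θy) {W : E d × E d × E d → ℝ}
    (hW : ∀ w, 0 ≤ W w) {f : E d × E d × E d → ℂ} (hf : IsSymbol 1 W (fun _ => f)) (j : Fin d) :
    IsSymbol 1 (fun w => W w * (fiberWeight w)⁻¹)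
      (fun _ w => (starRingEnd ℂ) (gradPhase Θy j w) * f w / (phaseDenom Θy w : ℂ)) := by
  refine ((((isSymbol_gradPhase (Θy := Θy) j).conj.mul hf).mul
    (isSymbol_inv_phaseDenom hΘy)).congr fun _ _ z => (div_eq_mul_inv _ _).symm).mono 1
    (fun z => ?_) fun z => le_of_eq ?_
  · have := one_le_fiberWeight z
    have := hW z
    positivity
  · have := one_le_fiberWeight z
    field_simp

/-- The conjugate gradient has order one and the denominator order two in `(p, y - q)`, and
differentiation does not raise the order. Each application therefore gains one power of the weight.
-/
theorem isSymbol_fiberLadj (hΘy : IsAdmissibleMatrix Θy) (ε : ℝ) {W : E d × E d × E d → ℝ}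
    (hW : ∀ w, 0 ≤ W w) {f : E d × E d × E d → ℂ} (hf : IsSymbol 1 W (fun _ => f)) :
    IsSymbol 1 (fun w => W w * (fiberWeight w)⁻¹) (fun _ => fiberLadj Θy ε f) := by
  refine IsSymbol.add ?_ ((IsSymbol.sum fun j _ =>
    (isSymbol_conj_gradPhase_mul hΘy hW hf j).fderiv_apply _).const_mul _)
  refine ((hf.mul (isSymbol_inv_phaseDenom hΘy)).congr
    fun _ _ z => (div_eq_mul_inv _ _).symm).mono 1 (fun z => ?_) fun z => ?_
  · have := one_le_fiberWeight z
    have := hW z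
    positivity
  · have := one_le_fiberWeight z
    rw [one_mul]
    refine mul_le_mul_of_nonneg_left (inv_anti₀ (by linarith) ?_) (hW z)
    nlinarith

theorem isSymbol_iterate_fiberLadj (hΘy : IsAdmissibleMatrix Θy) (ε : ℝ)
    {W : E d × E d × E d → ℝ} (hW : ∀ w, 0 ≤ W w) {f : E d × E d × E d → ℂ}
    (hf : IsSymbol 1 W (fun _ => f)) (n : ℕ) :
    IsSymbol 1 (fun w => W w * (fiberWeight w)⁻¹ ^ n) (fun _ => (fiberLadj Θy ε)^[n] f) := by
  induction n with
  | zero => simpa using hf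
  | succ n ih =>
    simp only [Function.iterate_succ_apply', pow_succ, ← mul_assoc]
    refine isSymbol_fiberLadj hΘy ε (fun w => ?_) ih
    have := one_le_fiberWeight w
    have := hW w
    positivity

theorem dy_fiber {f : E d × E d × E d → ℂ} (hf : Differentiable ℝ f) (q p y : E d) (j : Fin d) :
    dy j (fun y => f (q, p, y)) y = fderiv ℝ f (q, p, y) (0, 0, EuclideanSpace.single j 1) := by
  have h := (hf (q, p, y)).hasFDerivAt.comp y (hasFDerivAt_fiber q p y)
  have h2 : (fun y => f (q, p, y)) = f ∘ fun y => (q, p, y) := rfl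
  rw [dy, h2, h.fderiv]
  rfl

theorem dy_conj {f : E d → ℂ} {y : E d} (j : Fin d) :
    dy j (fun y => (starRingEnd ℂ) (f y)) y = (starRingEnd ℂ) (dy j f y) := by
  have : (fun y => (starRingEnd ℂ) (f y)) = Complex.conjCLE ∘ f := rfl
  rw [dy, this, ContinuousLinearEquiv.comp_fderiv]
  rfl

/-- Identifies the operator in `y` alone with the one on all `(q, p, y)`, where joint symbol
estimates can be iterated. -/
theorem Ladj_fiber (hΘy : IsAdmissibleMatrix Θy) (κ : Phase d → Phase d) (S : Phase d → ℝ)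
    (x q p : E d) (ε : ℝ) {f : E d × E d × E d → ℂ} {W : E d × E d × E d → ℝ}
    (hW : ∀ w, 0 ≤ W w) (hf : IsSymbol 1 W (fun _ => f)) :
    Ladj ε (fun y => phase κ S Θx Θy x y q p) (fun y => f (q, p, y)) =
      fun y => fiberLadj Θy ε f (q, p, y) := by
  ext y
  simp only [Ladj, dy_conj, dy_phase hΘy.symm, fiberLadj]
  congr 2
  refine Finset.sum_congr rfl fun j _ => ?_
  exact dy_fiber ((isSymbol_conj_gradPhase_mul hΘy hW hf j).differentiable
    (ε := 1) ⟨one_pos, le_rfl⟩) q p y j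

theorem iterate_Ladj_fiber (hΘy : IsAdmissibleMatrix Θy) (κ : Phase d → Phase d) (S : Phase d → ℝ)
    (x q p : E d) (ε : ℝ) {f : E d × E d × E d → ℂ} {W : E d × E d × E d → ℝ}
    (hW : ∀ w, 0 ≤ W w) (hf : IsSymbol 1 W (fun _ => f)) (n : ℕ) :
    (Ladj ε (fun y => phase κ S Θx Θy x y q p))^[n] (fun y => f (q, p, y)) =
      fun y => (fiberLadj Θy ε)^[n] f (q, p, y) := by
  induction n with
  | zero => rfl
  | succ n ih =>
    rw [Function.iterate_succ_apply', ih]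
    have hsym := isSymbol_iterate_fiberLadj hΘy ε hW hf n
    simp only [Function.iterate_succ_apply']
    refine Ladj_fiber hΘy κ S x q p ε (fun w => ?_) hsym
    have := one_le_fiberWeight w
    have := hW w
    positivity

end RegularisedIntegrand

/-! ### Absolute convergence and removal of `L_y^†` -/

section FiberSymbols

variable {d : ℕ} {Θx Θy : Matrix (Fin d) (Fin d) ℂ} {m : ℝ} {f : E d × E d × E d → ℂ}

/-- The weight `(1 + |q|)^L (1 + |y|)^{-N} ⟨p⟩^m`. -/
noncomputable def decayWeight (L N : ℕ) (m : ℝ) (w : E d × E d × E d) : ℝ :=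
  (1 + ‖w.1‖) ^ L * ((1 + ‖w.2.2‖) ^ N)⁻¹ * Real.sqrt (1 + ‖w.2.1‖ ^ 2) ^ m

theorem one_le_bracket (p : E d) : 1 ≤ Real.sqrt (1 + ‖p‖ ^ 2) := by
  rw [Real.one_le_sqrt]
  nlinarith [sq_nonneg ‖p‖]

theorem decayWeight_nonneg (L N : ℕ) (m : ℝ) (w : E d × E d × E d) : 0 ≤ decayWeight L N m w := by
  unfold decayWeight
  positivity

/-- Symbols in `(q, p, y)` which decrease rapidly in `y`, grow polynomially in `q` and have
order `m` in `p`. -/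
def IsFiberSymbol (m : ℝ) (f : E d × E d × E d → ℂ) : Prop :=
  ∃ L : ℕ, ∀ N : ℕ, IsSymbol 1 (decayWeight L N m) (fun _ => f)

theorem isSymbol_schwartz (φ : 𝓢(E d, ℂ)) (N : ℕ) :
    IsSymbol 1 (fun y : E d => ((1 + ‖y‖) ^ N)⁻¹) (fun _ => φ) := by
  refine ⟨fun _ _ => φ.smooth _, fun k => ⟨2 ^ N * ((Finset.Iic (N, k)).sup fun m =>
    SchwartzMap.seminorm ℝ m.1 m.2) φ, fun _ _ y => ?_⟩⟩
  · rw [← div_eq_mul_inv, le_div_iff₀ (by positivity), mul_comm]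
    exact SchwartzMap.one_add_le_sup_seminorm_apply (𝕜 := ℝ) (m := (N, k)) le_rfl le_rfl φ y

theorem weight31_nonneg (M m : ℝ) (z : Full d) : 0 ≤ weight31 M m z := by
  unfold weight31
  positivity

/-- With `x` frozen, `⟨(x, y, q)⟩ ≤ (1 + |x|)(1 + |q|)(1 + |y|)`; replacing the exponent by a larger
natural number is allowed since the bracket is at least one. -/
theorem exists_weight31_le (M m : ℝ) (x : E d) : ∃ (L : ℕ) (C : ℝ), 0 ≤ C ∧
    ∀ w : E d × E d × E d, weight31 M m (x, w.2.2, w.1, w.2.1) ≤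
      C * ((1 + ‖w.1‖) ^ L * (1 + ‖w.2.2‖) ^ L * Real.sqrt (1 + ‖w.2.1‖ ^ 2) ^ m) := by
  obtain ⟨L, hL⟩ := exists_nat_ge M
  refine ⟨L, (1 + ‖x‖) ^ L, by positivity, fun w => ?_⟩
  have h0 : 1 ≤ Real.sqrt (1 + ‖x‖ ^ 2 + ‖w.2.2‖ ^ 2 + ‖w.1‖ ^ 2) := by
    rw [Real.one_le_sqrt]
    nlinarith [sq_nonneg ‖x‖, sq_nonneg ‖w.2.2‖, sq_nonneg ‖w.1‖]
  have h1 : Real.sqrt (1 + ‖x‖ ^ 2 + ‖w.2.2‖ ^ 2 + ‖w.1‖ ^ 2) ≤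
      (1 + ‖x‖) * ((1 + ‖w.1‖) * (1 + ‖w.2.2‖)) := by
    rw [Real.sqrt_le_left (by positivity)]
    have ha := norm_nonneg x
    have hb := norm_nonneg w.1
    have hc := norm_nonneg w.2.2
    generalize ‖x‖ = a at *
    generalize ‖w.1‖ = b at *
    generalize ‖w.2.2‖ = c at *
    have e1 : 1 + b ^ 2 + c ^ 2 ≤ ((1 + b) * (1 + c)) ^ 2 := by
      have : 0 ≤ b * c := by positivity
      nlinarith [mul_nonneg this this, mul_nonneg hb this, mul_nonneg hc this]
    have e2 : 1 ≤ ((1 + b) * (1 + c)) ^ 2 := by nlinarith [sq_nonneg b, sq_nonneg c]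
    calc 1 + a ^ 2 + c ^ 2 + b ^ 2 ≤ (1 + 2 * a + a ^ 2) * ((1 + b) * (1 + c)) ^ 2 := by
          nlinarith [sq_nonneg a]
      _ = _ := by ring
  have h2 : Real.sqrt (1 + ‖x‖ ^ 2 + ‖w.2.2‖ ^ 2 + ‖w.1‖ ^ 2) ^ M ≤
      (1 + ‖x‖) ^ L * ((1 + ‖w.1‖) ^ L * (1 + ‖w.2.2‖) ^ L) := by
    refine (Real.rpow_le_rpow_of_exponent_le h0 hL).trans ?_
    rw [Real.rpow_natCast, ← mul_pow, ← mul_pow]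
    exact pow_le_pow_left₀ (by positivity) h1 L
  rw [weight31, ← mul_assoc]
  exact mul_le_mul_of_nonneg_right h2 (by positivity)

theorem IsSymbol31.isFiberSymbol {ε₀ : ℝ} {u : ℝ → Full d → ℂ} (hu : IsSymbol31 ε₀ m u) {ε : ℝ}
    (hε : ε ∈ Ioc 0 ε₀) (φ : 𝓢(E d, ℂ)) (x : E d) :
    IsFiberSymbol m (fun w => u ε (x, w.2.2, w.1, w.2.1) * φ w.2.2) := by
  obtain ⟨M, hu⟩ := hu
  obtain ⟨L, C, hC, hw⟩ := exists_weight31_le M m x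
  refine ⟨L, fun N => ?_⟩
  have h1 := (hu.freeze hε 1).comp_affine (ContinuousLinearMap.prod (0 : (E d × E d × E d) →L[ℝ] E d)
    (((ContinuousLinearMap.snd ℝ (E d) (E d)).comp (ContinuousLinearMap.snd ℝ (E d) (E d × E d))).prod
      ((ContinuousLinearMap.fst ℝ (E d) (E d × E d)).prod
        ((ContinuousLinearMap.fst ℝ (E d) (E d)).comp
          (ContinuousLinearMap.snd ℝ (E d) (E d × E d)))))) (x, 0, 0, 0)
  -- `L` of the powers of decay compensate the growth of the symbol in `y`, so the growth exponent
  -- in `q` does not depend on `N`.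
  have h2 := (isSymbol_schwartz φ (N + L)).comp_affine ((ContinuousLinearMap.snd ℝ (E d) (E d)).comp
    (ContinuousLinearMap.snd ℝ (E d) (E d × E d))) 0
  have h3 := h1.mul h2
  simp only [ContinuousLinearMap.prod_apply, _root_.zero_apply,
    ContinuousLinearMap.comp_apply, ContinuousLinearMap.coe_fst', ContinuousLinearMap.coe_snd',
    Prod.mk_add_mk, zero_add, add_zero] at h3
  refine h3.mono C (fun z => mul_nonneg (weight31_nonneg _ _ _) (by positivity)) fun z => ?_
  refine (mul_le_mul_of_nonneg_right (hw z) (by positivity)).trans (le_of_eq ?_)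
  rw [decayWeight, pow_add]
  field_simp

theorem isFiberSymbol_schwartz (φ : 𝓢(E d, ℂ)) :
    IsFiberSymbol 0 (fun w : E d × E d × E d => φ w.2.2) := by
  have h : IsSymbol31 (d := d) 1 0 (fun _ _ => 1) := by
    refine ⟨0, ?_⟩
    have := isSymbol_const (V := Full d) (ε₀ := 1) (fun _ => 1) 1 (by simp)
    exact this.mono 1 (fun _ => zero_le_one) fun z => by simp [weight31]
  simpa using h.isFiberSymbol (ε := 1) ⟨one_pos, le_rfl⟩ φ 0

theorem inv_fiberWeight_le (w : E d × E d × E d) :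
    (fiberWeight w)⁻¹ ≤ (Real.sqrt (1 + ‖w.2.1‖ ^ 2))⁻¹ := by
  refine inv_anti₀ (one_pos.trans_le (one_le_bracket _)) (Real.sqrt_le_sqrt ?_)
  nlinarith [sq_nonneg ‖w.2.2 - w.1‖]

theorem IsFiberSymbol.fiberLadj (hf : IsFiberSymbol m f) (hΘy : IsAdmissibleMatrix Θy) (ε : ℝ) :
    IsFiberSymbol m (fiberLadj Θy ε f) := by
  obtain ⟨L, hf⟩ := hf
  refine ⟨L, fun N => (isSymbol_fiberLadj hΘy ε (decayWeight_nonneg L N m) (hf N)).mono 1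
    (fun w => ?_) fun w => ?_⟩
  · have := one_le_fiberWeight w
    have := decayWeight_nonneg L N m w
    positivity
  · rw [one_mul]
    exact mul_le_of_le_one_right (decayWeight_nonneg L N m w) (inv_le_one_of_one_le₀
      (one_le_fiberWeight w))

theorem IsFiberSymbol.exists_norm_iterate_le (hf : IsFiberSymbol m f)
    (hΘy : IsAdmissibleMatrix Θy) (ε : ℝ) (n : ℕ) : ∃ L : ℕ, ∀ N : ℕ, ∃ C : ℝ, 0 ≤ C ∧ ∀ w,
      ‖(SemiclassicalFIO.fiberLadj Θy ε)^[n] f w‖ ≤ C * decayWeight L N (m - n) w := by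
  obtain ⟨L, hf⟩ := hf
  refine ⟨L, fun N => ?_⟩
  obtain ⟨C, hC⟩ := (isSymbol_iterate_fiberLadj hΘy ε (decayWeight_nonneg L N m) (hf N) n).norm_le
  refine ⟨|C|, abs_nonneg C, fun w => (hC 1 ⟨one_pos, le_rfl⟩ w).trans ?_⟩
  have h1 := one_le_fiberWeight w
  have h2 := decayWeight_nonneg L N m w
  have h4 := one_pos.trans_le (one_le_bracket w.2.1)
  have h3 : decayWeight L N m w * (fiberWeight w)⁻¹ ^ n ≤ decayWeight L N (m - n) w := by
    calc _ ≤ decayWeight L N m w * (Real.sqrt (1 + ‖w.2.1‖ ^ 2))⁻¹ ^ n :=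
          mul_le_mul_of_nonneg_left (pow_le_pow_left₀ (by positivity) (inv_fiberWeight_le w) n) h2
      _ = _ := by
          rw [decayWeight, decayWeight, Real.rpow_sub h4, Real.rpow_natCast, inv_pow, mul_assoc,
            div_eq_mul_inv]
  calc _ ≤ |C| * (decayWeight L N m w * (fiberWeight w)⁻¹ ^ n) :=
        mul_le_mul_of_nonneg_right (le_abs_self C) (by positivity)
    _ ≤ _ := by gcongr

theorem IsFiberSymbol.contDiff (hf : IsFiberSymbol m f) : ContDiff ℝ ∞ f := by
  obtain ⟨L, hf⟩ := hf
  exact (hf 0).contDiff (ε := 1) ⟨one_pos, le_rfl⟩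

theorem IsFiberSymbol.iterate (hf : IsFiberSymbol m f) (hΘy : IsAdmissibleMatrix Θy) (ε : ℝ)
    (n : ℕ) : IsFiberSymbol m ((SemiclassicalFIO.fiberLadj Θy ε)^[n] f) := by
  induction n with
  | zero => exact hf
  | succ n ih =>
    rw [Function.iterate_succ_apply']
    exact ih.fiberLadj hΘy ε

/-- The oscillating Gaussian makes the integrand decrease rapidly in `q` and `y`. -/
theorem IsFiberSymbol.exists_norm_exp_mul_iterate_le (hf : IsFiberSymbol m f)
    (hΘy : IsAdmissibleMatrix Θy) {ε : ℝ} (hε : 0 < ε) (n N : ℕ) : ∃ C : ℝ, 0 ≤ C ∧ ∀ w,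
      ‖Complex.exp (Complex.I / ε * innerPhase Θy w) *
        (SemiclassicalFIO.fiberLadj Θy ε)^[n] f w‖ ≤
      C * (((1 + ‖w.1‖) ^ N)⁻¹ * (((1 + ‖w.2.2‖) ^ N)⁻¹ *
        Real.sqrt (1 + ‖w.2.1‖ ^ 2) ^ (m - n))) := by
  obtain ⟨L, hL⟩ := hf.exists_norm_iterate_le hΘy ε n
  -- By `1 + |q| ≤ (1 + |y|)(1 + |y - q|)`, the Gaussian decay in `y - q` becomes decay of order `L
  -- + N` in `q` at the cost of `L + N` powers in `y`. Of those in `q`, `L` offset the growth of the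
  -- symbol.
  obtain ⟨C, hC0, hC⟩ := hL (N + (L + N))
  obtain ⟨D, hD0, hD⟩ := norm_exp_innerPhase_le hΘy hε (L + N)
  refine ⟨D * C, by positivity, fun w => ?_⟩
  rw [norm_mul]
  have h1 : 1 + ‖w.1‖ ≤ (1 + ‖w.2.2‖) * (1 + ‖w.2.2 - w.1‖) := by
    have : ‖w.1‖ ≤ ‖w.2.2‖ + ‖w.2.2 - w.1‖ := by
      have := norm_sub_le w.2.2 (w.2.2 - w.1)
      rwa [sub_sub_cancel] at this
    nlinarith [norm_nonneg w.2.2, norm_nonneg (w.2.2 - w.1),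
      mul_nonneg (norm_nonneg w.2.2) (norm_nonneg (w.2.2 - w.1))]
  have h2 : ((1 + ‖w.2.2 - w.1‖) ^ (L + N))⁻¹ ≤
      (1 + ‖w.2.2‖) ^ (L + N) * ((1 + ‖w.1‖) ^ (L + N))⁻¹ := by
    rw [← div_eq_mul_inv, le_div_iff₀ (by positivity), inv_mul_le_iff₀ (by positivity),
      ← mul_pow, mul_comm (1 + ‖w.2.2 - w.1‖)]
    exact pow_le_pow_left₀ (by positivity) h1 _
  calc _ ≤ (D * ((1 + ‖w.2.2 - w.1‖) ^ (L + N))⁻¹) *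
          (C * decayWeight L (N + (L + N)) (m - n) w) :=
        mul_le_mul (hD w) (hC w) (norm_nonneg _) (by positivity)
    _ ≤ (D * ((1 + ‖w.2.2‖) ^ (L + N) * ((1 + ‖w.1‖) ^ (L + N))⁻¹)) *
          (C * decayWeight L (N + (L + N)) (m - n) w) := by
        have := decayWeight_nonneg L (N + (L + N)) (m - n) w
        gcongr
    _ = _ := by
        rw [decayWeight, pow_add _ N (L + N), pow_add (1 + ‖w.1‖) L N]
        field_simp

theorem integrable_inv_one_add_norm_pow {N : ℕ} (hN : d < N) :
    Integrable (fun y : E d => ((1 + ‖y‖) ^ N)⁻¹) := by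
  have := integrable_one_add_norm (E := E d) (μ := volume) (r := N) (by simpa using hN)
  simpa [Real.rpow_neg, add_nonneg, Real.rpow_natCast] using this

theorem integrable_bracket_rpow {r : ℝ} (hr : r < -d) :
    Integrable (fun p : E d => Real.sqrt (1 + ‖p‖ ^ 2) ^ r) := by
  have := integrable_rpow_neg_one_add_norm_sq (E := E d) (μ := volume) (r := -r)
    (by simp; linarith)
  refine this.congr (Filter.Eventually.of_forall fun p => ?_)
  simp only [neg_neg]
  rw [Real.sqrt_eq_rpow, ← Real.rpow_mul (by positivity)]
  congr 1; ring

theorem continuous_exp_innerPhase (Θy : Matrix (Fin d) (Fin d) ℂ) (ε : ℝ) :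
    Continuous fun w : E d × E d × E d => Complex.exp (Complex.I / ε * innerPhase Θy w) :=
  Complex.continuous_exp.comp (continuous_const.mul contDiff_innerPhase.continuous)

theorem continuous_outerPhase {κ : Phase d ≃ Phase d} (hκ : IsCanonicalB κ) {S : Phase d → ℝ}
    (hS : Continuous S) (Θx : Matrix (Fin d) (Fin d) ℂ) (x : E d) :
    Continuous (outerPhase κ S Θx x) := by
  have h1 := hκ.contDiff.continuous
  have h2 : Continuous fun z => (κ z).1 := by fun_prop
  have h3 : Continuous fun z => (κ z).2 := by fun_prop
  unfold outerPhase
  simp only [dotProduct, Matrix.mulVec, cvec]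
  fun_prop

/-- The condition `n > m + d` is what makes `⟨p⟩^{m - n}` integrable; the variables `q` and `y` have
as much decay as desired. -/
theorem IsFiberSymbol.integrable (hf : IsFiberSymbol m f) (hΘy : IsAdmissibleMatrix Θy) {ε : ℝ}
    (hε : 0 < ε) {n : ℕ} (hn : m + d < n) : Integrable (fun w : E d × E d × E d =>
      Complex.exp (Complex.I / ε * innerPhase Θy w) *
        (SemiclassicalFIO.fiberLadj Θy ε)^[n] f w) := by
  obtain ⟨C, -, hC⟩ := hf.exists_norm_exp_mul_iterate_le hΘy hε n (d + 1)
  have h1 := integrable_inv_one_add_norm_pow (d := d) (Nat.lt_succ_self d)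
  have h2 := integrable_bracket_rpow (d := d) (r := m - n) (by linarith)
  have h3 : Integrable (fun w : E d × E d × E d => ((1 + ‖w.1‖) ^ (d + 1))⁻¹ *
      (((1 + ‖w.2.2‖) ^ (d + 1))⁻¹ * Real.sqrt (1 + ‖w.2.1‖ ^ 2) ^ (m - n))) := by
    refine h1.mul_prod (g := fun v : E d × E d =>
      ((1 + ‖v.2‖) ^ (d + 1))⁻¹ * Real.sqrt (1 + ‖v.1‖ ^ 2) ^ (m - n)) ?_
    simp only [mul_comm ((1 + ‖_‖) ^ (d + 1))⁻¹]
    exact h2.mul_prod h1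
  refine (h3.const_mul C).mono' ?_ (Filter.Eventually.of_forall hC)
  exact ((continuous_exp_innerPhase Θy ε).mul
    (hf.iterate hΘy ε n).contDiff.continuous).aestronglyMeasurable

theorem integrable_fiber_of_le {L : ℕ} {g : E d × E d × E d → ℂ} (hg : Continuous g) {C : ℝ}
    (h : ∀ w, ‖g w‖ ≤ C * decayWeight L (d + 1) m w) (q p : E d) :
    Integrable (fun y => g (q, p, y)) := by
  have h1 := (integrable_inv_one_add_norm_pow (d := d) (Nat.lt_succ_self d)).const_mul
    (C * ((1 + ‖q‖) ^ L * Real.sqrt (1 + ‖p‖ ^ 2) ^ m))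
  refine h1.mono' (hg.comp (by fun_prop)).aestronglyMeasurable
    (Filter.Eventually.of_forall fun y => (h (q, p, y)).trans (le_of_eq ?_))
  simp only [decayWeight, Nat.succ_eq_add_one]
  ring

theorem IsFiberSymbol.integrable_fiber (hf : IsFiberSymbol m f) (hΘy : IsAdmissibleMatrix Θy)
    {ε : ℝ} (hε : 0 < ε) (q p : E d) :
    Integrable fun y => Complex.exp (Complex.I / ε * innerPhase Θy (q, p, y)) * f (q, p, y) := by
  have hc := hf.contDiff.continuous
  obtain ⟨L, hf⟩ := hf
  obtain ⟨C, hC⟩ := (hf (d + 1)).norm_le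
  refine integrable_fiber_of_le (L := L) (m := m) (C := C)
    ((continuous_exp_innerPhase Θy ε).mul hc) (fun w => ?_) q p
  refine le_trans ?_ (hC 1 ⟨one_pos, le_rfl⟩ w)
  rw [Pi.mul_apply, norm_mul]
  exact mul_le_of_le_one_left (norm_nonneg _) (norm_exp_innerPhase_le_one hΘy hε w)

theorem fderiv_exp_innerPhase (hΘy : Θyᵀ = Θy) (ε : ℝ) (q p y : E d) (j : Fin d) :
    fderiv ℝ (fun y => Complex.exp (Complex.I / ε * innerPhase Θy (q, p, y))) y
      (EuclideanSpace.single j 1) = Complex.I / ε * gradPhase Θy j (q, p, y) *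
        Complex.exp (Complex.I / ε * innerPhase Θy (q, p, y)) := by
  have h2 := (hasFDerivAt_innerPhase hΘy (q, p, y)).comp y (hasFDerivAt_fiber q p y)
  have h3 := (h2.const_mul (Complex.I / ε)).cexp
  have h4 : fderiv ℝ (fun y => innerPhase Θy (q, p, y)) y (EuclideanSpace.single j 1) =
      gradPhase Θy j (q, p, y) := by
    rw [← dy_phase (Θx := 0) hΘy (fun z => z) (fun _ => 0) 0 q p j y, dy]
    have : (fun y => phase (fun z => z) (fun _ => 0) 0 Θy 0 y q p) = fun y =>
        outerPhase (fun z => z) (fun _ => 0) 0 0 (q, p) + innerPhase Θy (q, p, y) := by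
      ext y; exact phase_eq ..
    rw [this, fderiv_const_add]
  have h5 := h2.fderiv
  change fderiv ℝ (fun y => innerPhase Θy (q, p, y)) y = _ at h5
  have h6 := h3.fderiv
  simp only [Function.comp_apply] at h6
  rw [h6, ← h5]
  simp only [FunLike.coe_smul, Pi.smul_apply, smul_eq_mul]
  rw [h4]
  ring

theorem differentiable_exp_innerPhase (hΘy : Θyᵀ = Θy) (ε : ℝ) (q p : E d) :
    Differentiable ℝ (fun y => Complex.exp (Complex.I / ε * innerPhase Θy (q, p, y))) :=
  fun y => (((hasFDerivAt_innerPhase hΘy (q, p, y)).comp y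
    (hasFDerivAt_fiber q p y)).const_mul (Complex.I / ε)).cexp.differentiableAt

/-- The operator `L_y^†` may be removed after integration over `y`. -/
theorem IsFiberSymbol.integral_fiberLadj (hf : IsFiberSymbol m f) (hΘy : IsAdmissibleMatrix Θy)
    {ε : ℝ} (hε : 0 < ε) (q p : E d) :
    ∫ y, Complex.exp (Complex.I / ε * innerPhase Θy (q, p, y)) *
        SemiclassicalFIO.fiberLadj Θy ε f (q, p, y) =
      ∫ y, Complex.exp (Complex.I / ε * innerPhase Θy (q, p, y)) * f (q, p, y) := by
  obtain ⟨L, hf'⟩ := hf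
  have hN := hf' (d + 1)
  have h1 : (1 : ℝ) ∈ Ioc (0 : ℝ) 1 := ⟨one_pos, le_rfl⟩
  have hεC : (ε : ℂ) ≠ 0 := by exact_mod_cast hε.ne'
  set e : E d → ℂ := fun y => Complex.exp (Complex.I / ε * innerPhase Θy (q, p, y)) with he
  have hec : Continuous fun w : E d × E d × E d =>
      Complex.exp (Complex.I / ε * innerPhase Θy w) := continuous_exp_innerPhase Θy ε
  set W : E d × E d × E d → ℝ := decayWeight L (d + 1) m
  have hW : ∀ w, 0 ≤ W w := decayWeight_nonneg L (d + 1) m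
  have hint : ∀ {g : E d × E d × E d → ℂ}, IsSymbol 1 W (fun _ => g) →
      Integrable fun y => e y * g (q, p, y) := by
    intro g hg
    obtain ⟨C, hC⟩ := hg.norm_le
    refine integrable_fiber_of_le (L := L) (m := m) (C := C) (hec.mul (hg.1 1 h1).continuous)
      (fun w => ?_) q p
    refine le_trans ?_ (hC 1 h1 w)
    rw [Pi.mul_apply, norm_mul]
    exact mul_le_of_le_one_left (norm_nonneg _) (norm_exp_innerPhase_le_one hΘy hε w)
  set h : Fin d → E d × E d × E d → ℂ := fun j w =>
    (starRingEnd ℂ) (gradPhase Θy j w) * f w / (phaseDenom Θy w : ℂ) with hh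
  have hsym : ∀ j, IsSymbol 1 (fun w => W w * (fiberWeight w)⁻¹) (fun _ => h j) := fun j =>
    isSymbol_conj_gradPhase_mul hΘy hW hN j
  have hsymW : ∀ {g : E d × E d × E d → ℂ},
      IsSymbol 1 (fun w => W w * (fiberWeight w)⁻¹) (fun _ => g) → IsSymbol 1 W (fun _ => g) := by
    intro g hg
    refine hg.mono 1 (fun w => ?_) fun w => ?_
    · have := one_le_fiberWeight w
      have := hW w
      positivity
    · rw [one_mul]
      exact mul_le_of_le_one_right (hW w) (inv_le_one_of_one_le₀ (one_le_fiberWeight w))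
  have hgrad : ∀ j, IsSymbol 1 W (fun _ w => gradPhase Θy j w * h j w) := fun j =>
    ((isSymbol_gradPhase j).mul (hsym j)).mono 1 (fun w => by
      have := one_le_fiberWeight w
      have := hW w
      positivity) fun w => le_of_eq (by
      have := one_le_fiberWeight w
      field_simp)
  have hdiv : IsSymbol 1 W (fun _ w => f w / (phaseDenom Θy w : ℂ)) := by
    refine ((hN.mul (isSymbol_inv_phaseDenom hΘy)).congr
      fun _ _ z => (div_eq_mul_inv _ _).symm).mono 1 (fun z => ?_) fun z => ?_
    · have := one_le_fiberWeight z
      have := hW z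
      positivity
    · have := one_le_fiberWeight z
      rw [one_mul]
      refine mul_le_of_le_one_right (hW z) (inv_le_one_of_one_le₀ ?_)
      nlinarith
  have hdh : ∀ j, Differentiable ℝ (h j) := fun j => (hsym j).differentiable h1
  have hdhy : ∀ j, Differentiable ℝ (fun y => h j (q, p, y)) := fun j y =>
    DifferentiableAt.comp (g := h j) (f := fun y => (q, p, y)) y (hdh j (q, p, y))
      (hasFDerivAt_fiber q p y).differentiableAt
  -- Integration by parts moves `∂_{y_j}` onto the exponential, which produces the factor `(i/ε)
  -- ∂_{y_j} Φ`.
  have hpart : ∀ j, ∫ y, e y * fderiv ℝ (h j) (q, p, y) (0, 0, EuclideanSpace.single j 1) =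
      -∫ y, Complex.I / ε * (e y * (gradPhase Θy j (q, p, y) * h j (q, p, y))) := by
    intro j
    have hrw : ∀ y, fderiv ℝ (h j) (q, p, y) (0, 0, EuclideanSpace.single j 1) =
        fderiv ℝ (fun y => h j (q, p, y)) y (EuclideanSpace.single j 1) := fun y =>
      (dy_fiber (hdh j) q p y j).symm
    have hrw2 : ∀ y, fderiv ℝ e y (EuclideanSpace.single j 1) * h j (q, p, y) =
        Complex.I / ε * (e y * (gradPhase Θy j (q, p, y) * h j (q, p, y))) := fun y => by
      rw [he, fderiv_exp_innerPhase hΘy.symm]; ring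
    simp only [hrw, ← hrw2]
    refine integral_mul_fderiv_eq_neg_fderiv_mul_of_integrable ?_ ?_ (hint (hsymW (hsym j)))
      (fun y _ => differentiable_exp_innerPhase hΘy.symm ε q p y) (fun y _ => hdhy j y)
    · simp only [hrw2]
      exact (hint (hgrad j)).const_mul _
    · simp only [← hrw]
      exact hint (hsymW ((hsym j).fderiv_apply _))
  have hI : ∀ j, Integrable fun y =>
      e y * fderiv ℝ (h j) (q, p, y) (0, 0, EuclideanSpace.single j 1) := fun j =>
    hint (hsymW ((hsym j).fderiv_apply _))
  calc ∫ y, e y * SemiclassicalFIO.fiberLadj Θy ε f (q, p, y)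
      = ∫ y, (e y * (f (q, p, y) / (phaseDenom Θy (q, p, y) : ℂ)) + Complex.I * ε *
          ∑ j, e y * fderiv ℝ (h j) (q, p, y) (0, 0, EuclideanSpace.single j 1)) := by
        congr 1; ext y
        rw [SemiclassicalFIO.fiberLadj, ← Finset.mul_sum]
        ring
    _ = (∫ y, e y * (f (q, p, y) / (phaseDenom Θy (q, p, y) : ℂ))) + Complex.I * ε *
          ∑ j, -∫ y, Complex.I / ε * (e y * (gradPhase Θy j (q, p, y) * h j (q, p, y))) := by
        rw [integral_add (hint hdiv) ((integrable_finsetSum _ fun j _ => hI j).const_mul _),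
          integral_const_mul, integral_finsetSum _ fun j _ => hI j]
        simp only [hpart]
    _ = (∫ y, e y * (f (q, p, y) / (phaseDenom Θy (q, p, y) : ℂ))) +
          ∑ j, ∫ y, e y * (gradPhase Θy j (q, p, y) * h j (q, p, y)) := by
        congr 1
        rw [Finset.mul_sum]
        refine Finset.sum_congr rfl fun j _ => ?_
        rw [integral_const_mul]
        field_simp
        rw [Complex.I_sq]; ring
    _ = ∫ y, (e y * (f (q, p, y) / (phaseDenom Θy (q, p, y) : ℂ)) +
          ∑ j, e y * (gradPhase Θy j (q, p, y) * h j (q, p, y))) := by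
        rw [integral_add (hint hdiv) (integrable_finsetSum _ fun j _ => hint (hgrad j)),
          integral_finsetSum _ fun j _ => hint (hgrad j)]
    -- After `iε · (-i/ε) = 1`, the amplitude is `f (1 + |∇_y Φ|²) / (1 + |∇_y Φ|²)`.
    _ = ∫ y, e y * f (q, p, y) := by
        congr 1; ext y
        have hne : (phaseDenom Θy (q, p, y) : ℂ) ≠ 0 := by
          exact_mod_cast (phaseDenom_pos _).ne'
        rw [← Finset.mul_sum, ← mul_add]
        congr 1
        have : ∑ j, gradPhase Θy j (q, p, y) * h j (q, p, y) =
            (∑ j, (starRingEnd ℂ) (gradPhase Θy j (q, p, y)) * gradPhase Θy j (q, p, y)) *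
              (f (q, p, y) / (phaseDenom Θy (q, p, y) : ℂ)) := by
          rw [Finset.sum_mul]
          refine Finset.sum_congr rfl fun j _ => ?_
          simp only [hh]; ring
        rw [this]
        have h9 := ofReal_phaseDenom (Θy := Θy) (q, p, y)
        rw [← one_add_mul, ← h9]
        field_simp

theorem IsFiberSymbol.integral_iterate (hf : IsFiberSymbol m f) (hΘy : IsAdmissibleMatrix Θy)
    {ε : ℝ} (hε : 0 < ε) (q p : E d) (n : ℕ) :
    ∫ y, Complex.exp (Complex.I / ε * innerPhase Θy (q, p, y)) *
        (SemiclassicalFIO.fiberLadj Θy ε)^[n] f (q, p, y) =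
      ∫ y, Complex.exp (Complex.I / ε * innerPhase Θy (q, p, y)) * f (q, p, y) := by
  induction n with
  | zero => rfl
  | succ n ih =>
    simp only [Function.iterate_succ_apply']
    rw [(hf.iterate hΘy ε n).integral_fiberLadj hΘy hε, ih]

end FiberSymbols

/-! ### Fourier integral operators as integrals over phase space -/

section Operators

variable {d : ℕ} {Θx Θy : Matrix (Fin d) (Fin d) ℂ} {κ : Phase d ≃ Phase d} {S : Phase d → ℝ}
  {ε₀ m : ℝ} {u : ℝ → Full d → ℂ}

theorem fioIntegrand_eq (hΘy : IsAdmissibleMatrix Θy) (hu : IsSymbol31 ε₀ m u) {ε : ℝ}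
    (hε : ε ∈ Ioc 0 ε₀) (κ : Phase d → Phase d) (S : Phase d → ℝ) (n : ℕ) (φ : 𝓢(E d, ℂ))
    (x : E d) (w : E d × E d × E d) : fioIntegrand κ S Θx Θy n ε (u ε) φ x w =
      Complex.exp (Complex.I / ε * outerPhase κ S Θx x (w.1, w.2.1)) *
        (Complex.exp (Complex.I / ε * innerPhase Θy w) * (fiberLadj Θy ε)^[n]
          (fun w => u ε (x, w.2.2, w.1, w.2.1) * φ w.2.2) w) := by
  obtain ⟨L, hL⟩ := hu.isFiberSymbol hε φ x
  have := iterate_Ladj_fiber (Θx := Θx) hΘy κ S x w.1 w.2.1 ε (decayWeight_nonneg L 0 m) (hL 0) n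
  simp only at this
  rw [fioIntegrand, this, phase_eq, mul_add, Complex.exp_add, mul_assoc]

theorem integrable_fioIntegrand (hκ : IsCanonicalB κ) (hS : Continuous S)
    (hΘx : IsAdmissibleMatrix Θx) (hΘy : IsAdmissibleMatrix Θy) (hu : IsSymbol31 ε₀ m u) {ε : ℝ}
    (hε : ε ∈ Ioc 0 ε₀) {n : ℕ} (hn : m + d < n) (φ : 𝓢(E d, ℂ)) (x : E d) :
    Integrable (fioIntegrand κ S Θx Θy n ε (u ε) φ x) := by
  have h1 := (hu.isFiberSymbol hε φ x).integrable hΘy hε.1 hn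
  have h2 : Continuous fun w : E d × E d × E d =>
      Complex.exp (Complex.I / ε * outerPhase κ S Θx x (w.1, w.2.1)) := by
    have := continuous_outerPhase hκ hS Θx x
    fun_prop
  have h3 := h1.bdd_mul (c := 1) h2.aestronglyMeasurable (Filter.Eventually.of_forall fun w =>
    norm_exp_outerPhase_le hΘx κ S x hε.1 (w.1, w.2.1))
  exact h3.congr (Filter.Eventually.of_forall fun w =>
    (fioIntegrand_eq hΘy hu hε κ S n φ x w).symm)

theorem integral_triple {F : E d × E d × E d → ℂ} (hF : Integrable F) :
    ∫ w, F w = ∫ z : Phase d, ∫ y, F (z.1, z.2, y) := by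
  have hmp := volume_preserving_prodAssoc (α₁ := E d) (β₁ := E d) (γ₁ := E d)
  rw [← hmp.integral_comp MeasurableEquiv.prodAssoc.measurableEmbedding]
  exact integral_prod _ ((hmp.integrable_comp_emb
    MeasurableEquiv.prodAssoc.measurableEmbedding).2 hF)

/-- Absolute convergence permits integrating over `y` first, where the powers of `L_y^†` drop out.
The right side no longer contains `n`, so the regularisations on the two sides of an equivalence are
independent. -/
theorem fio_eq (hκ : IsCanonicalB κ) (hS : Continuous S)
    (hΘx : IsAdmissibleMatrix Θx) (hΘy : IsAdmissibleMatrix Θy) (hu : IsSymbol31 ε₀ m u) {ε : ℝ}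
    (hε : ε ∈ Ioc 0 ε₀) {n : ℕ} (hn : m + d < n) (φ : 𝓢(E d, ℂ)) (x : E d) :
    fio κ S Θx Θy n ε (u ε) φ x = (((2 * Real.pi * ε) ^ (3 * (d : ℝ) / 2) : ℝ) : ℂ)⁻¹ *
      ∫ z : Phase d, Complex.exp (Complex.I / ε * outerPhase κ S Θx x z) *
        ∫ y, Complex.exp (Complex.I / ε * innerPhase Θy (z.1, z.2, y)) *
          (u ε (x, y, z.1, z.2) * φ y) := by
  rw [fio, integral_triple (integrable_fioIntegrand hκ hS hΘx hΘy hu hε hn φ x)]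
  congr 2
  ext z
  simp only [fioIntegrand_eq hΘy hu hε]
  rw [integral_const_mul, (hu.isFiberSymbol hε φ x).integral_iterate hΘy hε.1]

end Operators

/-! ### Integration by parts against rapidly decreasing functions -/

section GrowthAndDecay

variable {d : ℕ} {f g : Phase d → ℂ}

/-- Functions of at most polynomial growth. -/
def PolyBounded (f : Phase d → ℂ) : Prop :=
  ∃ (N : ℕ) (C : ℝ), 0 ≤ C ∧ ∀ z, ‖f z‖ ≤ C * (1 + ‖z‖) ^ N

/-- Functions decreasing faster than any power. -/
def RapidlyDecreasing (f : Phase d → ℂ) : Prop :=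
  ∀ N : ℕ, ∃ C : ℝ, 0 ≤ C ∧ ∀ z, ‖f z‖ ≤ C * ((1 + ‖z‖) ^ N)⁻¹

theorem IsSymbol2.polyBounded {ε₀ m : ℝ} {u : ℝ → Phase d → ℂ} (hu : IsSymbol2 ε₀ m u) {ε : ℝ}
    (hε : ε ∈ Ioc 0 ε₀) : PolyBounded (u ε) := by
  obtain ⟨C, hC⟩ := IsSymbol.norm_le hu
  obtain ⟨N, D, hD0, hD⟩ := weight2_le_pow (d := d) m
  refine ⟨N, |C| * D, by positivity, fun z => (hC ε hε z).trans ?_⟩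
  calc _ ≤ |C| * weight2 m z := mul_le_mul_of_nonneg_right (le_abs_self C) (weight2_pos m z).le
    _ ≤ |C| * (D * (1 + ‖z‖) ^ N) := mul_le_mul_of_nonneg_left (hD z) (abs_nonneg C)
    _ = _ := by ring

theorem RapidlyDecreasing.add (hf : RapidlyDecreasing f) (hg : RapidlyDecreasing g) :
    RapidlyDecreasing (fun z => f z + g z) := by
  intro N
  obtain ⟨C, hC0, hC⟩ := hf N
  obtain ⟨D, hD0, hD⟩ := hg N
  refine ⟨C + D, by positivity, fun z => (norm_add_le _ _).trans ?_⟩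
  rw [add_mul]
  exact add_le_add (hC z) (hD z)

theorem RapidlyDecreasing.sum {ι : Type*} {s : Finset ι} {F : ι → Phase d → ℂ}
    (h : ∀ i ∈ s, RapidlyDecreasing (F i)) : RapidlyDecreasing (fun z => ∑ i ∈ s, F i z) := by
  classical
  induction s using Finset.induction_on with
  | empty => exact fun N => ⟨0, le_rfl, fun z => by simp⟩
  | insert i s hi ih =>
    simp only [Finset.sum_insert hi]
    exact (h i (by simp)).add (ih fun j hj => h j (by simp [hj]))

theorem PolyBounded.mul_rapidlyDecreasing (hf : PolyBounded f) (hg : RapidlyDecreasing g) :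
    RapidlyDecreasing (fun z => f z * g z) := by
  intro N
  obtain ⟨M, C, hC0, hC⟩ := hf
  obtain ⟨D, hD0, hD⟩ := hg (M + N)
  refine ⟨C * D, by positivity, fun z => ?_⟩
  rw [norm_mul]
  have h1 := norm_nonneg z
  calc _ ≤ (C * (1 + ‖z‖) ^ M) * (D * ((1 + ‖z‖) ^ (M + N))⁻¹) :=
        mul_le_mul (hC z) (hD z) (norm_nonneg _) (by positivity)
    _ = _ := by
        rw [pow_add]
        field_simp

theorem RapidlyDecreasing.const_mul (hf : RapidlyDecreasing f) (c : ℂ) :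
    RapidlyDecreasing (fun z => c * f z) :=
  PolyBounded.mul_rapidlyDecreasing (f := fun _ => c) ⟨0, ‖c‖, norm_nonneg c, fun z => by simp⟩ hf

theorem RapidlyDecreasing.of_norm_le (hg : RapidlyDecreasing g) (h : ∀ z, ‖f z‖ ≤ ‖g z‖) :
    RapidlyDecreasing f := fun N =>
  (hg N).imp fun _ hC => ⟨hC.1, fun z => (h z).trans (hC.2 z)⟩

instance : (volume : Measure (Phase d)).IsAddHaarMeasure :=
  Measure.prod.instIsAddHaarMeasure _ _

theorem RapidlyDecreasing.integrable (hf : RapidlyDecreasing f)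
    (hm : AEStronglyMeasurable f) : Integrable f := by
  -- One power more than the real dimension `2d` of phase space.
  obtain ⟨C, -, hC⟩ := hf (2 * d + 1)
  have := integrable_one_add_norm (E := Phase d) (μ := volume) (r := (2 * d + 1 : ℕ))
    (by simp; linarith)
  refine (this.const_mul C).mono' hm (Filter.Eventually.of_forall fun z => (hC z).trans
    (le_of_eq ?_))
  rw [Real.rpow_neg (by positivity), Real.rpow_natCast]

/-- Differentiable functions which decrease rapidly together with their first derivatives. -/
structure IsTestAmplitude (g : Phase d → ℂ) : Prop where
  differentiable : Differentiable ℝ g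
  rapid : RapidlyDecreasing g
  rapid_dq : ∀ k, RapidlyDecreasing (dq k g)
  rapid_dp : ∀ k, RapidlyDecreasing (dp k g)

/-- Polynomial growth against rapid decrease makes all three products integrable, so there is no
boundary term. -/
theorem integral_mul_fderiv_of_testAmplitude {e : Phase d} (hg : Differentiable ℝ g)
    (hgr : RapidlyDecreasing g) (hge : RapidlyDecreasing fun z => fderiv ℝ g z e)
    (hf : Differentiable ℝ f) (hfp : PolyBounded f) (hfe : PolyBounded fun z => fderiv ℝ f z e) :
    Integrable (fun z => f z * fderiv ℝ g z e) ∧ Integrable (fun z => fderiv ℝ f z e * g z) ∧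
    ∫ z, f z * fderiv ℝ g z e = -∫ z, fderiv ℝ f z e * g z := by
  have hmg : AEStronglyMeasurable (fun z => fderiv ℝ g z e) (volume : Measure (Phase d)) :=
    (measurable_fderiv_apply_const ℝ g e).aestronglyMeasurable
  have hmf : AEStronglyMeasurable (fun z => fderiv ℝ f z e) (volume : Measure (Phase d)) :=
    (measurable_fderiv_apply_const ℝ f e).aestronglyMeasurable
  have h1 := (hfp.mul_rapidlyDecreasing hge).integrable
    (hf.continuous.aestronglyMeasurable.mul hmg)
  have h2 := (hfe.mul_rapidlyDecreasing hgr).integrable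
    (hmf.mul hg.continuous.aestronglyMeasurable)
  have h3 := (hfp.mul_rapidlyDecreasing hgr).integrable
    (hf.continuous.aestronglyMeasurable.mul hg.continuous.aestronglyMeasurable)
  exact ⟨h1, h2, integral_mul_fderiv_eq_neg_fderiv_mul_of_integrable h2 h1 h3
    (fun z _ => hf z) (fun z _ => hg z)⟩

theorem IsTestAmplitude.integrable_mul (hg : IsTestAmplitude g) {ε₀ m : ℝ}
    {u : ℝ → Phase d → ℂ} (hu : IsSymbol2 ε₀ m u) {ε : ℝ} (hε : ε ∈ Ioc 0 ε₀) :
    Integrable fun z => u ε z * g z :=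
  ((hu.polyBounded hε).mul_rapidlyDecreasing hg.rapid).integrable
    ((hu.differentiable hε).continuous.mul hg.differentiable.continuous).aestronglyMeasurable

/-- Integration by parts for `∂_z`. -/
theorem IsTestAmplitude.integral_mul_dz (hg : IsTestAmplitude g) {ε₀ m : ℝ}
    {u : ℝ → Phase d → ℂ} (hu : IsSymbol2 ε₀ m u) {ε : ℝ} (hε : ε ∈ Ioc 0 ε₀)
    (Θy : Matrix (Fin d) (Fin d) ℂ) (j : Fin d) :
    Integrable (fun z => u ε z * dz Θy j g z) ∧
    ∫ z, u ε z * dz Θy j g z = -∫ z, dz Θy j (u ε) z * g z := by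
  have hq : ∀ k, Integrable (fun z => u ε z * dq k g z) ∧
      Integrable (fun z => dq k (u ε) z * g z) ∧
      ∫ z, u ε z * dq k g z = -∫ z, dq k (u ε) z * g z := fun k => integral_mul_fderiv_of_testAmplitude hg.differentiable hg.rapid
    (hg.rapid_dq k) (hu.differentiable hε) (hu.polyBounded hε) ((hu.dq k).polyBounded hε)
  have hp : ∀ k, Integrable (fun z => u ε z * dp k g z) ∧
      Integrable (fun z => dp k (u ε) z * g z) ∧
      ∫ z, u ε z * dp k g z = -∫ z, dp k (u ε) z * g z := fun k => integral_mul_fderiv_of_testAmplitude hg.differentiable hg.rapid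
    (hg.rapid_dp k) (hu.differentiable hε) (hu.polyBounded hε) ((hu.dp k).polyBounded hε)
  have e1 : ∀ z, u ε z * dz Θy j g z = (∑ k, Θy⁻¹ j k * (u ε z * dq k g z)) -
      Complex.I * (u ε z * dp j g z) := by
    intro z
    rw [dz, mul_sub, Finset.mul_sum]
    congr 1
    · exact Finset.sum_congr rfl fun k _ => by ring
    · ring
  have e2 : ∀ z, dz Θy j (u ε) z * g z = (∑ k, Θy⁻¹ j k * (dq k (u ε) z * g z)) -
      Complex.I * (dp j (u ε) z * g z) := by
    intro z
    rw [dz, sub_mul, Finset.sum_mul]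
    congr 1
    · exact Finset.sum_congr rfl fun k _ => by ring
    · ring
  simp only [e1, e2]
  refine ⟨(integrable_finsetSum _ fun k _ => (hq k).1.const_mul _).sub
      ((hp j).1.const_mul _), ?_⟩
  rw [integral_sub (integrable_finsetSum _ fun k _ => (hq k).1.const_mul _)
      ((hp j).1.const_mul _), integral_sub (integrable_finsetSum _ fun k _ =>
      (hq k).2.1.const_mul _) ((hp j).2.1.const_mul _),
    integral_finsetSum _ fun k _ => (hq k).1.const_mul _,
    integral_finsetSum _ fun k _ => (hq k).2.1.const_mul _]
  simp only [integral_const_mul]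
  have e3 := fun k => (hq k).2.2
  have e4 := (hp j).2.2
  simp only [e3, e4]
  rw [neg_sub, mul_neg, sub_neg_eq_add, add_comm, sub_eq_add_neg, ← Finset.sum_neg_distrib]
  simp only [mul_neg]

end GrowthAndDecay

/-! ### The wave packet transform: decay and derivatives -/

section Transform

variable {d : ℕ} {Θx Θy : Matrix (Fin d) (Fin d) ℂ} {ε : ℝ}

/-- The Gaussian wave packet transform of `φ`, up to normalisation. -/
noncomputable def packetTransform (Θy : Matrix (Fin d) (Fin d) ℂ) (ε : ℝ) (φ : 𝓢(E d, ℂ))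
    (z : Phase d) : ℂ :=
  ∫ y, Complex.exp (Complex.I / ε * innerPhase Θy (z.1, z.2, y)) * φ y

theorem one_add_norm_le_bracket (p : E d) : 1 + ‖p‖ ≤ 2 * Real.sqrt (1 + ‖p‖ ^ 2) := by
  have h1 := one_le_bracket p
  have h2 : ‖p‖ ≤ Real.sqrt (1 + ‖p‖ ^ 2) := Real.le_sqrt_of_sq_le (by linarith)
  linarith

/-- Decay in `p` comes from inserting powers of `L_y^†`, which leave the integral unchanged; decay
in `q` comes from the Gaussian together with the decay of `φ`. -/
theorem packetTransform_rapid (hΘy : IsAdmissibleMatrix Θy) (hε : 0 < ε) (φ : 𝓢(E d, ℂ)) :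
    RapidlyDecreasing (packetTransform Θy ε φ) := by
  intro N
  have hf := isFiberSymbol_schwartz φ
  -- `N` iterations on an amplitude of order zero give `⟨p⟩^{-N}`; the additional `d + 1` powers pay
  -- for the integral over `y`.
  obtain ⟨C, hC0, hC⟩ := hf.exists_norm_exp_mul_iterate_le hΘy hε N (N + (d + 1))
  have hint := integrable_inv_one_add_norm_pow (d := d) (N := N + (d + 1)) (by omega)
  refine ⟨C * 2 ^ N * ∫ y : E d, ((1 + ‖y‖) ^ (N + (d + 1)))⁻¹,
    mul_nonneg (by positivity) (integral_nonneg fun y => by positivity), fun z => ?_⟩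
  have h1 : packetTransform Θy ε φ z = ∫ y, Complex.exp (Complex.I / ε *
      innerPhase Θy (z.1, z.2, y)) * (fiberLadj Θy ε)^[N] (fun w => φ w.2.2) (z.1, z.2, y) :=
    (hf.integral_iterate hΘy hε z.1 z.2 N).symm
  rw [h1]
  have h2 : ∀ y : E d, ‖Complex.exp (Complex.I / ε * innerPhase Θy (z.1, z.2, y)) *
      (fiberLadj Θy ε)^[N] (fun w => φ w.2.2) (z.1, z.2, y)‖ ≤
      (C * 2 ^ N * ((1 + ‖z‖) ^ N)⁻¹) * ((1 + ‖y‖) ^ (N + (d + 1)))⁻¹ := by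
    intro y
    refine (hC (z.1, z.2, y)).trans ?_
    have hp := one_le_bracket z.2
    have e0 : (1 + ‖z‖) ≤ (1 + ‖z.1‖) * (2 * Real.sqrt (1 + ‖z.2‖ ^ 2)) := by
      have := one_add_norm_le_bracket z.2
      have h3 : ‖z‖ ≤ ‖z.1‖ + ‖z.2‖ := by
        rw [Prod.norm_def]
        exact max_le_add_of_nonneg (norm_nonneg _) (norm_nonneg _)
      calc 1 + ‖z‖ ≤ (1 + ‖z.1‖) * (1 + ‖z.2‖) := by
            nlinarith [mul_nonneg (norm_nonneg z.1) (norm_nonneg z.2)]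
        _ ≤ _ := by gcongr
    have e1 : ((1 + ‖z.1‖) ^ (N + (d + 1)))⁻¹ ≤ ((1 + ‖z.1‖) ^ N)⁻¹ :=
      inv_anti₀ (by positivity) (pow_le_pow_right₀ (by linarith [norm_nonneg z.1]) (by omega))
    have e2 : ((1 + ‖z.1‖) ^ N)⁻¹ * Real.sqrt (1 + ‖z.2‖ ^ 2) ^ (0 - (N : ℝ)) ≤
        2 ^ N * ((1 + ‖z‖) ^ N)⁻¹ := by
      rw [zero_sub, Real.rpow_neg (by positivity), Real.rpow_natCast, ← div_eq_mul_inv (2 ^ N),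
        le_div_iff₀ (by positivity), ← mul_inv, inv_mul_le_iff₀ (by positivity), ← mul_pow,
        ← mul_pow]
      refine pow_le_pow_left₀ (by positivity) (e0.trans (le_of_eq (by ring))) N
    calc C * (((1 + ‖z.1‖) ^ (N + (d + 1)))⁻¹ * (((1 + ‖y‖) ^ (N + (d + 1)))⁻¹ *
          Real.sqrt (1 + ‖z.2‖ ^ 2) ^ (0 - (N : ℝ))))
        ≤ C * (((1 + ‖z.1‖) ^ N)⁻¹ * (((1 + ‖y‖) ^ (N + (d + 1)))⁻¹ *
          Real.sqrt (1 + ‖z.2‖ ^ 2) ^ (0 - (N : ℝ)))) := by gcongr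
      _ = C * ((1 + ‖y‖) ^ (N + (d + 1)))⁻¹ *
          (((1 + ‖z.1‖) ^ N)⁻¹ * Real.sqrt (1 + ‖z.2‖ ^ 2) ^ (0 - (N : ℝ))) := by ring
      _ ≤ C * ((1 + ‖y‖) ^ (N + (d + 1)))⁻¹ * (2 ^ N * ((1 + ‖z‖) ^ N)⁻¹) := by gcongr
      _ = _ := by ring
  refine (norm_integral_le_of_norm_le (hint.const_mul _)
    (Filter.Eventually.of_forall h2)).trans (le_of_eq ?_)
  rw [integral_const_mul]
  ring

/-- Derivatives of the transform of `φ` are combinations of transforms of `φ` and of `y_k φ` with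
polynomial coefficients, so they inherit rapid decrease. -/
theorem exists_schwartz_coord_mul (φ : 𝓢(E d, ℂ)) (k : Fin d) :
    ∃ ψ : 𝓢(E d, ℂ), ∀ y, ψ y = ((y k : ℝ) : ℂ) * φ y :=
  ⟨SchwartzMap.smulLeftCLM ℂ (coordC k) φ, fun y => by
    rw [SchwartzMap.smulLeftCLM_apply_apply (coordC k).hasTemperateGrowth]
    rfl⟩

/-- The derivative of the inner phase in the directions of phase space. -/
noncomputable def innerPhaseDeriv (Θy : Matrix (Fin d) (Fin d) ℂ) (w : E d × E d × E d) :
    Phase d →L[ℝ] ℂ :=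
  ∑ k, (-gradPhase Θy k w • (coordC k).comp (ContinuousLinearMap.fst ℝ (E d) (E d)) -
    cvec (w.2.2 - w.1) k • (coordC k).comp (ContinuousLinearMap.snd ℝ (E d) (E d)))

theorem hasFDerivAt_innerPhase_base (hΘy : Θyᵀ = Θy) (y : E d) (z : Phase d) :
    HasFDerivAt (fun z : Phase d => innerPhase Θy (z.1, z.2, y))
      (innerPhaseDeriv Θy (z.1, z.2, y)) z := by
  have h1 : HasFDerivAt (𝕜 := ℝ) (fun z : Phase d => (z.1, z.2, y))
      ((ContinuousLinearMap.fst ℝ (E d) (E d)).prod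
        ((ContinuousLinearMap.snd ℝ (E d) (E d)).prod 0)) z :=
    hasFDerivAt_fst.prodMk (hasFDerivAt_snd.prodMk (hasFDerivAt_const y z))
  refine ((hasFDerivAt_innerPhase hΘy (z.1, z.2, y)).comp z h1).congr_fderiv ?_
  refine ContinuousLinearMap.ext fun e => ?_
  simp [innerPhaseDeriv, cvec]

theorem exists_norm_innerPhaseDeriv_le (Θy : Matrix (Fin d) (Fin d) ℂ) :
    ∃ C : ℝ, 0 ≤ C ∧ ∀ w : E d × E d × E d,
      ‖innerPhaseDeriv Θy w‖ ≤ C * ((1 + ‖(w.1, w.2.1)‖) * (1 + ‖w.2.2‖)) := by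
  refine ⟨∑ k, (‖gradPhase Θy k‖ * ‖(coordC k).comp (ContinuousLinearMap.fst ℝ (E d) (E d))‖ +
    ‖displacement (d := d) k‖ * ‖(coordC k).comp (ContinuousLinearMap.snd ℝ (E d) (E d))‖),
    Finset.sum_nonneg fun _ _ => by positivity, fun w => ?_⟩
  have hw : ‖w‖ ≤ (1 + ‖(w.1, w.2.1)‖) * (1 + ‖w.2.2‖) := by
    have h1 : ‖w.1‖ ≤ ‖(w.1, w.2.1)‖ := norm_fst_le (w.1, w.2.1)
    have h2 : ‖w.2.1‖ ≤ ‖(w.1, w.2.1)‖ := norm_snd_le (w.1, w.2.1)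
    have h3 := norm_nonneg (w.1, w.2.1)
    have h4 := norm_nonneg w.2.2
    have h5 := mul_nonneg h3 h4
    rw [Prod.norm_def, Prod.norm_def w.2]
    refine max_le ?_ (max_le ?_ ?_) <;> nlinarith
  rw [Finset.sum_mul]
  refine (norm_sum_le _ _).trans (Finset.sum_le_sum fun k _ => ?_)
  rw [add_mul]
  refine (norm_sub_le _ _).trans (add_le_add ?_ ?_)
  · rw [norm_smul, norm_neg]
    calc _ ≤ (‖gradPhase Θy k‖ * ‖w‖) * _ :=
          mul_le_mul_of_nonneg_right ((gradPhase Θy k).le_opNorm w) (norm_nonneg _)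
      _ ≤ (‖gradPhase Θy k‖ * ((1 + ‖(w.1, w.2.1)‖) * (1 + ‖w.2.2‖))) * _ := by gcongr
      _ = _ := by ring
  · rw [norm_smul, ← displacement_apply]
    calc _ ≤ (‖displacement (d := d) k‖ * ‖w‖) * _ :=
          mul_le_mul_of_nonneg_right ((displacement k).le_opNorm w) (norm_nonneg _)
      _ ≤ (‖displacement (d := d) k‖ * ((1 + ‖(w.1, w.2.1)‖) * (1 + ‖w.2.2‖))) * _ := by gcongr
      _ = _ := by ring

theorem continuous_innerPhaseDeriv (Θy : Matrix (Fin d) (Fin d) ℂ) :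
    Continuous (innerPhaseDeriv Θy) := by
  refine continuous_finsetSum _ fun k _ => ?_
  exact ((gradPhase Θy k).continuous.neg.smul continuous_const).sub
    ((displacement k).continuous.smul continuous_const)

theorem integrable_one_add_norm_mul_schwartz (φ : 𝓢(E d, ℂ)) :
    Integrable fun y : E d => (1 + ‖y‖) * ‖φ y‖ := by
  obtain ⟨C, hC⟩ := (isSymbol_schwartz φ (d + 2)).norm_le
  have h := (integrable_inv_one_add_norm_pow (d := d) (Nat.lt_succ_self d)).const_mul C
  refine h.mono' (by
    have := φ.continuous
    exact Continuous.aestronglyMeasurable (by fun_prop)) (Filter.Eventually.of_forall fun y => ?_)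
  have h1 := hC 1 ⟨one_pos, le_rfl⟩ y
  have h2 := norm_nonneg y
  rw [Real.norm_of_nonneg (by positivity)]
  calc _ ≤ (1 + ‖y‖) * (C * ((1 + ‖y‖) ^ (d + 2))⁻¹) := by gcongr
    _ = _ := by
      rw [show d + 2 = d.succ + 1 from rfl, pow_succ]
      field_simp

theorem integrable_exp_mul_schwartz (hΘy : IsAdmissibleMatrix Θy) (hε : 0 < ε) (φ : 𝓢(E d, ℂ))
    (z : Phase d) :
    Integrable fun y => Complex.exp (Complex.I / ε * innerPhase Θy (z.1, z.2, y)) * φ y :=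
  (isFiberSymbol_schwartz φ).integrable_fiber hΘy hε z.1 z.2

/-- The derivative in `z` of the integrand of `packetTransform`. -/
noncomputable def packetIntegrandDeriv (Θy : Matrix (Fin d) (Fin d) ℂ) (ε : ℝ) (φ : 𝓢(E d, ℂ))
    (z : Phase d) (y : E d) : Phase d →L[ℝ] ℂ :=
  (φ y * (Complex.exp (Complex.I / ε * innerPhase Θy (z.1, z.2, y)) *
    (Complex.I / ε))) • innerPhaseDeriv Θy (z.1, z.2, y)

/-- The domination needed to differentiate under the integral: on a unit ball the phase derivative
grows at most linearly in `y`, and the exponential has norm at most one. -/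
theorem exists_norm_packetIntegrandDeriv_le (hΘy : IsAdmissibleMatrix Θy) (hε : 0 < ε)
    (φ : 𝓢(E d, ℂ)) (z : Phase d) : ∃ C : ℝ, ∀ y, ∀ z' ∈ Metric.ball z 1,
      ‖packetIntegrandDeriv Θy ε φ z' y‖ ≤ C * ((1 + ‖y‖) * ‖φ y‖) := by
  obtain ⟨C, hC0, hC⟩ := exists_norm_innerPhaseDeriv_le Θy
  refine ⟨‖Complex.I / (ε : ℂ)‖ * (C * (2 + ‖z‖)), fun y z' hz' => ?_⟩
  have h1 : 1 + ‖z'‖ ≤ 2 + ‖z‖ := by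
    have h2 := norm_sub_norm_le z' z
    rw [← dist_eq_norm] at h2
    have h3 := Metric.mem_ball.1 hz'
    linarith
  have h2 : ‖innerPhaseDeriv Θy (z'.1, z'.2, y)‖ ≤ C * ((2 + ‖z‖) * (1 + ‖y‖)) :=
    (hC (z'.1, z'.2, y)).trans (mul_le_mul_of_nonneg_left
      (mul_le_mul_of_nonneg_right h1 (by positivity)) hC0)
  have h3 := norm_exp_innerPhase_le_one hΘy hε (z'.1, z'.2, y)
  rw [packetIntegrandDeriv, norm_smul, norm_mul, norm_mul]
  calc _ ≤ (‖φ y‖ * (1 * ‖Complex.I / (ε : ℂ)‖)) * (C * ((2 + ‖z‖) * (1 + ‖y‖))) := by gcongr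
    _ = _ := by ring

theorem continuous_packetIntegrandDeriv (Θy : Matrix (Fin d) (Fin d) ℂ) (ε : ℝ) (φ : 𝓢(E d, ℂ))
    (z : Phase d) : Continuous (packetIntegrandDeriv Θy ε φ z) := by
  have h1 : Continuous fun y : E d => (z.1, z.2, y) := by fun_prop
  exact (φ.continuous.mul (((continuous_exp_innerPhase Θy ε).comp h1).mul
    continuous_const)).smul ((continuous_innerPhaseDeriv Θy).comp h1)

theorem integrable_packetIntegrandDeriv (hΘy : IsAdmissibleMatrix Θy) (hε : 0 < ε)
    (φ : 𝓢(E d, ℂ)) (z : Phase d) : Integrable (packetIntegrandDeriv Θy ε φ z) := by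
  obtain ⟨C, hC⟩ := exists_norm_packetIntegrandDeriv_le hΘy hε φ z
  exact ((integrable_one_add_norm_mul_schwartz φ).const_mul C).mono'
    (continuous_packetIntegrandDeriv Θy ε φ z).aestronglyMeasurable
    (Filter.Eventually.of_forall fun y => hC y z (Metric.mem_ball_self one_pos))

theorem hasFDerivAt_packetIntegrand (hΘy : IsAdmissibleMatrix Θy) (φ : 𝓢(E d, ℂ)) (z : Phase d)
    (y : E d) : HasFDerivAt (fun z : Phase d =>
      Complex.exp (Complex.I / ε * innerPhase Θy (z.1, z.2, y)) * φ y)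
      (packetIntegrandDeriv Θy ε φ z y) z := by
  have h1 := (((hasFDerivAt_innerPhase_base hΘy.symm y z).const_mul
    (Complex.I / (ε : ℂ))).cexp).mul_const (φ y)
  refine h1.congr_fderiv ?_
  rw [packetIntegrandDeriv, smul_smul, smul_smul, mul_assoc]

theorem hasFDerivAt_packetTransform (hΘy : IsAdmissibleMatrix Θy) (hε : 0 < ε) (φ : 𝓢(E d, ℂ))
    (z : Phase d) : HasFDerivAt (packetTransform Θy ε φ)
      (∫ y, packetIntegrandDeriv Θy ε φ z y) z := by
  obtain ⟨C, hC⟩ := exists_norm_packetIntegrandDeriv_le hΘy hε φ z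
  exact hasFDerivAt_integral_of_dominated_of_fderiv_le (𝕜 := ℝ)
    (Metric.ball_mem_nhds z one_pos)
    (Filter.Eventually.of_forall fun z' =>
      (integrable_exp_mul_schwartz hΘy hε φ z').aestronglyMeasurable)
    (integrable_exp_mul_schwartz hΘy hε φ z)
    (continuous_packetIntegrandDeriv Θy ε φ z).aestronglyMeasurable
    (Filter.Eventually.of_forall hC) ((integrable_one_add_norm_mul_schwartz φ).const_mul C)
    (Filter.Eventually.of_forall fun y z' _ => hasFDerivAt_packetIntegrand hΘy φ z' y)

theorem fderiv_packetTransform_apply (hΘy : IsAdmissibleMatrix Θy) (hε : 0 < ε) (φ : 𝓢(E d, ℂ))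
    (z v : Phase d) : fderiv ℝ (packetTransform Θy ε φ) z v =
      ∫ y, Complex.I / ε * innerPhaseDeriv Θy (z.1, z.2, y) v *
        (Complex.exp (Complex.I / ε * innerPhase Θy (z.1, z.2, y)) * φ y) := by
  rw [(hasFDerivAt_packetTransform hΘy hε φ z).fderiv,
    ContinuousLinearMap.integral_apply (integrable_packetIntegrandDeriv hΘy hε φ z)]
  congr 1; ext y
  simp only [packetIntegrandDeriv, FunLike.coe_smul, Pi.smul_apply, smul_eq_mul]
  ring

theorem integral_cvec_mul (hΘy : IsAdmissibleMatrix Θy) (hε : 0 < ε) {φ ψ : 𝓢(E d, ℂ)} {k : Fin d}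
    (hψ : ∀ y, ψ y = ((y k : ℝ) : ℂ) * φ y) (z : Phase d) :
    Integrable (fun y => cvec (y - z.1) k *
      (Complex.exp (Complex.I / ε * innerPhase Θy (z.1, z.2, y)) * φ y)) ∧
    ∫ y, cvec (y - z.1) k * (Complex.exp (Complex.I / ε * innerPhase Θy (z.1, z.2, y)) * φ y) =
      packetTransform Θy ε ψ z - ((z.1 k : ℝ) : ℂ) * packetTransform Θy ε φ z := by
  have e : (fun y => cvec (y - z.1) k *
      (Complex.exp (Complex.I / ε * innerPhase Θy (z.1, z.2, y)) * φ y)) = fun y =>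
      Complex.exp (Complex.I / ε * innerPhase Θy (z.1, z.2, y)) * ψ y - ((z.1 k : ℝ) : ℂ) *
        (Complex.exp (Complex.I / ε * innerPhase Θy (z.1, z.2, y)) * φ y) := by
    ext y
    rw [hψ]
    simp only [cvec, PiLp.sub_apply]
    push_cast
    ring
  have h1 := integrable_exp_mul_schwartz hΘy hε φ z
  have h2 := integrable_exp_mul_schwartz hΘy hε ψ z
  rw [e]
  exact ⟨h2.sub (h1.const_mul _), by
    rw [integral_sub h2 (h1.const_mul _), integral_const_mul]; rfl⟩

theorem dp_packetTransform (hΘy : IsAdmissibleMatrix Θy) (hε : 0 < ε) {φ : 𝓢(E d, ℂ)}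
    {ψ : Fin d → 𝓢(E d, ℂ)} (hψ : ∀ k y, ψ k y = ((y k : ℝ) : ℂ) * φ y) (k : Fin d)
    (z : Phase d) : dp k (packetTransform Θy ε φ) z = -(Complex.I / ε) *
      (packetTransform Θy ε (ψ k) z - ((z.1 k : ℝ) : ℂ) * packetTransform Θy ε φ z) := by
  rw [dp, fderiv_packetTransform_apply hΘy hε, ← (integral_cvec_mul hΘy hε (hψ k) z).2,
    ← integral_const_mul]
  congr 1; ext y
  have : innerPhaseDeriv Θy (z.1, z.2, y) (0, EuclideanSpace.single k 1) = -cvec (y - z.1) k := by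
    simp [innerPhaseDeriv, apply_ite]
  rw [this]
  ring

theorem dq_packetTransform (hΘy : IsAdmissibleMatrix Θy) (hε : 0 < ε) {φ : 𝓢(E d, ℂ)}
    {ψ : Fin d → 𝓢(E d, ℂ)} (hψ : ∀ k y, ψ k y = ((y k : ℝ) : ℂ) * φ y) (k : Fin d)
    (z : Phase d) : dq k (packetTransform Θy ε φ) z = Complex.I / ε *
      (((z.2 k : ℝ) : ℂ) * packetTransform Θy ε φ z - Complex.I * ∑ l, Θy k l *
      (packetTransform Θy ε (ψ l) z - ((z.1 l : ℝ) : ℂ) * packetTransform Θy ε φ z)) := by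
  have h1 := integrable_exp_mul_schwartz hΘy hε φ z
  have h2 := fun l => (integral_cvec_mul hΘy hε (hψ l) z).1
  simp only [← (integral_cvec_mul hΘy hε (hψ _) z).2]
  simp only [← integral_const_mul]
  rw [← integral_finsetSum _ fun l _ => (h2 l).const_mul _, ← integral_const_mul,
    packetTransform, ← integral_const_mul, ← integral_sub (h1.const_mul _)
      ((integrable_finsetSum _ fun l _ => (h2 l).const_mul _).const_mul _),
    ← integral_const_mul, dq, fderiv_packetTransform_apply hΘy hε]
  congr 1; ext y
  have : innerPhaseDeriv Θy (z.1, z.2, y) (EuclideanSpace.single k 1, 0) =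
      -gradPhase Θy k (z.1, z.2, y) := by
    simp [innerPhaseDeriv, apply_ite]
  rw [this, gradPhase_apply, Matrix.mulVec, dotProduct]
  simp only [← mul_assoc, ← Finset.sum_mul]
  ring

end Transform

/-! ### The amplitude and its differential equation -/

section Amplitude

variable {d : ℕ} {Θx Θy : Matrix (Fin d) (Fin d) ℂ} {ε : ℝ} {κ : Phase d ≃ Phase d}
  {S : Phase d → ℝ}

/-- `∂_{z_j}` as a complex-linear functional of the differential. -/
noncomputable def dzForm (Θy : Matrix (Fin d) (Fin d) ℂ) (j : Fin d) :
    (Phase d →L[ℝ] ℂ) →ₗ[ℂ] ℂ where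
  toFun L := (∑ k, Θy⁻¹ j k * L (EuclideanSpace.single k 1, 0)) -
    Complex.I * L (0, EuclideanSpace.single j 1)
  map_add' L M := by
    simp only [FunLike.coe_add, Pi.add_apply, mul_add, Finset.sum_add_distrib]
    ring
  map_smul' c L := by
    simp only [FunLike.coe_smul, Pi.smul_apply, smul_eq_mul, RingHom.id_apply, mul_sub,
      Finset.mul_sum]
    congr 1
    · exact Finset.sum_congr rfl fun k _ => by ring
    · ring

theorem dz_eq_dzForm (f : Phase d → ℂ) (j : Fin d) (z : Phase d) :
    dz Θy j f z = dzForm Θy j (fderiv ℝ f z) := rfl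

theorem phase_clm_ext {L M : Phase d →L[ℝ] ℂ}
    (h1 : ∀ j, L (EuclideanSpace.single j 1, 0) = M (EuclideanSpace.single j 1, 0))
    (h2 : ∀ j, L (0, EuclideanSpace.single j 1) = M (0, EuclideanSpace.single j 1)) : L = M := by
  refine ContinuousLinearMap.ext fun v => ?_
  rw [← phase_basis v, map_sum, map_sum]
  refine Finset.sum_congr rfl fun i _ => ?_
  rw [map_smul, map_smul]
  rcases i with i | i
  · exact congrArg _ (h1 i)
  · exact congrArg _ (h2 i)

theorem dz_mul {f g : Phase d → ℂ} (hf : Differentiable ℝ f) (hg : Differentiable ℝ g)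
    (j : Fin d) (z : Phase d) :
    dz Θy j (fun z => f z * g z) z = f z * dz Θy j g z + g z * dz Θy j f z := by
  have h := ((hf z).hasFDerivAt.mul (hg z).hasFDerivAt).fderiv
  have h' : fderiv ℝ (fun z => f z * g z) z = _ := h
  simp only [dz_eq_dzForm, h', map_add, map_smul, smul_eq_mul]

theorem dz_sum {ι : Type*} {s : Finset ι} {f : ι → Phase d → ℂ}
    (hf : ∀ i ∈ s, Differentiable ℝ (f i)) (j : Fin d) (z : Phase d) :
    dz Θy j (fun z => ∑ i ∈ s, f i z) z = ∑ i ∈ s, dz Θy j (f i) z := by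
  have h := (HasFDerivAt.fun_sum fun i hi => (hf i hi z).hasFDerivAt).fderiv
  simp only [dz_eq_dzForm, h, map_sum]

theorem dz_const_sub {f : Phase d → ℂ} (hf : Differentiable ℝ f) (c : ℂ)
    (j : Fin d) (z : Phase d) : dz Θy j (fun z => c - f z) z = -dz Θy j f z := by
  have h := ((hf z).hasFDerivAt.const_sub c).fderiv
  simp only [dz_eq_dzForm, h, map_neg]

theorem IsCanonicalB.differentiable_fst (hκ : IsCanonicalB κ) (k : Fin d) :
    Differentiable ℝ fun z => (((κ z).1 k : ℝ) : ℂ) :=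
  Complex.ofRealCLM.differentiable.comp ((hκ.contDiff_fst k).differentiable (by simp))

theorem IsCanonicalB.differentiable_snd (hκ : IsCanonicalB κ) (k : Fin d) :
    Differentiable ℝ fun z => (((κ z).2 k : ℝ) : ℂ) :=
  Complex.ofRealCLM.differentiable.comp ((hκ.contDiff_snd k).differentiable (by simp))

/-- The two defining relations of the action are the single identity `dS = Ξ · dX - p · dq`. -/
theorem IsAction.hasFDerivAt_ofReal (hS : IsAction κ S) (hκ : IsCanonicalB κ) (z : Phase d) :
    HasFDerivAt (fun z => (S z : ℂ))
      (∑ k, ((((κ z).2 k : ℝ) : ℂ) • fderiv ℝ (fun z => (((κ z).1 k : ℝ) : ℂ)) z -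
        ((z.2 k : ℝ) : ℂ) • (coordC k).comp (ContinuousLinearMap.fst ℝ (E d) (E d)))) z := by
  have h1 : Differentiable ℝ fun z => (S z : ℂ) :=
    Complex.ofRealCLM.differentiable.comp hS.differentiable
  refine (h1 z).hasFDerivAt.congr_fderiv (phase_clm_ext (fun j => ?_) fun j => ?_)
  · change dq j (fun z => (S z : ℂ)) z = _
    rw [dq_ofReal hS.differentiable, hS.dq_eq]
    have h2 : ∀ k, fderiv ℝ (fun z => (((κ z).1 k : ℝ) : ℂ)) z (EuclideanSpace.single j 1, 0) =
        ((dq j (fun z => (κ z).1 k) z : ℝ) : ℂ) := fun k =>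
      dq_ofReal ((hκ.contDiff_fst k).differentiable (by simp)) j z
    simp only [FunLike.coe_sum, Finset.sum_apply, FunLike.coe_sub, Pi.sub_apply, FunLike.coe_smul,
      Pi.smul_apply, h2, smul_eq_mul, Finset.sum_sub_distrib]
    push_cast
    simp only [mul_comm]
    rw [neg_add_eq_sub]
    congr 1
    simp [apply_ite]
  · change dp j (fun z => (S z : ℂ)) z = _
    rw [dp_ofReal hS.differentiable, hS.dp_eq]
    have h2 : ∀ k, fderiv ℝ (fun z => (((κ z).1 k : ℝ) : ℂ)) z (0, EuclideanSpace.single j 1) =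
        ((dp j (fun z => (κ z).1 k) z : ℝ) : ℂ) := fun k =>
      dp_ofReal ((hκ.contDiff_fst k).differentiable (by simp)) j z
    simp only [FunLike.coe_sum, Finset.sum_apply, FunLike.coe_sub, Pi.sub_apply, FunLike.coe_smul,
      Pi.smul_apply, h2, smul_eq_mul, Finset.sum_sub_distrib]
    push_cast
    simp [mul_comm]

/-- The term `Ξ · dX` of `dS` cancels the one obtained by differentiating `x - X` in `Ξ · (x - X)`.
What survives is linear in `x - X`, except for `-p · dq`. -/
theorem hasFDerivAt_outerPhase (hκ : IsCanonicalB κ) (hS : IsAction κ S)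
    (hΘx : IsAdmissibleMatrix Θx) (x : E d) (z : Phase d) :
    HasFDerivAt (outerPhase κ S Θx x)
      (∑ k, (cvec (x - (κ z).1) k • fderiv ℝ (fun z => (((κ z).2 k : ℝ) : ℂ)) z -
        (Complex.I * (Θx *ᵥ cvec (x - (κ z).1)) k) • fderiv ℝ (fun z => (((κ z).1 k : ℝ) : ℂ)) z -
        ((z.2 k : ℝ) : ℂ) • (coordC k).comp (ContinuousLinearMap.fst ℝ (E d) (E d)))) z := by
  have hs : ∀ k, HasFDerivAt (fun z => cvec (x - (κ z).1) k)
      (-fderiv ℝ (fun z => (((κ z).1 k : ℝ) : ℂ)) z) z := by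
    intro k
    have := ((hκ.differentiable_fst k) z).hasFDerivAt.const_sub ((x k : ℝ) : ℂ)
    refine this.congr_of_eventuallyEq (Filter.Eventually.of_forall fun z => ?_)
    simp [cvec]
  have h1 := ((hS.hasFDerivAt_ofReal hκ z).add (HasFDerivAt.fun_sum (u := Finset.univ) fun k _ =>
    ((hκ.differentiable_snd k) z).hasFDerivAt.mul (hs k))).add
    (hasFDerivAt_quadratic hΘx.symm hs)
  refine HasFDerivAt.congr_fderiv h1 ?_
  rw [← Finset.sum_add_distrib, ← Finset.sum_add_distrib]
  refine Finset.sum_congr rfl fun k _ => ?_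
  simp only [smul_neg]
  abel

theorem dz_outerPhase (hκ : IsCanonicalB κ) (hS : IsAction κ S)
    (hΘx : IsAdmissibleMatrix Θx) (x : E d) (j : Fin d) (z : Phase d) :
    dz Θy j (outerPhase κ S Θx x) z =
      -Complex.I * (calZ κ Θx Θy z *ᵥ cvec (x - (κ z).1)) j - (Θy⁻¹ *ᵥ cvec z.2) j := by
  have h1 : ∀ k, dzForm Θy j ((coordC k).comp (ContinuousLinearMap.fst ℝ (E d) (E d))) =
      Θy⁻¹ j k := by
    intro k
    simp [dzForm, apply_ite]
  rw [dz_eq_dzForm, (hasFDerivAt_outerPhase hκ hS hΘx x z).fderiv]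
  simp only [map_sum, map_sub, map_smul, smul_eq_mul, h1, ← dz_eq_dzForm, Finset.sum_sub_distrib]
  congr 1
  · simp only [Matrix.mulVec, dotProduct, hκ.calZ_apply hΘx, add_mul, Finset.sum_add_distrib,
      mul_add, Finset.mul_sum, Finset.sum_mul]
    have e1 : ∑ k, ∑ l, Complex.I * (Θx k l * cvec (x - (κ z).1) l) *
          dz Θy j (fun z => (((κ z).1 k : ℝ) : ℂ)) z =
        ∑ l, ∑ k, Complex.I * (Θx k l * cvec (x - (κ z).1) l) *
          dz Θy j (fun z => (((κ z).1 k : ℝ) : ℂ)) z := Finset.sum_comm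
    rw [e1, add_comm, sub_eq_add_neg]
    congr 1
    · refine Finset.sum_congr rfl fun k _ => ?_
      linear_combination (cvec (x - (κ z).1) k *
        dz Θy j (fun z => (((κ z).2 k : ℝ) : ℂ)) z) * Complex.I_mul_I
    · rw [← Finset.sum_neg_distrib]
      refine Finset.sum_congr rfl fun l _ => ?_
      rw [← Finset.sum_neg_distrib]
      refine Finset.sum_congr rfl fun k _ => ?_
      ring
  · simp only [Matrix.mulVec, dotProduct, cvec]
    exact Finset.sum_congr rfl fun k _ => mul_comm _ _

/-- This is what singles out `∂_z`: on the inner phase, `(Θ^y)⁻¹ ∂_q` gives `(Θ^y)⁻¹ p - i(y - q)`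
and `-i ∂_p` gives `i(y - q)`. The dependence on `y` cancels, so the remaining factor leaves the
integral. -/
theorem dz_packetTransform (hΘy : IsAdmissibleMatrix Θy) (hε : 0 < ε) (φ : 𝓢(E d, ℂ))
    (j : Fin d) (z : Phase d) : dz Θy j (packetTransform Θy ε φ) z =
      Complex.I / ε * (Θy⁻¹ *ᵥ cvec z.2) j * packetTransform Θy ε φ z := by
  choose ψ hψ using exists_schwartz_coord_mul φ
  rw [dz, dp_packetTransform hΘy hε hψ]
  simp only [dq_packetTransform hΘy hε hψ]
  set b : Fin d → ℂ := fun l =>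
    packetTransform Θy ε (ψ l) z - ((z.1 l : ℝ) : ℂ) * packetTransform Θy ε φ z with hb
  have h1 : (Θy⁻¹ *ᵥ (Θy *ᵥ b)) j = b j := by
    rw [Matrix.mulVec_mulVec, Matrix.nonsing_inv_mul _ hΘy.isUnit_det, Matrix.one_mulVec]
  have h2 : ∑ k, Θy⁻¹ j k * (Complex.I / ε * (((z.2 k : ℝ) : ℂ) * packetTransform Θy ε φ z -
      Complex.I * ∑ l, Θy k l * b l)) = Complex.I / ε * ((Θy⁻¹ *ᵥ cvec z.2) j *
        packetTransform Θy ε φ z - Complex.I * (Θy⁻¹ *ᵥ (Θy *ᵥ b)) j) := by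
    simp only [Matrix.mulVec, dotProduct, cvec]
    rw [Finset.sum_mul, Finset.mul_sum, ← Finset.sum_sub_distrib, Finset.mul_sum]
    exact Finset.sum_congr rfl fun k _ => by ring
  change ∑ k, Θy⁻¹ j k * (Complex.I / ε * (((z.2 k : ℝ) : ℂ) * packetTransform Θy ε φ z -
      Complex.I * ∑ l, Θy k l * b l)) - Complex.I * (-(Complex.I / ε) * b j) = _
  rw [h2, h1]
  ring

/-- The integral over `y` of the oscillating exponential against `φ`. -/
noncomputable def amplitude (κ : Phase d → Phase d) (S : Phase d → ℝ)
    (Θx Θy : Matrix (Fin d) (Fin d) ℂ) (ε : ℝ) (φ : 𝓢(E d, ℂ)) (x : E d) (z : Phase d) : ℂ :=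
  Complex.exp (Complex.I / ε * outerPhase κ S Θx x z) * packetTransform Θy ε φ z

theorem differentiable_packetTransform (hΘy : IsAdmissibleMatrix Θy) (hε : 0 < ε)
    (φ : 𝓢(E d, ℂ)) : Differentiable ℝ (packetTransform Θy ε φ) := fun z =>
  (hasFDerivAt_packetTransform hΘy hε φ z).differentiableAt

theorem hasFDerivAt_amplitude (hκ : IsCanonicalB κ) (hS : IsAction κ S)
    (hΘx : IsAdmissibleMatrix Θx) (hΘy : IsAdmissibleMatrix Θy) (hε : 0 < ε) (φ : 𝓢(E d, ℂ))
    (x : E d) (z : Phase d) : HasFDerivAt (amplitude κ S Θx Θy ε φ x)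
      (Complex.exp (Complex.I / ε * outerPhase κ S Θx x z) • fderiv ℝ (packetTransform Θy ε φ) z +
        (Complex.I / ε * amplitude κ S Θx Θy ε φ x z) • fderiv ℝ (outerPhase κ S Θx x) z) z := by
  have h1 := (hasFDerivAt_outerPhase hκ hS hΘx x z).differentiableAt.hasFDerivAt
  have h2 := (h1.const_mul (Complex.I / (ε : ℂ))).cexp.mul
    (differentiable_packetTransform hΘy hε φ z).hasFDerivAt
  refine HasFDerivAt.congr_fderiv h2 ?_
  congr 1
  rw [smul_smul, smul_smul, amplitude]
  congr 1
  ring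

/-- The amplitude satisfies `ε ∂_z g = 𝒵 (x - X) g`. -/
theorem dz_amplitude (hκ : IsCanonicalB κ) (hS : IsAction κ S)
    (hΘx : IsAdmissibleMatrix Θx) (hΘy : IsAdmissibleMatrix Θy) (hε : 0 < ε) (φ : 𝓢(E d, ℂ))
    (x : E d) (j : Fin d) (z : Phase d) : dz Θy j (amplitude κ S Θx Θy ε φ x) z =
      (ε : ℂ)⁻¹ * (calZ κ Θx Θy z *ᵥ cvec (x - (κ z).1)) j * amplitude κ S Θx Θy ε φ x z := by
  rw [dz_eq_dzForm, (hasFDerivAt_amplitude hκ hS hΘx hΘy hε φ x z).fderiv, map_add, map_smul,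
    map_smul, ← dz_eq_dzForm, ← dz_eq_dzForm, dz_packetTransform hΘy hε,
    dz_outerPhase hκ hS hΘx]
  simp only [smul_eq_mul, amplitude]
  -- The terms in `(Θ^y)⁻¹ p` from the two factors cancel, and `i · (-i) = 1`.
  linear_combination (-(ε : ℂ)⁻¹ * (calZ κ Θx Θy z *ᵥ cvec (x - (κ z).1)) j *
    (Complex.exp (Complex.I / ε * outerPhase κ S Θx x z) * packetTransform Θy ε φ z)) *
      Complex.I_mul_I

theorem isSymbol2_clm (ε₀ : ℝ) (hε₀ : ε₀ ≤ 1) (L : Phase d →L[ℝ] ℂ) :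
    IsSymbol2 ε₀ 1 (fun _ => L) := by
  refine IsSymbol.restrict (isSymbol_clm L (C := ‖L‖ * 2) (K := 1) (fun z => ?_) fun z => ?_) hε₀
  · have := one_add_norm_le_weight2 z
    refine (L.le_opNorm z).trans ?_
    rw [mul_assoc]
    refine mul_le_mul_of_nonneg_left ?_ (norm_nonneg _)
    linarith
  · rw [one_mul, weight2, Real.rpow_one]
    exact one_le_bracket2 z

theorem IsCanonicalB.symbol_cvec_sub (hκ : IsCanonicalB κ) {ε₀ : ℝ} (h0 : 0 < ε₀) (h1 : ε₀ ≤ 1)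
    (x : E d) (k : Fin d) : IsSymbol2 ε₀ 1 (fun _ z => cvec (x - (κ z).1) k) := by
  have h2 : IsSymbol2 ε₀ 1 (fun _ (_ : Phase d) => ((x k : ℝ) : ℂ)) :=
    (IsSymbol2.const _).mono zero_le_one
  exact IsSymbol.congr (h2.sub (hκ.symbol_fst h0 h1 k)) fun _ _ z => by simp [cvec]

/-- The order is not sharp in any useful way; it serves only to show polynomial growth. -/
theorem isSymbol2_fderiv_outerPhase (hκ : IsCanonicalB κ) (hS : IsAction κ S)
    (hΘx : IsAdmissibleMatrix Θx) (x : E d) {v : Phase d} :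
    IsSymbol2 1 2 (fun _ z => fderiv ℝ (outerPhase κ S Θx x) z v) := by
  have h2 : ∀ k, IsSymbol2 1 1 (fun _ z => cvec (x - (κ z).1) k) :=
    hκ.symbol_cvec_sub one_pos le_rfl x
  have e : (1 : ℝ) + 1 = 2 := by norm_num
  have h3 : ∀ k, IsSymbol2 1 1
      (fun _ z => fderiv ℝ (fun z => (((κ z).2 k : ℝ) : ℂ)) z v) := fun k =>
    IsSymbol.fderiv_apply (hκ.symbol_snd one_pos le_rfl k) v
  have h4 : ∀ k, IsSymbol2 1 1
      (fun _ z => fderiv ℝ (fun z => (((κ z).1 k : ℝ) : ℂ)) z v) := fun k =>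
    IsSymbol.fderiv_apply (hκ.symbol_fst one_pos le_rfl k) v
  have h5 := IsSymbol2.sum (s := Finset.univ) fun k _ =>
    (((h2 k).mul (h3 k)).sub (((IsSymbol2.sum (s := Finset.univ) fun l _ =>
      (h2 l).const_mul (Θx k l)).const_mul Complex.I).mul (h4 k))).sub
      (((isSymbol2_clm 1 le_rfl ((coordC k).comp (ContinuousLinearMap.snd ℝ (E d) (E d)))).mono
        (m' := 1 + 1) (by norm_num)).const_mul
          ((coordC k).comp (ContinuousLinearMap.fst ℝ (E d) (E d)) v))
  rw [e] at h5
  refine IsSymbol.congr h5 fun _ _ z => ?_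
  rw [(hasFDerivAt_outerPhase hκ hS hΘx x z).fderiv]
  simp only [FunLike.coe_sum, Finset.sum_apply, FunLike.coe_sub, Pi.sub_apply, FunLike.coe_smul,
      Pi.smul_apply, smul_eq_mul, Matrix.mulVec, dotProduct]
  refine Finset.sum_congr rfl fun k _ => ?_
  congr 1
  exact mul_comm _ _

theorem packetTransform_rapid_dq (hΘy : IsAdmissibleMatrix Θy) (hε : 0 < ε) (φ : 𝓢(E d, ℂ))
    (k : Fin d) : RapidlyDecreasing (dq k (packetTransform Θy ε φ)) := by
  choose ψ hψ using exists_schwartz_coord_mul φ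
  have hq : ∀ l : Fin d, PolyBounded fun z : Phase d => ((z.1 l : ℝ) : ℂ) := fun l =>
    (isSymbol2_clm 1 le_rfl ((coordC l).comp
      (ContinuousLinearMap.fst ℝ (E d) (E d)))).polyBounded (ε := 1) ⟨one_pos, le_rfl⟩
  have hp : ∀ l : Fin d, PolyBounded fun z : Phase d => ((z.2 l : ℝ) : ℂ) := fun l =>
    (isSymbol2_clm 1 le_rfl ((coordC l).comp
      (ContinuousLinearMap.snd ℝ (E d) (E d)))).polyBounded (ε := 1) ⟨one_pos, le_rfl⟩
  have hr := fun χ => packetTransform_rapid (d := d) hΘy hε χ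
  have h1 := (((hp k).mul_rapidlyDecreasing (hr φ)).add
    ((RapidlyDecreasing.sum (s := Finset.univ) fun l _ => ((hr (ψ l)).add
      (((hq l).mul_rapidlyDecreasing (hr φ)).const_mul (-1))).const_mul
        (Θy k l)).const_mul (-Complex.I))).const_mul (Complex.I / ε)
  refine h1.of_norm_le fun z => le_of_eq ?_
  rw [dq_packetTransform hΘy hε hψ]
  simp only [neg_mul, one_mul, sub_eq_add_neg]

theorem packetTransform_rapid_dp (hΘy : IsAdmissibleMatrix Θy) (hε : 0 < ε) (φ : 𝓢(E d, ℂ))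
    (k : Fin d) : RapidlyDecreasing (dp k (packetTransform Θy ε φ)) := by
  choose ψ hψ using exists_schwartz_coord_mul φ
  have hq : ∀ l : Fin d, PolyBounded fun z : Phase d => ((z.1 l : ℝ) : ℂ) := fun l =>
    (isSymbol2_clm 1 le_rfl ((coordC l).comp
      (ContinuousLinearMap.fst ℝ (E d) (E d)))).polyBounded (ε := 1) ⟨one_pos, le_rfl⟩
  have hr := fun χ => packetTransform_rapid (d := d) hΘy hε χ
  have h1 := ((hr (ψ k)).add (((hq k).mul_rapidlyDecreasing (hr φ)).const_mul (-1))).const_mul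
    (-(Complex.I / ε))
  refine h1.of_norm_le fun z => le_of_eq ?_
  rw [dp_packetTransform hΘy hε hψ]
  simp only [neg_mul, one_mul, sub_eq_add_neg]

/-- The exponential of the outer phase has norm at most one and its logarithmic derivatives grow
polynomially, so rapid decrease passes from the transform to the product. -/
theorem isTestAmplitude_amplitude (hκ : IsCanonicalB κ) (hS : IsAction κ S)
    (hΘx : IsAdmissibleMatrix Θx) (hΘy : IsAdmissibleMatrix Θy) (hε : 0 < ε) (φ : 𝓢(E d, ℂ))
    (x : E d) : IsTestAmplitude (amplitude κ S Θx Θy ε φ x) := by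
  have hle : ∀ (f : Phase d → ℂ) z,
      ‖Complex.exp (Complex.I / ε * outerPhase κ S Θx x z) * f z‖ ≤ ‖f z‖ := fun f z => by
    rw [norm_mul]
    exact mul_le_of_le_one_left (norm_nonneg _) (norm_exp_outerPhase_le hΘx κ S x hε z)
  have hr : RapidlyDecreasing (amplitude κ S Θx Θy ε φ x) :=
    (packetTransform_rapid hΘy hε φ).of_norm_le (hle _)
  have hd : ∀ v : Phase d, RapidlyDecreasing (fun z => fderiv ℝ (packetTransform Θy ε φ) z v) →
      RapidlyDecreasing (fun z => fderiv ℝ (amplitude κ S Θx Θy ε φ x) z v) := by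
    intro v hv
    have h1 := (hv.of_norm_le (hle _)).add ((((isSymbol2_fderiv_outerPhase hκ hS hΘx x
      (v := v)).polyBounded (ε := 1) ⟨one_pos, le_rfl⟩).mul_rapidlyDecreasing hr).const_mul
        (Complex.I / ε))
    refine h1.of_norm_le fun z => le_of_eq ?_
    rw [(hasFDerivAt_amplitude hκ hS hΘx hΘy hε φ x z).fderiv]
    simp only [FunLike.coe_add, Pi.add_apply, FunLike.coe_smul, Pi.smul_apply, smul_eq_mul]
    congr 2
    ring
  exact ⟨fun z => (hasFDerivAt_amplitude hκ hS hΘx hΘy hε φ x z).differentiableAt, hr,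
    fun k => hd _ (packetTransform_rapid_dq hΘy hε φ k),
    fun k => hd _ (packetTransform_rapid_dp hΘy hε φ k)⟩

end Amplitude

/-! ### Membership in the class of symbols in all variables -/

section FullSymbols

variable {d : ℕ} {ε₀ m m' : ℝ}

theorem one_le_bracket4 (z : Full d) :
    1 ≤ Real.sqrt (1 + ‖z.1‖ ^ 2 + ‖z.2.1‖ ^ 2 + ‖z.2.2.1‖ ^ 2 + ‖z.2.2.2‖ ^ 2) := by
  rw [Real.one_le_sqrt]
  nlinarith [sq_nonneg ‖z.1‖, sq_nonneg ‖z.2.1‖, sq_nonneg ‖z.2.2.1‖, sq_nonneg ‖z.2.2.2‖]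

theorem weight4_pos (m : ℝ) (z : Full d) : 0 < weight4 m z :=
  Real.rpow_pos_of_pos (one_pos.trans_le (one_le_bracket4 z)) m

theorem IsSymbol4.mul {u v : ℝ → Full d → ℂ} (hu : IsSymbol4 ε₀ u) (hv : IsSymbol4 ε₀ v) :
    IsSymbol4 ε₀ (fun ε w => u ε w * v ε w) := by
  obtain ⟨m, hu⟩ := hu
  obtain ⟨m', hv⟩ := hv
  refine ⟨m + m', ?_⟩
  have := hu.mul hv
  refine this.mono 1 (fun z => (mul_pos (weight4_pos m z) (weight4_pos m' z)).le) fun z => ?_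
  rw [one_mul]
  exact (Real.rpow_add (one_pos.trans_le (one_le_bracket4 z)) m m').ge

theorem IsSymbol4.add {u v : ℝ → Full d → ℂ} (hu : IsSymbol4 ε₀ u) (hv : IsSymbol4 ε₀ v) :
    IsSymbol4 ε₀ (fun ε w => u ε w + v ε w) := by
  obtain ⟨m, hu⟩ := hu
  obtain ⟨m', hv⟩ := hv
  refine ⟨max m m', IsSymbol.add (hu.mono 1 (fun z => (weight4_pos m z).le) fun z => ?_)
    (hv.mono 1 (fun z => (weight4_pos m' z).le) fun z => ?_)⟩
  · rw [one_mul]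
    exact Real.rpow_le_rpow_of_exponent_le (one_le_bracket4 z) (le_max_left _ _)
  · rw [one_mul]
    exact Real.rpow_le_rpow_of_exponent_le (one_le_bracket4 z) (le_max_right _ _)

theorem IsSymbol4.const {c : ℝ → ℂ} {K : ℝ} (hc : ∀ ε ∈ Ioc 0 ε₀, ‖c ε‖ ≤ K) :
    IsSymbol4 ε₀ (fun ε (_ : Full d) => c ε) :=
  ⟨0, (isSymbol_const c K hc).mono 1 (fun _ => zero_le_one) fun z => by simp [weight4]⟩

theorem IsSymbol4.sum {ι : Type*} {s : Finset ι} {f : ι → ℝ → Full d → ℂ}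
    (h : ∀ i ∈ s, IsSymbol4 ε₀ (f i)) : IsSymbol4 ε₀ (fun ε w => ∑ i ∈ s, f i ε w) := by
  classical
  induction s using Finset.induction_on with
  | empty => simpa using IsSymbol4.const (ε₀ := ε₀) (c := fun _ => 0) (K := 0) (by simp)
  | insert i s hi ih =>
    simp only [Finset.sum_insert hi]
    exact (h i (by simp)).add (ih fun j hj => h j (by simp [hj]))

theorem IsSymbol2.isSymbol4 {u : ℝ → Phase d → ℂ} (hu : IsSymbol2 ε₀ m u) :
    IsSymbol4 ε₀ (fun ε w => u ε w.2.2) := by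
  -- Enlarging the bracket by `x` and `y` increases the weight only for a nonnegative exponent.
  refine ⟨|m|, ?_⟩
  have h := IsSymbol.comp_affine hu ((ContinuousLinearMap.snd ℝ (E d) (Phase d)).comp
    (ContinuousLinearMap.snd ℝ (E d) (E d × Phase d))) 0
  simp only [ContinuousLinearMap.comp_apply, ContinuousLinearMap.coe_snd', add_zero] at h
  refine h.mono 1 (fun z => (weight2_pos m _).le) fun z => ?_
  rw [one_mul]
  refine (weight2_mono (le_abs_self m) _).trans ?_
  refine Real.rpow_le_rpow (Real.sqrt_nonneg _) (Real.sqrt_le_sqrt ?_) (abs_nonneg m)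
  nlinarith [sq_nonneg ‖z.1‖, sq_nonneg ‖z.2.1‖]

theorem isSymbol4_coord (h1 : ε₀ ≤ 1) (k : Fin d) :
    IsSymbol4 ε₀ (fun _ (w : Full d) => ((w.1 k : ℝ) : ℂ)) := by
  refine ⟨1, IsSymbol.restrict (isSymbol_clm ((coordC k).comp
    (ContinuousLinearMap.fst ℝ (E d) (E d × Phase d))) (C := 1) (K := 1) (fun z => ?_)
      fun z => ?_) h1⟩
  · rw [one_mul, weight4, Real.rpow_one]
    have : ‖(coordC k).comp (ContinuousLinearMap.fst ℝ (E d) (E d × Phase d)) z‖ ≤ ‖z.1‖ := by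
      rw [ContinuousLinearMap.comp_apply, ContinuousLinearMap.coe_fst', coordC_apply,
        Complex.norm_real]
      exact PiLp.norm_apply_le _ k
    refine this.trans (Real.le_sqrt_of_sq_le ?_)
    nlinarith [sq_nonneg ‖z.2.1‖, sq_nonneg ‖z.2.2.1‖, sq_nonneg ‖z.2.2.2‖]
  · rw [one_mul, weight4, Real.rpow_one]
    exact one_le_bracket4 z

theorem IsCanonicalB.symbol4_cvec_sub {κ : Phase d ≃ Phase d} (hκ : IsCanonicalB κ) (h0 : 0 < ε₀)
    (h1 : ε₀ ≤ 1) (k : Fin d) :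
    IsSymbol4 ε₀ (fun _ (w : Full d) => cvec (w.1 - (κ w.2.2).1) k) := by
  have h2 := (isSymbol4_coord (d := d) h1 k).add ((IsSymbol4.const (c := fun _ => (-1 : ℂ)) (K := 1)
    (by simp)).mul (hκ.symbol_fst h0 h1 k).isSymbol4)
  obtain ⟨M, h2⟩ := h2
  exact ⟨M, h2.congr fun _ _ w => by simp [cvec, sub_eq_add_neg]⟩

theorem isSymbol4_quadPoly_mul {κ : Phase d ≃ Phase d} (hκ : IsCanonicalB κ) (h0 : 0 < ε₀)
    (h1 : ε₀ ≤ 1) {mP mu : ℝ} {α : ℝ → Phase d → ℂ} {a : ℝ → Phase d → Fin d → ℂ}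
    {A : ℝ → Phase d → Matrix (Fin d) (Fin d) ℂ} {u : ℝ → Phase d → ℂ}
    (hα : IsSymbol2 ε₀ mP α) (ha : ∀ j, IsSymbol2 ε₀ mP (fun ε z => a ε z j))
    (hA : ∀ j k, IsSymbol2 ε₀ mP (fun ε z => A ε z j k)) (hu : IsSymbol2 ε₀ mu u) :
    IsSymbol4 ε₀ (fun ε w => quadPoly (α ε) (a ε) (A ε) w.2.2 (w.1 - (κ w.2.2).1) *
      u ε w.2.2) := by
  have hs := hκ.symbol4_cvec_sub h0 h1
  have hAs : ∀ k, IsSymbol4 ε₀ (fun ε w => (A ε w.2.2 *ᵥ cvec (w.1 - (κ w.2.2).1)) k) :=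
    fun k => by
      simp only [Matrix.mulVec, dotProduct]
      exact IsSymbol4.sum fun l _ => (hA k l).isSymbol4.mul (hs l)
  refine IsSymbol4.mul (IsSymbol4.add (hα.isSymbol4.add ?_) ?_) hu.isSymbol4
  · exact IsSymbol4.sum fun k _ => (ha k).isSymbol4.mul (hs k)
  · exact IsSymbol4.sum fun k _ => (hs k).mul (hAs k)

end FullSymbols

/-! ### Trading `x - X` for powers of `ε` -/

section Equivalence

variable {d : ℕ} {Θx Θy : Matrix (Fin d) (Fin d) ℂ} {ε ε₀ : ℝ} {κ : Phase d ≃ Phase d}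
  {S : Phase d → ℝ}

/-- A factor `x - X` may be traded for `-ε` times a divergence. -/
theorem integral_dotProduct_mul_amplitude (hκ : IsCanonicalB κ) (hS : IsAction κ S)
    (hΘx : IsAdmissibleMatrix Θx) (hΘy : IsAdmissibleMatrix Θy) (h1 : ε₀ ≤ 1)
    (hε : ε ∈ Ioc 0 ε₀) (φ : 𝓢(E d, ℂ)) (x : E d) {m : ℝ} {b : ℝ → Phase d → Fin d → ℂ}
    (hb : ∀ j, IsSymbol2 ε₀ m (fun ε z => b ε z j)) :
    ∫ z, (b ε z ⬝ᵥ cvec (x - (κ z).1)) * amplitude κ S Θx Θy ε φ x z =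
      -ε * ∫ z, divz Θy (fun z => b ε z ᵥ* (calZ κ Θx Θy z)⁻¹) z *
        amplitude κ S Θx Θy ε φ x z := by
  have hg := isTestAmplitude_amplitude hκ hS hΘx hΘy hε.1 φ x
  have hεC : (ε : ℂ) ≠ 0 := by exact_mod_cast hε.1.ne'
  have hB := isSymbol2_smul_vecMul_calZ_inv hκ hΘx hΘy h1 hb
  have e1 : ∀ z, (b ε z ⬝ᵥ cvec (x - (κ z).1)) * amplitude κ S Θx Θy ε φ x z =
      ε * ∑ j, (b ε z ᵥ* (calZ κ Θx Θy z)⁻¹) j * dz Θy j (amplitude κ S Θx Θy ε φ x) z := by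
    intro z
    -- Inserting `𝒵⁻¹ 𝒵` brings out `𝒵 (x - X)`, which on the amplitude is `ε ∂_z`.
    have e2 : b ε z ⬝ᵥ cvec (x - (κ z).1) = (b ε z ᵥ* (calZ κ Θx Θy z)⁻¹) ⬝ᵥ
        (calZ κ Θx Θy z *ᵥ cvec (x - (κ z).1)) := by
      rw [← Matrix.dotProduct_mulVec, Matrix.mulVec_mulVec,
        Matrix.nonsing_inv_mul _ (isUnit_det_calZ hκ hΘx hΘy z), Matrix.one_mulVec]
    rw [e2, dotProduct, Finset.sum_mul, Finset.mul_sum]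
    refine Finset.sum_congr rfl fun j _ => ?_
    rw [dz_amplitude hκ hS hΘx hΘy hε.1]
    field_simp
  have h2 := fun j => hg.integral_mul_dz (hB j) hε Θy j
  simp only [e1]
  rw [integral_const_mul, integral_finsetSum _ fun j _ => (h2 j).1]
  simp only [(h2 _).2, divz, Finset.sum_mul]
  rw [integral_finsetSum _ fun j _ => hg.integrable_mul ((hB j).dz Θy j) hε,
    Finset.sum_neg_distrib]
  ring

/-- Leibniz' rule: derivatives of `C` keep a factor `x - X`, while those of `x - X` give `-X_z` and
are collected in the trace. -/
theorem divz_dotProduct_expansion (hκ : IsCanonicalB κ) (x : E d)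
    {C : Phase d → Matrix (Fin d) (Fin d) ℂ} (hC : ∀ j k, Differentiable ℝ fun z => C z j k)
    (z : Phase d) : divz Θy (fun z => cvec (x - (κ z).1) ᵥ* C z) z =
      (∑ k, fun i => dz Θy k (fun z => C z i k) z) ⬝ᵥ cvec (x - (κ z).1) -
        (Xz κ Θy z * C z).trace := by
  have hs : ∀ k, Differentiable ℝ fun z => cvec (x - (κ z).1) k := fun k => by
    have := (hκ.differentiable_fst k).const_sub ((x k : ℝ) : ℂ)
    simpa [cvec] using this
  have hds : ∀ j k, dz Θy j (fun z => cvec (x - (κ z).1) k) z = -Xz κ Θy z j k := fun j k => by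
    have := dz_const_sub (Θy := Θy) (hκ.differentiable_fst k) ((x k : ℝ) : ℂ) j z
    simpa [cvec, Xz] using this
  have hcol : ∀ j, dz Θy j (fun z => ∑ i, cvec (x - (κ z).1) i * C z i j) z =
      (∑ i, dz Θy j (fun z => C z i j) z * cvec (x - (κ z).1) i) -
        ∑ i, Xz κ Θy z j i * C z i j := fun j => by
    rw [dz_sum (f := fun i z => cvec (x - (κ z).1) i * C z i j) fun i _ => (hs i).mul (hC i j),
      ← Finset.sum_sub_distrib]
    refine Finset.sum_congr rfl fun i _ => ?_
    rw [dz_mul (hs i) (hC i j), hds]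
    ring
  simp only [divz, Matrix.vecMul, dotProduct, Matrix.trace, Matrix.diag_apply, Matrix.mul_apply,
    hcol, Finset.sum_sub_distrib, Finset.sum_apply, Finset.sum_mul]
  rw [Finset.sum_comm]

theorem divz_sum_vecMul {ι : Type*} {s : Finset ι} {b : ι → Phase d → Fin d → ℂ}
    {M : Phase d → Matrix (Fin d) (Fin d) ℂ}
    (h : ∀ i ∈ s, ∀ j, Differentiable ℝ fun z => (b i z ᵥ* M z) j) (z : Phase d) :
    divz Θy (fun z => (∑ i ∈ s, b i z) ᵥ* M z) z =
      ∑ i ∈ s, divz Θy (fun z => b i z ᵥ* M z) z := by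
  simp only [divz]
  rw [Finset.sum_comm]
  refine Finset.sum_congr rfl fun j _ => ?_
  rw [← dz_sum fun i hi => h i hi j]
  congr 1
  ext z
  rw [Matrix.sum_vecMul, Finset.sum_apply]

/-- One integration by parts handles the linear term. For the quadratic term it leaves `ε` times the
trace part of `v₁` and a linear remainder `-ε b₃ · (x - X)`; the second one turns this into `ε² div
(b₃^† 𝒵⁻¹)`, which is `ε² v₂`. -/
theorem integral_quadPoly_mul_amplitude (hκ : IsCanonicalB κ) (hS : IsAction κ S)
    (hΘx : IsAdmissibleMatrix Θx) (hΘy : IsAdmissibleMatrix Θy) (h0 : 0 < ε₀) (h1 : ε₀ ≤ 1)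
    (hε : ε ∈ Ioc 0 ε₀) (φ : 𝓢(E d, ℂ)) (x : E d) {mP mu : ℝ}
    {α : ℝ → Phase d → ℂ} {a : ℝ → Phase d → Fin d → ℂ}
    {A : ℝ → Phase d → Matrix (Fin d) (Fin d) ℂ} {u : ℝ → Phase d → ℂ}
    (hα : IsSymbol2 ε₀ mP α) (ha : ∀ j, IsSymbol2 ε₀ mP (fun ε z => a ε z j))
    (hA : ∀ j k, IsSymbol2 ε₀ mP (fun ε z => A ε z j k)) (hu : IsSymbol2 ε₀ mu u) :
    ∫ z, quadPoly (α ε) (a ε) (A ε) z (x - (κ z).1) * u ε z * amplitude κ S Θx Θy ε φ x z =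
      ∫ z, (v0 (α ε) (u ε) z + (ε : ℂ) * v1 κ Θx Θy (a ε) (A ε) (u ε) z +
        (ε : ℂ) ^ 2 * v2 κ Θx Θy (A ε) (u ε) z) * amplitude κ S Θx Θy ε φ x z := by
  have hg := isTestAmplitude_amplitude hκ hS hΘx hΘy hε.1 φ x
  set g := amplitude κ S Θx Θy ε φ x with hgdef
  have hs := hκ.symbol_cvec_sub h0 h1 x
  -- the linear term
  set b₁ : ℝ → Phase d → Fin d → ℂ := fun ε z => u ε z • a ε z with hb₁
  have hb₁s : ∀ j, IsSymbol2 ε₀ (mu + mP) (fun ε z => b₁ ε z j) := fun j => hu.mul (ha j)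
  have hI₁ := integral_dotProduct_mul_amplitude hκ hS hΘx hΘy h1 hε φ x hb₁s
  -- the quadratic term
  set b₂ : ℝ → Phase d → Fin d → ℂ := fun ε z => u ε z • (cvec (x - (κ z).1) ᵥ* A ε z) with hb₂
  have hb₂s : ∀ j, IsSymbol2 ε₀ (mu + (1 + mP)) (fun ε z => b₂ ε z j) := fun j => by
    have : IsSymbol2 ε₀ (1 + mP) (fun ε z => (cvec (x - (κ z).1) ᵥ* A ε z) j) := by
      simp only [Matrix.vecMul, dotProduct]
      exact IsSymbol2.sum fun i _ => (hs i).mul (hA i j)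
    exact hu.mul this
  have hI₂ := integral_dotProduct_mul_amplitude hκ hS hΘx hΘy h1 hε φ x hb₂s
  -- the remaining linear term after one integration by parts
  set C : ℝ → Phase d → Matrix (Fin d) (Fin d) ℂ := fun ε z =>
    u ε z • (A ε z * (calZ κ Θx Θy z)⁻¹) with hC
  have hCs : ∀ i k, IsSymbol2 ε₀ (mP + mu) (fun ε z => C ε z i k) := fun i k => by
    have := isSymbol2_smul_mul_calZ_inv_mulVec hκ hΘx hΘy h1 hA hu k i
    simpa [hC, Matrix.mulVec_single_one] using this
  set b₃ : ℝ → Phase d → Fin d → ℂ := fun ε z =>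
    ∑ k, fun i => dz Θy k (fun z => C ε z i k) z with hb₃
  have hb₃s : ∀ j, IsSymbol2 ε₀ (mP + mu) (fun ε z => b₃ ε z j) := fun j => by
    simp only [hb₃, Finset.sum_apply]
    exact IsSymbol2.sum fun k _ => (hCs j k).dz Θy k
  have hI₃ := integral_dotProduct_mul_amplitude hκ hS hΘx hΘy h1 hε φ x hb₃s
  have hdiv₂ : ∀ z, divz Θy (fun z => b₂ ε z ᵥ* (calZ κ Θx Θy z)⁻¹) z =
      b₃ ε z ⬝ᵥ cvec (x - (κ z).1) -
        ((calZ κ Θx Θy z)⁻¹ * Xz κ Θy z * A ε z).trace * u ε z := by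
    intro z
    have e1 : (fun z => b₂ ε z ᵥ* (calZ κ Θx Θy z)⁻¹) =
        fun z => cvec (x - (κ z).1) ᵥ* C ε z := by
      ext1 z
      simp only [hb₂, hC]
      rw [Matrix.smul_vecMul, Matrix.vecMul_vecMul, Matrix.vecMul_smul]
    rw [e1, divz_dotProduct_expansion hκ x fun i k => (hCs i k).differentiable hε]
    congr 1
    simp only [hC]
    -- Cyclicity of the trace moves `𝒵⁻¹` to the front.
    rw [Matrix.mul_smul, Matrix.trace_smul, smul_eq_mul, mul_comm, ← Matrix.mul_assoc,
      Matrix.trace_mul_comm, Matrix.mul_assoc]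
  have hv2 : ∀ z, divz Θy (fun z => b₃ ε z ᵥ* (calZ κ Θx Θy z)⁻¹) z =
      v2 κ Θx Θy (A ε) (u ε) z := by
    intro z
    simp only [hb₃]
    rw [divz_sum_vecMul fun k _ j => (isSymbol2_smul_vecMul_calZ_inv hκ hΘx hΘy h1
      (fun i => (hCs i k).dz Θy k) j).differentiable hε]
    simp only [v2, Matrix.mulVec_single_one, hC]
    rfl
  have hv1 : ∀ z, v1 κ Θx Θy (a ε) (A ε) (u ε) z =
      -divz Θy (fun z => b₁ ε z ᵥ* (calZ κ Θx Θy z)⁻¹) z +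
        ((calZ κ Θx Θy z)⁻¹ * Xz κ Θy z * A ε z).trace * u ε z := by
    intro z
    simp only [v1, hb₁, Matrix.smul_vecMul]
  -- integrability of all terms
  have hdot : ∀ {m : ℝ} {b : ℝ → Phase d → Fin d → ℂ},
      (∀ j, IsSymbol2 ε₀ m (fun ε z => b ε z j)) →
      Integrable fun z => (b ε z ⬝ᵥ cvec (x - (κ z).1)) * g z := fun hb =>
    hg.integrable_mul (IsSymbol2.sum fun j _ => (hb j).mul (hs j)) hε
  have i0 : Integrable fun z => v0 (α ε) (u ε) z * g z := hg.integrable_mul (isSymbol2_v0 hα hu) hε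
  have i1 : Integrable fun z => v1 κ Θx Θy (a ε) (A ε) (u ε) z * g z :=
    hg.integrable_mul (isSymbol2_v1 hκ hΘx hΘy h1 ha hA hu) hε
  have i2 : Integrable fun z => v2 κ Θx Θy (A ε) (u ε) z * g z :=
    hg.integrable_mul (isSymbol2_v2 hκ hΘx hΘy h1 hA hu) hε
  have id₁ : Integrable fun z => divz Θy (fun z => b₁ ε z ᵥ* (calZ κ Θx Θy z)⁻¹) z * g z :=
    hg.integrable_mul (IsSymbol2.divz
      (isSymbol2_smul_vecMul_calZ_inv hκ hΘx hΘy h1 hb₁s) Θy) hε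
  have itr : Integrable fun z =>
      ((calZ κ Θx Θy z)⁻¹ * Xz κ Θy z * A ε z).trace * u ε z * g z := by
    -- The trace term is what remains of `v₁` when its divergence part is cancelled.
    refine (i1.add id₁).congr (Filter.Eventually.of_forall fun z => ?_)
    simp only [Pi.add_apply, hv1]
    ring
  have e1 : ∫ z, v1 κ Θx Θy (a ε) (A ε) (u ε) z * g z =
      -(∫ z, divz Θy (fun z => b₁ ε z ᵥ* (calZ κ Θx Θy z)⁻¹) z * g z) +
        ∫ z, ((calZ κ Θx Θy z)⁻¹ * Xz κ Θy z * A ε z).trace * u ε z * g z := by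
    rw [neg_add_eq_sub, ← integral_sub itr id₁]
    congr 1; ext z
    rw [hv1]; ring
  have e2 : ∫ z, divz Θy (fun z => b₂ ε z ᵥ* (calZ κ Θx Θy z)⁻¹) z * g z =
      (∫ z, (b₃ ε z ⬝ᵥ cvec (x - (κ z).1)) * g z) -
        ∫ z, ((calZ κ Θx Θy z)⁻¹ * Xz κ Θy z * A ε z).trace * u ε z * g z := by
    rw [← integral_sub (hdot hb₃s) itr]
    congr 1; ext z
    rw [hdiv₂]; ring
  have hlhs : ∀ z, quadPoly (α ε) (a ε) (A ε) z (x - (κ z).1) * u ε z * g z =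
      v0 (α ε) (u ε) z * g z + (b₁ ε z ⬝ᵥ cvec (x - (κ z).1)) * g z +
        (b₂ ε z ⬝ᵥ cvec (x - (κ z).1)) * g z := by
    intro z
    simp only [quadPoly, v0, hb₁, hb₂, smul_dotProduct, smul_eq_mul]
    rw [← Matrix.dotProduct_mulVec]
    ring
  have hrhs : ∀ z, (v0 (α ε) (u ε) z + (ε : ℂ) * v1 κ Θx Θy (a ε) (A ε) (u ε) z +
        (ε : ℂ) ^ 2 * v2 κ Θx Θy (A ε) (u ε) z) * g z =
      v0 (α ε) (u ε) z * g z + (ε : ℂ) * (v1 κ Θx Θy (a ε) (A ε) (u ε) z * g z) +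
        (ε : ℂ) ^ 2 * (v2 κ Θx Θy (A ε) (u ε) z * g z) := fun z => by ring
  simp only [hlhs, hrhs]
  have j1 : Integrable fun z =>
      v0 (α ε) (u ε) z * g z + (b₁ ε z ⬝ᵥ cvec (x - (κ z).1)) * g z := i0.add (hdot hb₁s)
  have j2 : Integrable fun z => v0 (α ε) (u ε) z * g z +
      (ε : ℂ) * (v1 κ Θx Θy (a ε) (A ε) (u ε) z * g z) := i0.add (i1.const_mul _)
  rw [integral_add j1 (hdot hb₂s), integral_add i0 (hdot hb₁s),
    integral_add j2 (i2.const_mul _), integral_add i0 (i1.const_mul _),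
    integral_const_mul, integral_const_mul, hI₁, hI₂, e1, e2, hI₃]
  simp only [hv2]
  ring

end Equivalence

end SemiclassicalFIO

/-! ### Proof of the proposition -/

open SemiclassicalFIO in
theorem proposition3p5 (d : ℕ) (κ : Phase d ≃ Phase d) (hκ : IsCanonicalB κ)
    (S : Phase d → ℝ) (hS : IsAction κ S)
    (Θx Θy : Matrix (Fin d) (Fin d) ℂ) (hΘx : IsAdmissibleMatrix Θx) (hΘy : IsAdmissibleMatrix Θy)
    (ε₀ : ℝ) (hε₀ : 0 < ε₀) (hε₁ : ε₀ ≤ 1) (mP mu : ℝ)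
    (α : ℝ → Phase d → ℂ) (a : ℝ → Phase d → Fin d → ℂ)
    (A : ℝ → Phase d → Matrix (Fin d) (Fin d) ℂ) (u : ℝ → Phase d → ℂ)
    (hα : IsSymbol2 ε₀ mP α)
    (ha : ∀ j, IsSymbol2 ε₀ mP (fun ε z => a ε z j))
    (hA : ∀ j k, IsSymbol2 ε₀ mP (fun ε z => A ε z j k))
    (hu : IsSymbol2 ε₀ mu u) :
    IsSymbol2 ε₀ (mP + mu) (fun ε => v0 (α ε) (u ε)) ∧
    IsSymbol2 ε₀ (mP + mu) (fun ε => v1 κ Θx Θy (a ε) (A ε) (u ε)) ∧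
    IsSymbol2 ε₀ (mP + mu) (fun ε => v2 κ Θx Θy (A ε) (u ε)) ∧
    SymbolEquiv κ S Θx Θy ε₀
      (fun ε w => quadPoly (α ε) (a ε) (A ε) w.2.2 (w.1 - (κ w.2.2).1) * u ε w.2.2)
      (fun ε w => v0 (α ε) (u ε) w.2.2
        + (ε : ℂ) * v1 κ Θx Θy (a ε) (A ε) (u ε) w.2.2
        + (ε : ℂ) ^ 2 * v2 κ Θx Θy (A ε) (u ε) w.2.2) := by
  have h0 := isSymbol2_v0 hα hu
  have h1 := isSymbol2_v1 hκ hΘx hΘy hε₁ ha hA hu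
  have h2 := isSymbol2_v2 hκ hΘx hΘy hε₁ hA hu
  refine ⟨h0, h1, h2, ⟨isSymbol4_quadPoly_mul hκ hε₀ hε₁ hα ha hA hu, ?_, ?_⟩⟩
  -- Since `ε ≤ 1`, the powers of `ε` are bounded constants, so the expansion is a symbol uniformly
  -- in `ε`.
  · have hc : ∀ ε ∈ Ioc 0 ε₀, ‖(ε : ℂ)‖ ≤ 1 := fun ε hε => by
      rw [Complex.norm_real, Real.norm_of_nonneg hε.1.le]
      exact hε.2.trans hε₁
    refine IsSymbol4.add (h0.isSymbol4.add (IsSymbol4.mul (IsSymbol4.const hc) h1.isSymbol4))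
      (IsSymbol4.mul (IsSymbol4.const (K := 1) fun ε hε => ?_) h2.isSymbol4)
    rw [norm_pow]
    exact pow_le_one₀ (norm_nonneg _) (hc ε hε)
  · intro m m' n n' hl hn hr hn' ε hε φ x
    have hSc := hS.differentiable.continuous
    refine ⟨integrable_fioIntegrand hκ hSc hΘx hΘy hl hε hn φ x,
      integrable_fioIntegrand hκ hSc hΘx hΘy hr hε hn' φ x, ?_⟩
    rw [fio_eq hκ hSc hΘx hΘy hl hε hn, fio_eq hκ hSc hΘx hΘy hr hε hn']
    congr 1
    have key := integral_quadPoly_mul_amplitude hκ hS hΘx hΘy hε₀ hε₁ hε φ x hα ha hA hu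
    -- Neither symbol depends on `y`, so each leaves the inner integral and both operators become
    -- pairings with the same amplitude.
    have hpull : ∀ (c : ℂ) (z : Phase d),
        Complex.exp (Complex.I / ε * outerPhase κ S Θx x z) *
          ∫ y, Complex.exp (Complex.I / ε * innerPhase Θy (z.1, z.2, y)) * (c * φ y) =
        c * amplitude κ S Θx Θy ε φ x z := by
      intro c z
      rw [amplitude, packetTransform, ← integral_const_mul, ← integral_const_mul,
        ← integral_const_mul]
      congr 1; ext y
      ring
    simp only [hpull]
    exact key
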